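/- Let $s\in(0,1)$, $a=1-2s$, and let $S^2_+=\{(\cos\theta\cos\phi,\cos\theta\sin\phi,\sin\theta): \theta\in(0,\pi/2),\ \phi\in\mathbb R/2\pi\mathbb Z\}$ be the open upper hemisphere, with height $y=\sin\theta$ and boundary circle $S^1=\{\theta=0\}$. Let $H^{1;a}(S^2_+)$ be the space of functions $u$ on $S^2_+$ with a weak tangential gradient such that $\int_{S^2_+}y^a(u^2+|\nabla_{S^2}u|^2)<\infty$, and let $\mathcal R^a(u)=\int_{S^2_+}y^a|\nabla_{S^2}u|^2\big/\int_{S^2_+}y^au^2$ for $u\neq0$. For measurable $\omega\subset S^1$ let $H^{1;a}_\omega(S^2_+)$ be the subspace of those $u$ whose trace vanishes a.e. on $S^1\setminus\omega$, and put $\lambda_1^s(\omega)=\inf\{\mathcal R^a(u): u\in H^{1;a}_\omega(S^2_+)\setminus\{0\}\}$. For an integer $k\ge1$ let $T_k=2\pi/k$, let $\sigma_i$ ($i=1,\dots,k$) be the reflection $\phi\mapsto(i-1)T_k-\phi$ (with $\theta$ fixed), and let $\mathcal A_k$ be the class of measurable $\omega\subset S^1$ such that $\mathcal H^1(\omega)=\mathcal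 H^1(S^1\setminus\omega)$ and, for $i=1,\dots,k$ and a.e. $x\in S^1$, $x\in\omega\iff\sigma_i(x)\in S^1\setminus\omega$. Let $\lambda_{1,k}^s(\omega)$ be the infimum of $\mathcal R^a(u)$ over those $u\in H^{1;a}_\omega(S^2_+)\setminus\{0\}$ with $u=u\circ\sigma_i\circ\sigma_j$ a.e. for all $i,j\in\{1,\dots,k\}$. Let $\omega_k=\bigcup_{i=1}^k\{\phi\in((i-1)T_k,(i-\tfrac12)T_k)\}\subset S^1$ and $\lambda_1^s(k)=\lambda_{1,k}^s(\omega_k)$. Then: 1. For every $\omega\in\mathcal A_1$ there is a nonzero, nonnegative $u_\omega\in H^{1;a}_\omega(S^2_+)$ with $\mathcal R^a(u_\omega)=\lambda_1^s(\omega)$, and for every nonzero $u_\omega\in H^{1;a}_\omega(S^2_+)$ with $\mathcal R^a(u_\omega)=\lambda_1^s(\omega)$ there is a nonzero $u_\omega^*\in H^{1;a}_{\omega_1}(S^2_+)$ with $\mathcal R^a(u_\omega^*)\le\mathcal R^a(u_\omega)=\lambda_1^s(\omega)$. 2. For every $k\ge1$, $\omega_k\in\mathcal A_k$ and $\min_{\omega\in\mathcal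 A_k}\lambda_{1,k}^s(\omega)=\lambda_{1,k}^s(\omega_k)=\lambda_1^s(k)$. Moreover there is a nonzero, nonnegative $u_k\in H^{1;a}_{\omega_k}(S^2_+)$ with $u_k=u_k\circ\sigma_i\circ\sigma_j$ a.e. for all $i,j\in\{1,\dots,k\}$, with $\mathcal R^a(u_k)=\lambda_1^s(k)$, and with $\int_{S^2_+}y^a\nabla_{S^2}u_k\cdot\nabla_{S^2}\varphi=\lambda_1^s(k)\int_{S^2_+}y^au_k\varphi$ for all $\varphi\in H^{1;a}_{\omega_k}(S^2_+)$. 3. $\lambda_1^s(k)\le\lambda_1^s(k+1)$ for every $k\ge1$, and $\lim_{k\to\infty}\lambda_1^s(k)=\lambda_1^s(\emptyset)$. The characteristic exponent $d(t)=\sqrt{\left(\frac{N-2s}{2}\right)^2+t}-\frac{N-2s}{2}$ with $N=2$ satisfies $d(\lambda_1^s(\emptyset))=2s$. -/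

import Mathlib

open Real Set Filter Topology MeasureTheory
open scoped ENNReal

noncomputable section

namespace HemisphereEigenvalue

/-- The unit circle `S¹`, the boundary of the upper hemisphere, parametrized by the angle `φ`
(modulo `2π`); its `volume` is arc length, of total mass `2π`. -/
abbrev S1 : Type := AddCircle (2 * π)

instance instFactTwoPiPos : Fact (0 < 2 * π) := ⟨Real.two_pi_pos⟩

/-- Lebesgue measure `dθ dφ` in the spherical coordinates `(θ, φ) ∈ (0, π/2) × S¹` of the open upper
hemisphere `S²₊ = {(cos θ cos φ, cos θ sin φ, sin θ)}`. In these coordinates the height is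
`y = sin θ`, the metric is `dθ² + cos² θ dφ²` and the area element is `cos θ dθ dφ`. Only the pole
`θ = π/2` is not covered: a single point has measure zero and, the dimension being two, capacity
zero, so that it is irrelevant for the Sobolev space below. -/
def coordMeasure : Measure (ℝ × S1) :=
  ((volume : Measure ℝ).restrict (Ioo 0 (π / 2))).prod (volume : Measure S1)

/-- The weighted area `dμ = y^a dS = (sin θ)^a cos θ dθ dφ` of the upper hemisphere. -/
def weightedArea (a : ℝ) : Measure (ℝ × S1) :=
  coordMeasure.withDensity fun z => ENNReal.ofReal (sin z.1 ^ a * cos z.1)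

/-- The classical derivative in `θ`. -/
def partialTheta (η : ℝ × S1 → ℝ) (z : ℝ × S1) : ℝ :=
  deriv (fun t : ℝ => η (t, z.2)) z.1

/-- The classical derivative in `φ`. -/
def partialPhi (η : ℝ × S1 → ℝ) (z : ℝ × S1) : ℝ :=
  deriv (fun t : ℝ => η (z.1, z.2 + (t : S1))) 0

/-- Smooth test functions with compact support in the open cylinder `(0, π/2) × S¹`. -/
structure IsTestFunction (η : ℝ × S1 → ℝ) : Prop where
  smooth : ContDiff ℝ (⊤ : ℕ∞) fun p : ℝ × ℝ => η (p.1, (p.2 : S1))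
  compactSupport : ∃ α β : ℝ, 0 < α ∧ β < π / 2 ∧ ∀ z, η z ≠ 0 → z.1 ∈ Icc α β

/-- An element of the weighted Sobolev space `H^{1;a}(S²₊)`: a function `u` on the hemisphere together
with its weak derivatives `∂_θ u`, `∂_φ u` (unique up to null sets), such that `u` and the components
`∂_θ u`, `(cos θ)⁻¹ ∂_φ u` of its tangential gradient are square integrable with respect to
`dμ = y^a dS`. -/
structure WeightedH1 (a : ℝ) where
  fn : ℝ × S1 → ℝ
  dTheta : ℝ × S1 → ℝ
  dPhi : ℝ × S1 → ℝ
  memLp_fn : MemLp fn 2 (weightedArea a)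
  memLp_dTheta : MemLp dTheta 2 (weightedArea a)
  memLp_dPhi : MemLp (fun z => dPhi z / cos z.1) 2 (weightedArea a)
  weak_dTheta : ∀ η : ℝ × S1 → ℝ, IsTestFunction η →
    ∫ z, fn z * partialTheta η z ∂coordMeasure = -∫ z, dTheta z * η z ∂coordMeasure
  weak_dPhi : ∀ η : ℝ × S1 → ℝ, IsTestFunction η →
    ∫ z, fn z * partialPhi η z ∂coordMeasure = -∫ z, dPhi z * η z ∂coordMeasure

/-- `g` is the trace of `u` on `S¹ = {θ = 0}`: the mean over `θ ∈ (0, ε)` of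
`‖u(θ, ·) - g‖²` in `L²(S¹)` tends to zero as `ε → 0⁺`. -/
def IsTrace (u : ℝ × S1 → ℝ) (g : S1 → ℝ) : Prop :=
  MemLp g 2 (volume : Measure S1) ∧
  Tendsto (fun ε : ℝ => (ENNReal.ofReal ε)⁻¹ *
      ∫⁻ z in Ioo (0 : ℝ) ε ×ˢ (univ : Set S1), ‖u z - g z.2‖ₑ ^ 2)
    (𝓝[>] 0) (𝓝 0)

/-- The angle `T_k = 2π/k`. -/
def period (k : ℕ) : ℝ := 2 * π / k

/-- The reflection `σ_i` of the circle in the vertical plane `Σ_i` through the points of angle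
`(i - 1) T_k / 2`. It acts on the hemisphere by the same formula on `φ`, with `θ` unchanged. -/
def circleRefl (k i : ℕ) (x : S1) : S1 := ((((i : ℝ) - 1) * period k : ℝ) : S1) - x

namespace WeightedH1

variable {a : ℝ}

/-- `u` is not the zero element, i.e. does not vanish almost everywhere. -/
def IsNonzero (u : WeightedH1 a) : Prop := ¬ (u.fn =ᵐ[weightedArea a] 0)

/-- `u ≥ 0` almost everywhere. -/
def Nonneg (u : WeightedH1 a) : Prop := ∀ᵐ z ∂weightedArea a, 0 ≤ u.fn z

/-- `u ∈ H^{1;a}_ω(S²₊)`: the trace of `u` vanishes almost everywhere on `S¹ \ ω`. -/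
def VanishesOff (u : WeightedH1 a) (ω : Set S1) : Prop :=
  ∃ g : S1 → ℝ, IsTrace u.fn g ∧ ∀ᵐ x : S1, x ∉ ω → g x = 0

/-- `u(z) = u(σ_i(σ_j(z)))` for almost every `z` and all `i, j = 1, …, k`. (The same identity for the
trace of `u` on `S¹` is a consequence.) -/
def IsSymmetric (k : ℕ) (u : WeightedH1 a) : Prop :=
  ∀ i ∈ Finset.Icc 1 k, ∀ j ∈ Finset.Icc 1 k,
    ∀ᵐ z ∂weightedArea a, u.fn z = u.fn (z.1, circleRefl k i (circleRefl k j z.2))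

/-- `∫ y^a ∇u · ∇v`, with the tangential gradients. -/
def energyForm (u v : WeightedH1 a) : ℝ :=
  ∫ z, (u.dTheta z * v.dTheta z + u.dPhi z / cos z.1 * (v.dPhi z / cos z.1)) ∂weightedArea a

/-- `∫ y^a u v`. -/
def massForm (u v : WeightedH1 a) : ℝ := ∫ z, u.fn z * v.fn z ∂weightedArea a

/-- The Rayleigh quotient `∫ y^a |∇u|² / ∫ y^a u²`. -/
def rayleigh (u : WeightedH1 a) : ℝ := energyForm u u / massForm u u

end WeightedH1

/-- The admissible functions for `λ₁^s(ω)`, with `a = 1 - 2s`: the nonzero `u ∈ H^{1;a}(S²₊)` with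
`u = 0` on `S¹ \ ω`. -/
def admissible (s : ℝ) (ω : Set S1) : Set (WeightedH1 (1 - 2 * s)) :=
  {u | u.IsNonzero ∧ u.VanishesOff ω}

/-- The admissible functions that moreover have the `k`-fold symmetry. -/
def admissibleSym (s : ℝ) (k : ℕ) (ω : Set S1) : Set (WeightedH1 (1 - 2 * s)) :=
  {u | u ∈ admissible s ω ∧ u.IsSymmetric k}

/-- The first eigenvalue `λ₁^s(ω)`. -/
def lambda1 (s : ℝ) (ω : Set S1) : ℝ := sInf (WeightedH1.rayleigh '' admissible s ω)

/-- The first eigenvalue `λ₁^s(ω)` under `k` symmetries. -/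
def lambda1Sym (s : ℝ) (k : ℕ) (ω : Set S1) : ℝ :=
  sInf (WeightedH1.rayleigh '' admissibleSym s k ω)

/-- The class `𝒜_k` of (measurable) sets `ω ⊆ S¹` with `H¹(ω) = H¹(S¹ \ ω)` and
`x ∈ ω ↔ σ_i x ∈ S¹ \ ω` for `i = 1, …, k`. The equivalence is required for almost every `x`; it
cannot hold at the fixed points of `σ_i`. -/
def boundarySets (k : ℕ) : Set (Set S1) :=
  {ω | MeasurableSet ω ∧ volume ω = volume ωᶜ ∧
    ∀ i ∈ Finset.Icc 1 k, ∀ᵐ x : S1, x ∈ ω ↔ circleRefl k i x ∈ ωᶜ}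

/-- The equally spaced arcs `ω_k = {φ ∈ ⋃_{i=1}^k ((i-1) T_k, (i-1/2) T_k)}`. -/
def arcs (k : ℕ) : Set S1 :=
  (fun t : ℝ => (t : S1)) ''
    ⋃ i ∈ Finset.Icc 1 k, Ioo (((i : ℝ) - 1) * period k) (((i : ℝ) - 1 / 2) * period k)

/-- The optimal eigenvalue `λ₁^s(k) = λ₁^s(ω_k)`. -/
def lambdaOpt (s : ℝ) (k : ℕ) : ℝ := lambda1Sym s k (arcs k)

/-- The characteristic exponent `d(t) = √(((N-2s)/2)² + t) - (N-2s)/2`: the degree of homogeneity of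
the extension of an eigenfunction with eigenvalue `t`. -/
def charExponent (N : ℕ) (s t : ℝ) : ℝ :=
  √((((N : ℝ) - 2 * s) / 2) ^ 2 + t) - ((N : ℝ) - 2 * s) / 2

end HemisphereEigenvalue

end

/-!
# Optimal boundary sets for the first weighted eigenvalue of the upper hemisphere

In spherical coordinates the space `H^{1;a}` consists of functions on `(0, π/2) × S¹` with weak
derivatives in a weighted `L²` space, the weight `W(θ) = (sin θ)^a cos θ` having the integrable
reciprocal `1 / W` near `θ = 0`. Testing with products of bumps and trigonometric functions shows that
an element of `H^{1;a}` is, along almost every meridian, the primitive of `∂_θ u` that starts at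
`θ = 0` from the trace, and along almost every parallel a primitive of `∂_φ u`
(`WeightedH1.exists_thetaPrim`, `WeightedH1.exists_phiPrim`). Everything else about the space is read
off from these two representations.

*Vanishing trace.* If the trace is zero, the Cauchy–Schwarz inequality along meridians, with the
derivative of `(sin θ)^{2s}` as auxiliary weight, gives `∫ y^a (∂_θ u)² ≥ 4s ∫ y^a u²`, with equality
for `y^{2s}`. Hence `λ₁(∅) = 4s` and its characteristic exponent is `2s`
(`WeightedH1.four_mul_normSq_le`, `eigK_empty`).

*Existence of minimizers.* A bounded sequence has traces and `θ`-derivatives that converge weakly along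
a subsequence, so that the integrals over arcs at fixed height converge; on short arcs a function is
close to its mean, and therefore the sequence converges in `L²` (`WeightedH1.exists_subseq_cauchy`).
For a minimizing sequence the parallelogram identity turns this into convergence of the gradients
(`exists_minimizer`). Replacing a minimizer by its absolute value makes it nonnegative, and its
Euler–Lagrange equation follows from quadratic perturbation.

*Reduction to the half circle.* The map `φ ↦ k φ` identifies functions with `k`-fold symmetry with
arbitrary functions, the derivative in `φ` being multiplied by `k` in the energy. The pull-back under
this map and the average over its fibres are adjoint to each other, and the average does not increase
the energy (`WeightedH1.pull`, `WeightedH1.push`). It takes `arcs k` to the half circle `arcs 1`, and a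
set `ω` of the class `boundarySets k` to boundary data of which one of any two values at reflected
points vanishes. Polarization then moves the support of the trace into the half circle without
increasing the energy (`WeightedH1.exists_polarization`). Therefore `λ₁(k)` is the first eigenvalue
`eigK a k (arcs 1)` of the half circle with the energy `(∂_θ u)² + k² (∂_φ u)² / (cos θ)²`. This holds
for arbitrary competitors in the Euler–Lagrange equation too, because the pull-back is paired with a
competitor by averaging the latter.

*Monotonicity and limit.* The eigenvalue `eigK a k (arcs 1)` increases with `k` and is at most `4s`,
the quotient of `y^{2s}`. By monotonicity and the parallelogram identity the normalized minimizers
have a subsequence that converges with the gradients. The limit has no `φ`-derivative, so its trace,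
which vanishes on a half circle and is invariant under reflection, is zero; consequently its quotient,
a lower bound for the limit of the eigenvalues, is at least `4s` (`tendsto_eigK`).
-/

noncomputable section

namespace HemisphereEigenvalue

/-! ### The weight and the product structure of the measures -/

/-- The density `(sin θ)^a cos θ` of the weighted area in spherical coordinates. -/
def wt (a θ : ℝ) : ℝ := sin θ ^ a * cos θ

/-- The interval `(0, π/2)` of the polar angle with Lebesgue measure. -/
abbrev thetaMeasure : Measure ℝ := (volume : Measure ℝ).restrict (Ioo 0 (π / 2))

/-- The interval `(0, π/2)` of the polar angle with the measure `(sin θ)^a cos θ dθ`. -/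
def heightMeasure (a : ℝ) : Measure ℝ :=
  thetaMeasure.withDensity fun θ => ENNReal.ofReal (wt a θ)

lemma measurable_wt (a : ℝ) : Measurable (wt a) := by
  unfold wt; fun_prop

lemma sin_pos_of_mem {θ : ℝ} (h : θ ∈ Ioo 0 (π / 2)) : 0 < sin θ :=
  sin_pos_of_pos_of_lt_pi h.1 (by linarith [h.2, pi_pos])

lemma cos_pos_of_mem {θ : ℝ} (h : θ ∈ Ioo 0 (π / 2)) : 0 < cos θ :=
  cos_pos_of_mem_Ioo ⟨by linarith [h.1, pi_pos], h.2⟩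

lemma wt_pos {a θ : ℝ} (h : θ ∈ Ioo 0 (π / 2)) : 0 < wt a θ :=
  mul_pos (rpow_pos_of_pos (sin_pos_of_mem h) _) (cos_pos_of_mem h)

lemma weightedArea_eq_prod (a : ℝ) :
    weightedArea a = (heightMeasure a).prod (volume : Measure S1) := by
  rw [heightMeasure, prod_withDensity_left (measurable_wt a).ennreal_ofReal]
  rfl

lemma ae_thetaMeasure_mem : ∀ᵐ θ ∂thetaMeasure, θ ∈ Ioo 0 (π / 2) :=
  ae_restrict_mem measurableSet_Ioo

lemma ae_coordMeasure_mem : ∀ᵐ z ∂coordMeasure, z.1 ∈ Ioo 0 (π / 2) :=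
  Measure.quasiMeasurePreserving_fst.ae ae_thetaMeasure_mem

lemma weightedArea_absolutelyContinuous (a : ℝ) : weightedArea a ≪ coordMeasure :=
  withDensity_absolutelyContinuous _ _

lemma coordMeasure_absolutelyContinuous (a : ℝ) : coordMeasure ≪ weightedArea a := by
  refine withDensity_absolutelyContinuous' ?_ ?_
  · exact ((measurable_wt a).comp measurable_fst).ennreal_ofReal.aemeasurable
  · filter_upwards [ae_coordMeasure_mem] with z hz
    have := wt_pos (a := a) hz
    simpa [wt] using this

lemma ae_weightedArea_iff {a : ℝ} {p : ℝ × S1 → Prop} :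
    (∀ᵐ z ∂weightedArea a, p z) ↔ ∀ᵐ z ∂coordMeasure, p z :=
  ⟨fun h => (coordMeasure_absolutelyContinuous a).ae_le h,
    fun h => (weightedArea_absolutelyContinuous a).ae_le h⟩

lemma lintegral_weightedArea {a : ℝ} {f : ℝ × S1 → ℝ≥0∞} (hf : Measurable f) :
    ∫⁻ z, f z ∂weightedArea a =
      ∫⁻ θ in Ioo 0 (π / 2), ENNReal.ofReal (wt a θ) * ∫⁻ x : S1, f (θ, x) := by
  rw [weightedArea_eq_prod, lintegral_prod _ hf.aemeasurable, heightMeasure,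
    lintegral_withDensity_eq_lintegral_mul _ (measurable_wt a).ennreal_ofReal
      hf.lintegral_prod_right']
  rfl

lemma half_mul_le_sin {θ : ℝ} (h : θ ∈ Ioo 0 (π / 2)) : θ / 2 ≤ sin θ := by
  have := Real.mul_le_sin h.1.le h.2.le
  have h2 : (1 : ℝ) / 2 ≤ 2 / π := by
    rw [div_le_div_iff₀ two_pos pi_pos]; linarith [pi_le_four]
  nlinarith [h.1]

lemma sin_rpow_le {b θ : ℝ} (h : θ ∈ Ioo 0 (π / 2)) : sin θ ^ b ≤ 1 + (θ / 2) ^ b := by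
  have hs := sin_pos_of_mem h
  have hθ : 0 < θ / 2 := by linarith [h.1]
  rcases le_total 0 b with hb | hb
  · have := rpow_le_one hs.le (sin_le_one θ) hb
    have := rpow_pos_of_pos hθ b
    linarith
  · have := rpow_le_rpow_of_nonpos hθ (half_mul_le_sin h) hb
    linarith

lemma integrableOn_sin_rpow {b : ℝ} (hb : -1 < b) :
    IntegrableOn (fun θ => sin θ ^ b) (Ioo 0 (π / 2)) := by
  have h1 : IntegrableOn (fun θ : ℝ => 1 + (θ / 2) ^ b) (Ioo 0 (π / 2)) := by
    have h2 : IntervalIntegrable (fun θ : ℝ => θ ^ b) volume 0 (π / 2 / 2) :=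
      intervalIntegral.intervalIntegrable_rpow' hb
    have h3 := h2.comp_mul_right (c := (1 / 2 : ℝ))
    have h4 : IntervalIntegrable (fun θ : ℝ => 1 + (θ / 2) ^ b) volume 0 (π / 2) := by
      refine intervalIntegrable_const.add ?_
      convert h3 using 1 <;> (try ext) <;> simp <;> ring_nf
    rw [intervalIntegrable_iff_integrableOn_Ioo_of_le (by positivity)] at h4
    exact h4
  refine h1.mono' (measurable_sin.pow_const b).aestronglyMeasurable ?_
  filter_upwards [ae_thetaMeasure_mem] with θ hθ
  rw [norm_of_nonneg (rpow_nonneg (sin_pos_of_mem hθ).le _)]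
  exact sin_rpow_le hθ

lemma integrableOn_wt {a : ℝ} (ha : -1 < a) : IntegrableOn (wt a) (Ioo 0 (π / 2)) := by
  refine (integrableOn_sin_rpow ha).mono' (measurable_wt a).aestronglyMeasurable ?_
  filter_upwards [ae_thetaMeasure_mem] with θ hθ
  rw [norm_of_nonneg (wt_pos hθ).le, wt]
  exact mul_le_of_le_one_right (rpow_nonneg (sin_pos_of_mem hθ).le _) (cos_le_one θ)

lemma integrableOn_one_div_wt {a b : ℝ} (ha : a < 1) (hb : b < π / 2) :
    IntegrableOn (fun θ => 1 / wt a θ) (Ioo 0 b) := by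
  rcases le_or_gt b 0 with h0 | h0
  · simp [Ioo_eq_empty (not_lt.mpr h0)]
  have hsub : Ioo 0 b ⊆ Ioo 0 (π / 2) := Ioo_subset_Ioo_right hb.le
  have hcb : 0 < cos b := cos_pos_of_mem ⟨h0, hb⟩
  have h1 : IntegrableOn (fun θ => sin θ ^ (-a) * (1 / cos b)) (Ioo 0 b) :=
    ((integrableOn_sin_rpow (b := -a) (by linarith)).mono_set hsub).mul_const _
  refine h1.mono' ((measurable_wt a).const_div 1).aestronglyMeasurable ?_
  filter_upwards [ae_restrict_mem measurableSet_Ioo] with θ hθ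
  have hm := hsub hθ
  rw [norm_of_nonneg (one_div_nonneg.mpr (wt_pos hm).le), wt, one_div, mul_inv, ← one_div (cos θ),
    rpow_neg (sin_pos_of_mem hm).le]
  refine mul_le_mul_of_nonneg_left ?_ (inv_nonneg.mpr (rpow_nonneg (sin_pos_of_mem hm).le _))
  refine one_div_le_one_div_of_le hcb ?_
  exact cos_le_cos_of_nonneg_of_le_pi hθ.1.le (by linarith [pi_pos]) hθ.2.le

lemma isFiniteMeasure_heightMeasure {a : ℝ} (ha : -1 < a) :
    IsFiniteMeasure (heightMeasure a) := by
  refine ⟨?_⟩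
  rw [heightMeasure, withDensity_apply _ MeasurableSet.univ, Measure.restrict_univ]
  exact (integrableOn_wt ha).lintegral_lt_top

instance : SFinite (heightMeasure a) := by unfold heightMeasure; infer_instance

lemma isFiniteMeasure_weightedArea {a : ℝ} (ha : -1 < a) :
    IsFiniteMeasure (weightedArea a) := by
  have := isFiniteMeasure_heightMeasure ha
  rw [weightedArea_eq_prod]; infer_instance

/-- The coordinate measure of the part `θ < b` of the hemisphere. -/
abbrev collar (b : ℝ) : Measure (ℝ × S1) :=
  ((volume : Measure ℝ).restrict (Ioo 0 b)).prod (volume : Measure S1)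

lemma collar_eq {b : ℝ} (hb : b ≤ π / 2) :
    collar b = coordMeasure.restrict (Ioo 0 b ×ˢ univ) := by
  rw [coordMeasure, ← Measure.prod_restrict, Measure.restrict_univ, Measure.restrict_restrict
    measurableSet_Ioo, inter_eq_self_of_subset_left (Ioo_subset_Ioo_right hb)]

/-- A weighted square integrable function is integrable away from the pole, because both
`y^a` and `y^{-a}` are integrable at the boundary circle. -/
lemma integrable_collar {a b : ℝ} (ha : a < 1) (hb : b < π / 2) {f : ℝ × S1 → ℝ}
    (hf : MemLp f 2 (weightedArea a)) : Integrable f (collar b) := by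
  have hfm : AEStronglyMeasurable f coordMeasure :=
    hf.1.mono_ac (coordMeasure_absolutelyContinuous a)
  have h1 : Integrable (fun z => wt a z.1 * f z ^ 2) coordMeasure := by
    have := (memLp_two_iff_integrable_sq hf.1).mp hf
    rw [weightedArea, integrable_withDensity_iff_integrable_smul'
      (by have := measurable_wt a; unfold wt at this; fun_prop) (by simp)] at this
    refine this.congr ?_
    filter_upwards [ae_coordMeasure_mem] with z hz
    have := wt_pos (a := a) hz
    rw [← wt, ENNReal.toReal_ofReal this.le, smul_eq_mul]
  have h2 : Integrable (fun z : ℝ × S1 => 1 / wt a z.1) (collar b) :=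
    (integrableOn_one_div_wt ha hb).comp_fst _
  rw [collar_eq hb.le] at h2 ⊢
  refine (h1.restrict.add h2).mono' hfm.restrict ?_
  filter_upwards [ae_restrict_of_ae ae_coordMeasure_mem] with z hz
  have hw := wt_pos (a := a) hz
  rw [norm_eq_abs, Pi.add_apply]
  have h3 : 0 ≤ (wt a z.1 * |f z| - 1) ^ 2 / wt a z.1 := by positivity
  have h4 : (wt a z.1 * |f z| - 1) ^ 2 / wt a z.1
      = wt a z.1 * |f z| ^ 2 - 2 * |f z| + 1 / wt a z.1 := by
    field_simp; ring
  rw [h4, sq_abs] at h3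
  have h5 : 0 ≤ wt a z.1 * f z ^ 2 := by positivity
  have h6 : 0 ≤ 1 / wt a z.1 := by positivity
  linarith

lemma WeightedH1.memLp_dPhi' {a : ℝ} (u : WeightedH1 a) : MemLp u.dPhi 2 (weightedArea a) := by
  have hm : AEStronglyMeasurable u.dPhi (weightedArea a) := by
    have := u.memLp_dPhi.1.mul
      (measurable_cos.comp measurable_fst).aestronglyMeasurable
    refine this.congr ?_
    filter_upwards [ae_weightedArea_iff.mpr ae_coordMeasure_mem] with z hz
    have := (cos_pos_of_mem hz).ne'
    simp [this]
  refine u.memLp_dPhi.mono hm ?_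
  filter_upwards [ae_weightedArea_iff.mpr ae_coordMeasure_mem] with z hz
  have hc := cos_pos_of_mem hz
  rw [norm_div, norm_of_nonneg hc.le]
  exact le_div_self (norm_nonneg _) hc (cos_le_one _)

/-! ### Test functions -/

lemma isOpenQuotientMap_coe :
    IsOpenQuotientMap (fun p : ℝ × ℝ => ((p.1, (p.2 : S1)) : ℝ × S1)) :=
  IsOpenQuotientMap.id.prodMap QuotientAddGroup.isOpenQuotientMap_mk

/-- Integrability away from the pole, the natural domain of the pairing with test functions. -/
def CollarIntegrable (f : ℝ × S1 → ℝ) : Prop := ∀ b < π / 2, Integrable f (collar b)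

namespace IsTestFunction

variable {η : ℝ × S1 → ℝ}

lemma continuous (h : IsTestFunction η) : Continuous η := by
  rw [isOpenQuotientMap_coe.isQuotientMap.continuous_iff]
  exact h.smooth.continuous

lemma hasDerivAt_theta (h : IsTestFunction η) (θ : ℝ) (x : S1) :
    HasDerivAt (fun t => η (t, x)) (partialTheta η (θ, x)) θ := by
  obtain ⟨p, rfl⟩ := QuotientAddGroup.mk_surjective x
  have h1 : ContDiff ℝ (⊤ : ℕ∞) fun t : ℝ => η (t, (p : S1)) :=
    h.smooth.comp (contDiff_id.prodMk contDiff_const)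
  exact (h1.differentiable (by simp) θ).hasDerivAt

lemma hasDerivAt_phi (h : IsTestFunction η) (θ p : ℝ) :
    HasDerivAt (fun t : ℝ => η (θ, (t : S1))) (partialPhi η (θ, (p : S1))) p := by
  have h1 : ContDiff ℝ (⊤ : ℕ∞) fun t : ℝ => η (θ, (t : S1)) :=
    h.smooth.comp (contDiff_const.prodMk contDiff_id)
  have h2 := (h1.differentiable (by simp) p).hasDerivAt
  have h3 : partialPhi η (θ, (p : S1)) = deriv (fun t : ℝ => η (θ, (t : S1))) p := by
    unfold partialPhi
    have : (fun t : ℝ => η (θ, (p : S1) + (t : S1)))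
        = fun t : ℝ => (fun t : ℝ => η (θ, (t : S1))) (p + t) := by
      ext t; simp
    rw [show ((θ, (p : S1)) : ℝ × S1).1 = θ from rfl, show ((θ, (p : S1)) : ℝ × S1).2 = p from rfl,
      this, deriv_comp_const_add (fun t : ℝ => η (θ, (t : S1))), add_zero]
  rw [h3]; exact h2

lemma partialTheta_coe (h : IsTestFunction η) (p : ℝ × ℝ) :
    partialTheta η (p.1, (p.2 : S1)) =
      fderiv ℝ (fun p : ℝ × ℝ => η (p.1, (p.2 : S1))) p (1, 0) := by
  have h1 := (h.smooth.differentiable (by simp) p).hasFDerivAt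
  have h2 : HasDerivAt (fun t : ℝ => ((t, p.2) : ℝ × ℝ)) (1, 0) p.1 :=
    (hasDerivAt_id _).prodMk (hasDerivAt_const _ _)
  have h3 := HasFDerivAt.comp_hasDerivAt p.1 (f := fun t : ℝ => ((t, p.2) : ℝ × ℝ)) h1 h2
  exact (h.hasDerivAt_theta p.1 p.2).unique h3

lemma partialPhi_coe (h : IsTestFunction η) (p : ℝ × ℝ) :
    partialPhi η (p.1, (p.2 : S1)) =
      fderiv ℝ (fun p : ℝ × ℝ => η (p.1, (p.2 : S1))) p (0, 1) := by
  have h1 := (h.smooth.differentiable (by simp) p).hasFDerivAt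
  have h2 : HasDerivAt (fun t : ℝ => ((p.1, t) : ℝ × ℝ)) (0, 1) p.2 :=
    (hasDerivAt_const _ _).prodMk (hasDerivAt_id _)
  have h3 := HasFDerivAt.comp_hasDerivAt p.2 (f := fun t : ℝ => ((p.1, t) : ℝ × ℝ)) h1 h2
  exact (h.hasDerivAt_phi p.1 p.2).unique h3

lemma eq_zero_of_notMem {α β : ℝ} (hs : ∀ z, η z ≠ 0 → z.1 ∈ Icc α β) {z : ℝ × S1}
    (hz : z.1 ∉ Icc α β) : η z = 0 := by
  by_contra h; exact hz (hs z h)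

lemma compactSupport_of_eventually {f : ℝ × S1 → ℝ} (h : IsTestFunction η)
    (hf : ∀ z : ℝ × S1, (∀ᶠ t in 𝓝 z.1, ∀ x, η (t, x) = 0) → f z = 0) :
    ∃ α β : ℝ, 0 < α ∧ β < π / 2 ∧ ∀ z, f z ≠ 0 → z.1 ∈ Icc α β := by
  obtain ⟨α, β, hα, hβ, hs⟩ := h.compactSupport
  refine ⟨α, β, hα, hβ, fun z hz => ?_⟩
  by_contra hn
  refine hz (hf z ?_)
  filter_upwards [isClosed_Icc.isOpen_compl.mem_nhds hn] with t ht x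
  exact eq_zero_of_notMem hs ht

lemma partialTheta_isTest (h : IsTestFunction η) : IsTestFunction (partialTheta η) := by
  refine ⟨?_, h.compactSupport_of_eventually fun z hz => ?_⟩
  · simp_rw [h.partialTheta_coe]
    exact (h.smooth.fderiv_right (m := (⊤ : ℕ∞)) (by simp)).clm_apply contDiff_const
  · unfold partialTheta
    rw [Filter.EventuallyEq.deriv_eq (f := fun _ => (0 : ℝ))]
    · simp
    · filter_upwards [hz] with t ht using ht _

lemma partialPhi_isTest (h : IsTestFunction η) : IsTestFunction (partialPhi η) := by
  refine ⟨?_, h.compactSupport_of_eventually fun z hz => ?_⟩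
  · simp_rw [h.partialPhi_coe]
    exact (h.smooth.fderiv_right (m := (⊤ : ℕ∞)) (by simp)).clm_apply contDiff_const
  · unfold partialPhi
    simp [hz.self_of_nhds]

lemma exists_bound (h : IsTestFunction η) : ∃ C, ∀ z, |η z| ≤ C := by
  obtain ⟨α, β, hα, hβ, hs⟩ := h.compactSupport
  obtain ⟨C, hC⟩ := (isCompact_Icc (a := α) (b := β)).prod (isCompact_univ (X := S1))
    |>.exists_bound_of_continuousOn h.continuous.continuousOn
  refine ⟨max C 0, fun z => ?_⟩
  by_cases hz : η z = 0
  · simp [hz]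
  · exact (hC z ⟨hs z hz, mem_univ _⟩).trans (le_max_left _ _)

lemma exists_lt (h : IsTestFunction η) :
    ∃ b, 0 < b ∧ b < π / 2 ∧ ∀ z : ℝ × S1, b ≤ z.1 → η z = 0 := by
  obtain ⟨α, β, hα, hβ, hs⟩ := h.compactSupport
  have h2 : (0 : ℝ) < π / 2 := by positivity
  refine ⟨(max β 0 + π / 2) / 2, by positivity, ?_, fun z hz => ?_⟩
  · have : max β 0 < π / 2 := max_lt hβ h2
    linarith
  · refine eq_zero_of_notMem hs fun hm => ?_
    have : max β 0 < π / 2 := max_lt hβ h2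
    linarith [hm.2, le_max_left β 0]

lemma integrable_mul (h : IsTestFunction η) {f : ℝ × S1 → ℝ} (hf : CollarIntegrable f) :
    Integrable (fun z => f z * η z) coordMeasure := by
  obtain ⟨b, _, hb, hs⟩ := h.exists_lt
  obtain ⟨C, hC⟩ := h.exists_bound
  have h1 : Integrable (fun z => f z * η z) (collar b) :=
    (hf b hb).mul_bdd (c := C) h.continuous.aestronglyMeasurable (Eventually.of_forall hC)
  rw [collar_eq hb.le] at h1
  refine IntegrableOn.integrable_of_ae_notMem_eq_zero (s := Ioo 0 b ×ˢ univ) h1 ?_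
  filter_upwards [ae_coordMeasure_mem] with z hz hzn
  rw [hs z, mul_zero]
  by_contra hlt
  exact hzn ⟨⟨hz.1, not_le.mp hlt⟩, mem_univ _⟩

lemma prodMul {g : ℝ → ℝ} {ψ : S1 → ℝ} {α β : ℝ} (hg : ContDiff ℝ (⊤ : ℕ∞) g) (hα : 0 < α)
    (hβ : β < π / 2) (hs : ∀ θ, g θ ≠ 0 → θ ∈ Icc α β)
    (hψ : ContDiff ℝ (⊤ : ℕ∞) fun p : ℝ => ψ p) :
    IsTestFunction fun z => g z.1 * ψ z.2 :=
  ⟨(hg.comp contDiff_fst).mul (hψ.comp contDiff_snd), α, β, hα, hβ,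
    fun _ hz => hs _ (left_ne_zero_of_mul hz)⟩

end IsTestFunction

lemma collarIntegrable_of_memLp {a : ℝ} (ha : a < 1) {f : ℝ × S1 → ℝ}
    (hf : MemLp f 2 (weightedArea a)) : CollarIntegrable f :=
  fun _ hb => integrable_collar ha hb hf

lemma integral_mul_congr {f g η : ℝ × S1 → ℝ} (h : f =ᵐ[coordMeasure] g) :
    ∫ z, f z * η z ∂coordMeasure = ∫ z, g z * η z ∂coordMeasure := by
  refine integral_congr_ae ?_
  filter_upwards [h] with z hz
  rw [hz]

/-! ### Linear combinations and measurable representatives -/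

namespace WeightedH1

variable {a : ℝ}

/-- The linear combination `c u + d v`. -/
def lin (ha : a < 1) (c d : ℝ) (u v : WeightedH1 a) : WeightedH1 a where
  fn z := c * u.fn z + d * v.fn z
  dTheta z := c * u.dTheta z + d * v.dTheta z
  dPhi z := c * u.dPhi z + d * v.dPhi z
  memLp_fn := (u.memLp_fn.const_mul c).add (v.memLp_fn.const_mul d)
  memLp_dTheta := (u.memLp_dTheta.const_mul c).add (v.memLp_dTheta.const_mul d)
  memLp_dPhi := by
    have := (u.memLp_dPhi.const_mul c).add (v.memLp_dPhi.const_mul d)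
    refine this.ae_eq (Eventually.of_forall fun z => ?_)
    simp only [Pi.add_apply]; ring
  weak_dTheta η hη := by
    have I1 := hη.partialTheta_isTest.integrable_mul (collarIntegrable_of_memLp ha u.memLp_fn)
    have I2 := hη.partialTheta_isTest.integrable_mul (collarIntegrable_of_memLp ha v.memLp_fn)
    have I3 := hη.integrable_mul (collarIntegrable_of_memLp ha u.memLp_dTheta)
    have I4 := hη.integrable_mul (collarIntegrable_of_memLp ha v.memLp_dTheta)
    have h1 := u.weak_dTheta η hη
    have h2 := v.weak_dTheta η hη
    simp_rw [add_mul, mul_assoc]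
    rw [integral_add (I1.const_mul c) (I2.const_mul d), integral_add (I3.const_mul c)
      (I4.const_mul d), integral_const_mul, integral_const_mul, integral_const_mul,
      integral_const_mul, h1, h2]
    ring
  weak_dPhi η hη := by
    have I1 := hη.partialPhi_isTest.integrable_mul (collarIntegrable_of_memLp ha u.memLp_fn)
    have I2 := hη.partialPhi_isTest.integrable_mul (collarIntegrable_of_memLp ha v.memLp_fn)
    have I3 := hη.integrable_mul (collarIntegrable_of_memLp ha u.memLp_dPhi')
    have I4 := hη.integrable_mul (collarIntegrable_of_memLp ha v.memLp_dPhi')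
    have h1 := u.weak_dPhi η hη
    have h2 := v.weak_dPhi η hη
    simp_rw [add_mul, mul_assoc]
    rw [integral_add (I1.const_mul c) (I2.const_mul d), integral_add (I3.const_mul c)
      (I4.const_mul d), integral_const_mul, integral_const_mul, integral_const_mul,
      integral_const_mul, h1, h2]
    ring

/-- The function and its weak derivatives are measurable, not only almost everywhere. -/
structure IsMeasurable (u : WeightedH1 a) : Prop where
  fn : Measurable u.fn
  dTheta : Measurable u.dTheta
  dPhi : Measurable u.dPhi

/-- Equality almost everywhere, including the weak derivatives. -/
structure AEEq (u v : WeightedH1 a) : Prop where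
  fn : u.fn =ᵐ[coordMeasure] v.fn
  dTheta : u.dTheta =ᵐ[coordMeasure] v.dTheta
  dPhi : u.dPhi =ᵐ[coordMeasure] v.dPhi

lemma exists_measurable (u : WeightedH1 a) : ∃ v : WeightedH1 a, v.IsMeasurable ∧ u.AEEq v := by
  have e1 : AEStronglyMeasurable u.fn coordMeasure :=
    u.memLp_fn.1.mono_ac (coordMeasure_absolutelyContinuous a)
  have e2 : AEStronglyMeasurable u.dTheta coordMeasure :=
    u.memLp_dTheta.1.mono_ac (coordMeasure_absolutelyContinuous a)
  have e3 : AEStronglyMeasurable u.dPhi coordMeasure :=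
    u.memLp_dPhi'.1.mono_ac (coordMeasure_absolutelyContinuous a)
  have tr : ∀ {f g : ℝ × S1 → ℝ}, f =ᵐ[coordMeasure] g → f =ᵐ[weightedArea a] g :=
    fun h => ae_weightedArea_iff.mpr h
  refine ⟨⟨e1.mk _, e2.mk _, e3.mk _, u.memLp_fn.ae_eq (tr e1.ae_eq_mk),
    u.memLp_dTheta.ae_eq (tr e2.ae_eq_mk), u.memLp_dPhi.ae_eq (tr ?_), fun η hη => ?_,
    fun η hη => ?_⟩, ⟨e1.stronglyMeasurable_mk.measurable, e2.stronglyMeasurable_mk.measurable,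
    e3.stronglyMeasurable_mk.measurable⟩, ⟨e1.ae_eq_mk, e2.ae_eq_mk, e3.ae_eq_mk⟩⟩
  · filter_upwards [e3.ae_eq_mk] with z hz
    rw [hz]
  · have h := u.weak_dTheta η hη
    rwa [integral_mul_congr e1.ae_eq_mk, integral_mul_congr e2.ae_eq_mk] at h
  · have h := u.weak_dPhi η hη
    rwa [integral_mul_congr e1.ae_eq_mk, integral_mul_congr e3.ae_eq_mk] at h

end WeightedH1

/-! ### Integration by parts for primitives and for their absolute values -/

lemma measurable_realSign : Measurable Real.sign := by
  unfold Real.sign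
  exact Measurable.ite measurableSet_Iio measurable_const
    (Measurable.ite measurableSet_Ioi measurable_const measurable_const)

lemma abs_realSign_le (x : ℝ) : |Real.sign x| ≤ 1 := by
  rcases lt_trichotomy x 0 with h | h | h
  · simp [Real.sign_of_neg h]
  · simp [h]
  · simp [Real.sign_of_pos h]

lemma hasDerivAt_abs_realSign {x : ℝ} (h : x ≠ 0) : HasDerivAt (fun y : ℝ => |y|) (Real.sign x) x := by
  rcases lt_or_gt_of_ne h with h | h
  · rw [Real.sign_of_neg h]; exact hasDerivAt_abs_neg h
  · rw [Real.sign_of_pos h]; exact hasDerivAt_abs_pos h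

lemma AbsolutelyContinuousOnInterval.abs {v : ℝ → ℝ} {a b : ℝ}
    (hv : AbsolutelyContinuousOnInterval v a b) :
    AbsolutelyContinuousOnInterval (fun t => |v t|) a b := by
  refine squeeze_zero (fun t => Finset.sum_nonneg fun i _ => dist_nonneg) (fun t => ?_) hv
  exact Finset.sum_le_sum fun i _ => by
    simp only [Real.dist_eq]; exact abs_abs_sub_abs_le_abs_sub _ _

section Interval

variable {a b c : ℝ} {f ρ ρ' : ℝ → ℝ}

lemma absolutelyContinuous_primitive (hf : IntervalIntegrable f volume a b) (c : ℝ) :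
    AbsolutelyContinuousOnInterval (fun t => c + ∫ r in a..t, f r) a b := by
  have h1 : AbsolutelyContinuousOnInterval (fun _ : ℝ => c) a b :=
    (contDiff_const (n := 1)).contDiffOn.absolutelyContinuousOnInterval
  exact h1.fun_add (hf.absolutelyContinuousOnInterval_intervalIntegral (by simp))

lemma absolutelyContinuous_of_hasDerivAt (hρ : ∀ t, HasDerivAt ρ (ρ' t) t) (hρ' : Continuous ρ') :
    AbsolutelyContinuousOnInterval ρ a b := by
  refine ContDiffOn.absolutelyContinuousOnInterval (ContDiff.contDiffOn ?_)
  rw [contDiff_one_iff_deriv]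
  have : deriv ρ = ρ' := funext fun t => (hρ t).deriv
  exact ⟨fun t => (hρ t).differentiableAt, this ▸ hρ'⟩

/-- Integration by parts for a primitive of an integrable function. -/
lemma integral_primitive_mul (hf : IntervalIntegrable f volume a b)
    (hρ : ∀ t, HasDerivAt ρ (ρ' t) t) (hρ' : Continuous ρ') :
    ∫ t in a..b, (c + ∫ r in a..t, f r) * ρ' t =
      (c + ∫ r in a..b, f r) * ρ b - c * ρ a - ∫ t in a..b, f t * ρ t := by
  have h := (absolutelyContinuous_primitive hf c).integral_mul_deriv_eq_deriv_mul
    (absolutelyContinuous_of_hasDerivAt hρ hρ')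
  simp_rw [(hρ _).deriv] at h
  rw [h, intervalIntegral.integral_same, add_zero]
  congr 1
  refine intervalIntegral.integral_congr_ae ?_
  filter_upwards [hf.ae_hasDerivAt_integral] with x hx hxm
  have := (hx (uIoc_subset_uIcc hxm) a (by simp)).const_add c
  rw [this.deriv]

/-- Integration by parts for the absolute value of a primitive. At a zero of the primitive `v` where
`|v|` is differentiable, `|v|` has a minimum, so that its derivative is `0 = sign(v) v'`. -/
lemma integral_abs_primitive_mul (hf : IntervalIntegrable f volume a b)
    (hρ : ∀ t, HasDerivAt ρ (ρ' t) t) (hρ' : Continuous ρ') :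
    ∫ t in a..b, |c + ∫ r in a..t, f r| * ρ' t =
      |c + ∫ r in a..b, f r| * ρ b - |c| * ρ a -
        ∫ t in a..b, Real.sign (c + ∫ r in a..t, f r) * f t * ρ t := by
  have hac := AbsolutelyContinuousOnInterval.abs (absolutelyContinuous_primitive hf c)
  have h := hac.integral_mul_deriv_eq_deriv_mul (absolutelyContinuous_of_hasDerivAt hρ hρ')
  simp_rw [(hρ _).deriv] at h
  rw [h, intervalIntegral.integral_same, add_zero]
  congr 1
  refine intervalIntegral.integral_congr_ae ?_
  filter_upwards [hf.ae_hasDerivAt_integral, hac.ae_differentiableAt] with x hx hd hxm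
  have h1 := (hx (uIoc_subset_uIcc hxm) a (by simp)).const_add c
  have h2 := hd (uIoc_subset_uIcc hxm)
  congr 1
  by_cases h0 : c + ∫ r in a..x, f r = 0
  · rw [h0, Real.sign_zero, zero_mul]
    refine IsLocalMin.deriv_eq_zero (Eventually.of_forall fun y => ?_)
    simp [h0]
  · exact ((hasDerivAt_abs_realSign h0).comp x h1).deriv

end Interval

/-! ### Uniqueness: testing with products determines a function -/

/-- An integrable function on the circle all of whose Fourier coefficients vanish is zero. -/
lemma ae_eq_zero_of_integral_fourier {f : S1 → ℝ} (hf : Integrable f)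
    (h : ∀ n : ℤ, ∫ x, (f x : ℂ) * fourier n x = 0) : f =ᵐ[volume] 0 := by
  have hfc : Integrable (fun x => (f x : ℂ)) := hf.ofReal
  have bdd : ∀ ψ : C(S1, ℂ), Integrable fun x => (f x : ℂ) * ψ x := fun ψ =>
    hfc.mul_bdd (c := ‖ψ‖) ψ.continuous.aestronglyMeasurable
      (Eventually.of_forall fun x => ψ.norm_coe_le_norm x)
  have hspan : ∀ ψ ∈ Submodule.span ℂ (range (@fourier (2 * π))),
      ∫ x, (f x : ℂ) * ψ x = 0 := by
    intro ψ hψ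
    induction hψ using Submodule.span_induction with
    | mem ψ hψ => obtain ⟨n, rfl⟩ := hψ; exact h n
    | zero => simp
    | add φ ψ _ _ h1 h2 =>
      simp_rw [ContinuousMap.add_apply, mul_add]
      rw [integral_add (bdd φ) (bdd ψ), h1, h2, add_zero]
    | smul c ψ _ h1 =>
      simp_rw [ContinuousMap.smul_apply, smul_eq_mul, mul_left_comm _ c]
      rw [integral_const_mul, h1, mul_zero]
  have hall : ∀ ψ : C(S1, ℂ), ∫ x, (f x : ℂ) * ψ x = 0 := by
    intro ψ
    have hψ : ψ ∈ (Submodule.span ℂ (range (@fourier (2 * π)))).topologicalClosure := by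
      rw [span_fourier_closure_eq_top]; trivial
    rw [← SetLike.mem_coe, Submodule.topologicalClosure_coe] at hψ
    have hK : 0 ≤ ∫ x, |f x| := integral_nonneg fun x => abs_nonneg _
    by_contra hne
    have hpos : 0 < ‖∫ x, (f x : ℂ) * ψ x‖ := norm_pos_iff.mpr hne
    obtain ⟨p, hp, hd⟩ := Metric.mem_closure_iff.mp hψ
      (‖∫ x, (f x : ℂ) * ψ x‖ / ((∫ x, |f x|) + 1)) (by positivity)
    have h1 : ∫ x, (f x : ℂ) * ψ x = ∫ x, (f x : ℂ) * (ψ - p) x := by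
      simp_rw [ContinuousMap.sub_apply, mul_sub]
      rw [integral_sub (bdd ψ) (bdd p), hspan p hp, sub_zero]
    have h2 : ‖∫ x, (f x : ℂ) * (ψ - p) x‖ ≤ (∫ x, |f x|) * ‖ψ - p‖ := by
      rw [← integral_mul_const]
      refine norm_integral_le_of_norm_le (hf.abs.mul_const _) (Eventually.of_forall fun x => ?_)
      rw [norm_mul, Complex.norm_real, norm_eq_abs]
      exact mul_le_mul_of_nonneg_left ((ψ - p).norm_coe_le_norm x) (abs_nonneg _)
    rw [← h1] at h2
    rw [dist_eq_norm, lt_div_iff₀ (by positivity)] at hd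
    nlinarith [norm_nonneg (ψ - p)]
  refine ae_eq_zero_of_forall_setIntegral_isClosed_eq_zero hf fun s hs => ?_
  have key : ∀ n, ∫ x, f x * (hs.apprSeq n x : ℝ) = 0 := by
    intro n
    have h1 := hall ⟨fun x => ((hs.apprSeq n x : ℝ) : ℂ), by fun_prop⟩
    simp only [ContinuousMap.coe_mk, ← Complex.ofReal_mul] at h1
    rw [integral_complex_ofReal] at h1
    exact_mod_cast h1
  rw [← integral_indicator hs.measurableSet]
  have hzero : Tendsto (fun n => ∫ x, f x * (hs.apprSeq n x : ℝ)) atTop (𝓝 0) := by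
    simp only [key]; exact tendsto_const_nhds
  refine tendsto_nhds_unique ?_ hzero
  refine tendsto_integral_of_dominated_convergence (fun x => |f x|)
    (fun n => hf.1.mul (by fun_prop)) hf.abs (fun n => Eventually.of_forall fun x => ?_)
    (Eventually.of_forall fun x => ?_)
  · rw [norm_mul, norm_eq_abs]
    refine mul_le_of_le_one_right (abs_nonneg _) ?_
    rw [Real.norm_of_nonneg (by positivity)]
    exact_mod_cast HasOuterApproxClosed.apprSeq_apply_le_one hs n x
  · have h1 := (tendsto_pi_nhds.mp (HasOuterApproxClosed.tendsto_apprSeq hs)) x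
    have h2 : Tendsto (fun n => ((hs.apprSeq n x : NNReal) : ℝ)) atTop
        (𝓝 ((indicator s (fun _ => (1 : NNReal)) x : NNReal) : ℝ)) :=
      (NNReal.continuous_coe.tendsto _).comp h1
    have h3 := h2.const_mul (f x)
    by_cases hx : x ∈ s <;> simpa [hx] using h3

/-- Smooth real functions on the circle. -/
def SmoothCircle (ψ : S1 → ℝ) : Prop := ContDiff ℝ (⊤ : ℕ∞) fun p : ℝ => ψ p

lemma SmoothCircle.continuous {ψ : S1 → ℝ} (h : SmoothCircle ψ) : Continuous ψ :=
  (QuotientAddGroup.isOpenQuotientMap_mk.isQuotientMap.continuous_iff).mpr (ContDiff.continuous h)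

lemma contDiff_fourier (n : ℤ) : ContDiff ℝ (⊤ : ℕ∞) fun p : ℝ => fourier n (p : S1) := by
  simp_rw [fourier_coe_apply]
  have := Complex.ofRealCLM.contDiff (n := (⊤ : ℕ∞))
  exact ((contDiff_const.mul this).div_const _).cexp

lemma smoothCircle_fourier_re (n : ℤ) : SmoothCircle fun x => (fourier n x).re :=
  Complex.reCLM.contDiff.comp (contDiff_fourier n)

lemma smoothCircle_fourier_im (n : ℤ) : SmoothCircle fun x => (fourier n x).im :=
  Complex.imCLM.contDiff.comp (contDiff_fourier n)

/-- Smooth functions with compact support in `(0, π/2)`. -/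
structure IsBump (g : ℝ → ℝ) : Prop where
  smooth : ContDiff ℝ (⊤ : ℕ∞) g
  compactSupport : ∃ α β : ℝ, 0 < α ∧ β < π / 2 ∧ ∀ θ, g θ ≠ 0 → θ ∈ Icc α β

lemma isBump_of_tsupport {g : ℝ → ℝ} (h1 : ContDiff ℝ (⊤ : ℕ∞) g) (h2 : HasCompactSupport g)
    (h3 : tsupport g ⊆ Ioo 0 (π / 2)) : IsBump g := by
  refine ⟨h1, ?_⟩
  rcases (tsupport g).eq_empty_or_nonempty with h | h
  · refine ⟨1, 0, one_pos, by positivity, fun θ hθ => ?_⟩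
    have := subset_tsupport g hθ
    rw [h] at this; exact absurd this (notMem_empty _)
  · obtain ⟨α, hα⟩ := h2.isCompact.exists_isLeast h
    obtain ⟨β, hβ⟩ := h2.isCompact.exists_isGreatest h
    exact ⟨α, β, (h3 hα.1).1, (h3 hβ.1).2, fun θ hθ =>
      ⟨hα.2 (subset_tsupport g hθ), hβ.2 (subset_tsupport g hθ)⟩⟩

lemma IsBump.isTestFunction {g : ℝ → ℝ} {ψ : S1 → ℝ} (hg : IsBump g) (hψ : SmoothCircle ψ) :
    IsTestFunction fun z => g z.1 * ψ z.2 := by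
  obtain ⟨α, β, hα, hβ, hs⟩ := hg.compactSupport
  exact IsTestFunction.prodMul hg.smooth hα hβ hs hψ

lemma CollarIntegrable.slice_integrable {w : ℝ × S1 → ℝ} (hw : CollarIntegrable w) :
    ∀ᵐ θ ∂thetaMeasure, Integrable fun x => w (θ, x) := by
  have h : ∀ n : ℕ, ∀ᵐ θ ∂thetaMeasure, θ < π / 2 - 1 / (n + 1 : ℝ) →
      Integrable fun x => w (θ, x) := by
    intro n
    have h1 := (hw (π / 2 - 1 / (n + 1 : ℝ)) (by
      have : (0 : ℝ) < 1 / (n + 1 : ℝ) := by positivity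
      linarith)).prod_right_ae
    rw [ae_restrict_iff' measurableSet_Ioo] at h1 ⊢
    filter_upwards [h1] with θ h hθ hlt using h ⟨hθ.1, hlt⟩
  filter_upwards [ae_all_iff.mpr h, ae_thetaMeasure_mem] with θ h1 h2
  obtain ⟨n, hn⟩ := exists_nat_one_div_lt (sub_pos.mpr h2.2)
  exact h1 n (by linarith)

/-- A function that is orthogonal to all products of a bump in `θ` with a smooth function of `φ`
vanishes almost everywhere. -/
lemma ae_eq_zero_of_integral_prod {w : ℝ × S1 → ℝ} (hm : Measurable w) (hw : CollarIntegrable w)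
    (h : ∀ g ψ, IsBump g → SmoothCircle ψ → ∫ z, w z * (g z.1 * ψ z.2) ∂coordMeasure = 0) :
    w =ᵐ[coordMeasure] 0 := by
  have key : ∀ ψ, SmoothCircle ψ → ∀ᵐ θ ∂thetaMeasure, ∫ x, w (θ, x) * ψ x = 0 := by
    intro ψ hψ
    rw [ae_restrict_iff' measurableSet_Ioo]
    refine isOpen_Ioo.ae_eq_zero_of_integral_contDiff_smul_eq_zero ?_ ?_
    · rw [locallyIntegrableOn_iff (isOpen_Ioo.isLocallyClosed)]
      intro k hk hkc
      rcases k.eq_empty_or_nonempty with rfl | hne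
      · simp
      obtain ⟨β, hβ⟩ := hkc.exists_isGreatest hne
      have hb : (β + π / 2) / 2 < π / 2 := by linarith [(hk hβ.1).2]
      have hsub : k ⊆ Ioo 0 ((β + π / 2) / 2) := fun t ht =>
        ⟨(hk ht).1, by linarith [hβ.2 ht, (hk hβ.1).2]⟩
      refine IntegrableOn.mono_set ?_ hsub
      obtain ⟨C, hC⟩ := isCompact_univ.exists_bound_of_continuousOn hψ.continuous.continuousOn
      have h1 : Integrable (fun z => w z * ψ z.2) (collar ((β + π / 2) / 2)) :=
        (hw _ hb).mul_bdd (c := C) (hψ.continuous.comp continuous_snd).aestronglyMeasurable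
          (Eventually.of_forall fun z => hC _ (mem_univ _))
      exact h1.integral_prod_left
    · intro g h1 h2 h3
      have hg := isBump_of_tsupport h1 h2 h3
      have h4 := h g ψ hg hψ
      have h5 := (hg.isTestFunction hψ).integrable_mul hw
      rw [coordMeasure, integral_prod _ h5] at h4
      rw [← h4, ← integral_indicator measurableSet_Ioo]
      refine integral_congr_ae (Eventually.of_forall fun θ => ?_)
      by_cases hθ : θ ∈ Ioo 0 (π / 2)
      · simp only [hθ, indicator_of_mem, smul_eq_mul]
        rw [← integral_const_mul]
        congr 1; ext x; ring
      · have : g θ = 0 := by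
          by_contra hne
          exact hθ (h3 (subset_tsupport g hne))
        simp [hθ, this]
  have hre : ∀ᵐ θ ∂thetaMeasure, ∀ n : ℤ, ∫ x, w (θ, x) * (fourier n x).re = 0 :=
    ae_all_iff.mpr fun n => key _ (smoothCircle_fourier_re n)
  have him : ∀ᵐ θ ∂thetaMeasure, ∀ n : ℤ, ∫ x, w (θ, x) * (fourier n x).im = 0 :=
    ae_all_iff.mpr fun n => key _ (smoothCircle_fourier_im n)
  refine (Measure.ae_prod_iff_ae_ae (p := fun z => w z = 0)
    (measurableSet_eq_fun hm measurable_const)).mpr ?_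
  filter_upwards [hre, him, hw.slice_integrable] with θ h1 h2 h3
  refine ae_eq_zero_of_integral_fourier h3 fun n => ?_
  have hint : Integrable fun x => (w (θ, x) : ℂ) * fourier n x :=
    h3.ofReal.mul_bdd (c := 1) (fourier n).continuous.aestronglyMeasurable
      (Eventually.of_forall fun x => by rw [fourier_apply]; exact (Circle.norm_coe _).le)
  apply Complex.ext
  · have := (Complex.reCLM.integral_comp_comm hint)
    simp only [Complex.reCLM_apply, Complex.re_ofReal_mul] at this
    rw [← this]; simpa using h1 n
  · have := (Complex.imCLM.integral_comp_comm hint)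
    simp only [Complex.imCLM_apply, Complex.im_ofReal_mul] at this
    rw [← this]; simpa using h2 n

/-! ### Functions with vanishing weak derivative -/

lemma CollarIntegrable.sub {f g : ℝ × S1 → ℝ} (hf : CollarIntegrable f) (hg : CollarIntegrable g) :
    CollarIntegrable fun z => f z - g z := fun b hb => (hf b hb).sub (hg b hb)

lemma exists_bump : ∃ g : ℝ → ℝ, IsBump g ∧ ∫ θ, g θ = 1 := by
  let f : ContDiffBump (π / 4) := ⟨1 / 4, 1 / 2, by norm_num, by norm_num⟩
  refine ⟨f.normed volume, isBump_of_tsupport f.contDiff_normed f.hasCompactSupport_normed ?_,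
    f.integral_normed⟩
  rw [f.tsupport_normed_eq, closedBall_eq_Icc]
  have h : f.rOut = 1 / 2 := rfl
  intro x hx
  rw [h] at hx
  constructor <;> linarith [hx.1, hx.2, pi_gt_three]

namespace IsBump

variable {g : ℝ → ℝ}

lemma integrable (hg : IsBump g) : Integrable g := by
  obtain ⟨α, β, hα, hβ, hs⟩ := hg.compactSupport
  refine hg.smooth.continuous.integrable_of_hasCompactSupport ?_
  exact HasCompactSupport.intro (isCompact_Icc (a := α) (b := β)) fun x hx => by
    by_contra h; exact hx (hs x h)

lemma integral_eq (hg : IsBump g) : ∫ θ in Ioo 0 (π / 2), g θ = ∫ θ, g θ := by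
  obtain ⟨α, β, hα, hβ, hs⟩ := hg.compactSupport
  refine setIntegral_eq_integral_of_forall_compl_eq_zero fun x hx => ?_
  by_contra h
  exact hx ⟨hα.trans_le (hs x h).1, (hs x h).2.trans_lt hβ⟩

lemma sub_const_mul {g' : ℝ → ℝ} (hg : IsBump g) (hg' : IsBump g') (c : ℝ) :
    IsBump fun θ => g θ - c * g' θ := by
  obtain ⟨α, β, hα, hβ, hs⟩ := hg.compactSupport
  obtain ⟨α', β', hα', hβ', hs'⟩ := hg'.compactSupport
  refine ⟨hg.smooth.sub (contDiff_const.mul hg'.smooth), min α α', max β β', lt_min hα hα',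
    max_lt hβ hβ', fun θ hθ => ?_⟩
  by_cases h : g θ = 0
  · have h' : g' θ ≠ 0 := by
      intro h'; simp [h, h'] at hθ
    exact ⟨(min_le_right _ _).trans (hs' θ h').1, (hs' θ h').2.trans (le_max_right _ _)⟩
  · exact ⟨(min_le_left _ _).trans (hs θ h).1, (hs θ h).2.trans (le_max_left _ _)⟩

/-- A bump of mean zero is the derivative of a bump. -/
lemma exists_antideriv (hg : IsBump g) (h0 : ∫ θ, g θ = 0) :
    ∃ ρ, IsBump ρ ∧ ∀ θ, HasDerivAt ρ (g θ) θ := by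
  obtain ⟨α, β, hα, hβ, hs⟩ := hg.compactSupport
  have hz : ∀ θ, θ ∉ Icc α β → g θ = 0 := fun θ h => by
    by_contra hn; exact h (hs θ hn)
  have hd : ∀ θ, HasDerivAt (fun θ => ∫ t in (0 : ℝ)..θ, g t) (g θ) θ := fun θ =>
    (hg.smooth.continuous.integral_hasStrictDerivAt 0 θ).hasDerivAt
  refine ⟨_, ⟨?_, α, β, hα, hβ, fun θ hθ => ?_⟩, hd⟩
  · rw [contDiff_infty_iff_deriv]
    refine ⟨fun θ => (hd θ).differentiableAt, ?_⟩
    have : deriv (fun θ => ∫ t in (0 : ℝ)..θ, g t) = g := funext fun θ => (hd θ).deriv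
    rw [this]; exact hg.smooth
  · by_contra hn
    refine hθ ?_
    rw [mem_Icc, not_and_or, not_le, not_le] at hn
    rcases hn with hn | hn
    · rw [intervalIntegral.integral_congr (g := fun _ => (0 : ℝ))]
      · simp
      · intro t ht
        refine hz t fun hm => ?_
        have := ht.2.trans (max_le hα.le hn.le)
        rcases le_total 0 θ with h | h
        · rw [uIcc_of_le h] at ht; linarith [ht.2, hm.1]
        · rw [uIcc_of_ge h] at ht; linarith [ht.2, hm.1]
    · rcases lt_or_ge β α with hab | hab
      · have : ∀ t, g t = 0 := fun t => hz t (by simp [hab])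
        simp [this]
      · have hθ0 : 0 ≤ θ := by linarith
        rw [intervalIntegral.integral_of_le hθ0, setIntegral_eq_integral_of_forall_compl_eq_zero, h0]
        intro t ht
        refine hz t fun hm => ht ⟨by linarith [hm.1], by linarith [hm.2]⟩

end IsBump

/-- A function whose weak `θ`-derivative vanishes depends on `φ` only. -/
lemma exists_eq_snd_of_weak_theta {w : ℝ × S1 → ℝ} (hm : Measurable w) (hw : CollarIntegrable w)
    (h : ∀ η, IsTestFunction η → ∫ z, w z * partialTheta η z ∂coordMeasure = 0) :
    ∃ c : S1 → ℝ, Measurable c ∧ Integrable c ∧ w =ᵐ[coordMeasure] fun z => c z.2 := by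
  obtain ⟨g₀, hg₀, h₀⟩ := exists_bump
  have one : SmoothCircle fun _ => 1 := contDiff_const
  have hint : Integrable (fun z => w z * g₀ z.1) coordMeasure := by
    simpa using (hg₀.isTestFunction one).integrable_mul hw
  have hcm : Measurable fun x : S1 => ∫ θ in Ioo 0 (π / 2), w (θ, x) * g₀ θ := by
    have h1 : StronglyMeasurable (Function.uncurry fun (x : S1) (θ : ℝ) => w (θ, x) * g₀ θ) := by
      have := hg₀.smooth.continuous.measurable
      exact Measurable.stronglyMeasurable (by unfold Function.uncurry; fun_prop)
    exact h1.integral_prod_right.measurable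
  have hci : Integrable fun x : S1 => ∫ θ in Ioo 0 (π / 2), w (θ, x) * g₀ θ :=
    hint.integral_prod_right
  refine ⟨_, hcm, hci, ?_⟩
  set c := fun x : S1 => ∫ θ in Ioo 0 (π / 2), w (θ, x) * g₀ θ with hc
  have hcC : CollarIntegrable fun z => c z.2 := fun b _ => hci.comp_snd _
  have key := ae_eq_zero_of_integral_prod (w := fun z => w z - c z.2) (by fun_prop)
    (hw.sub hcC) fun g ψ hg hψ => ?_
  · filter_upwards [key] with z hz
    exact sub_eq_zero.mp hz
  · have T := hg.isTestFunction hψ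
    have T0 := hg₀.isTestFunction hψ
    simp_rw [sub_mul]
    rw [integral_sub (T.integrable_mul hw) (T.integrable_mul hcC)]
    set m := ∫ θ, g θ with hmdef
    have hgz : ∫ θ, (g θ - m * g₀ θ) = 0 := by
      rw [integral_sub hg.integrable (hg₀.integrable.const_mul _), integral_const_mul, h₀]
      simp [hmdef]
    obtain ⟨ρ, hρ, hρd⟩ := (hg.sub_const_mul hg₀ m).exists_antideriv hgz
    have h1 := h _ (hρ.isTestFunction hψ)
    have h2 : ∀ z : ℝ × S1, partialTheta (fun z => ρ z.1 * ψ z.2) z =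
        g z.1 * ψ z.2 - m * (g₀ z.1 * ψ z.2) := by
      intro z
      have := ((hρd z.1).mul_const (ψ z.2)).deriv
      rw [partialTheta, this]; ring
    simp_rw [h2, mul_sub, mul_left_comm _ m] at h1
    rw [integral_sub (T.integrable_mul hw) ((T0.integrable_mul hw).const_mul _),
      integral_const_mul] at h1
    have h3 : ∫ z, w z * (g₀ z.1 * ψ z.2) ∂coordMeasure = ∫ x, c x * ψ x := by
      rw [coordMeasure, integral_prod_symm _ (T0.integrable_mul hw)]
      refine integral_congr_ae (Eventually.of_forall fun x => ?_)
      simp only [hc]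
      rw [← integral_mul_const]
      congr 1; ext θ; ring
    have h4 : ∫ z, c z.2 * (g z.1 * ψ z.2) ∂coordMeasure = m * ∫ x, c x * ψ x := by
      simp_rw [mul_left_comm (c _)]
      rw [coordMeasure, integral_prod_mul (f := g) (g := fun x => c x * ψ x), hg.integral_eq]
    rw [h4, ← h3]; linarith

/-- A function whose weak `φ`-derivative vanishes depends on `θ` only. -/
lemma exists_eq_fst_of_weak_phi {w : ℝ × S1 → ℝ} (hm : Measurable w) (hw : CollarIntegrable w)
    (h : ∀ η, IsTestFunction η → ∫ z, w z * partialPhi η z ∂coordMeasure = 0) :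
    ∃ c : ℝ → ℝ, Measurable c ∧ w =ᵐ[coordMeasure] fun z => c z.1 := by
  have hcm : Measurable fun θ : ℝ => (2 * π)⁻¹ * ∫ x : S1, w (θ, x) := by
    have h1 : StronglyMeasurable (Function.uncurry fun (θ : ℝ) (x : S1) => w (θ, x)) :=
      hm.stronglyMeasurable
    exact h1.integral_prod_right.measurable.const_mul _
  refine ⟨_, hcm, ?_⟩
  set c := fun θ : ℝ => (2 * π)⁻¹ * ∫ x : S1, w (θ, x) with hc
  have hcC : CollarIntegrable fun z => c z.1 := fun b hb =>
    ((hw b hb).integral_prod_left.const_mul _).comp_fst _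
  have key := ae_eq_zero_of_integral_prod (w := fun z => w z - c z.1) (by fun_prop)
    (hw.sub hcC) fun g ψ hg hψ => ?_
  · filter_upwards [key] with z hz
    exact sub_eq_zero.mp hz
  · have one : SmoothCircle fun _ => 1 := contDiff_const
    have T := hg.isTestFunction hψ
    have T1 := hg.isTestFunction one
    simp_rw [sub_mul]
    rw [integral_sub (T.integrable_mul hw) (T.integrable_mul hcC)]
    set m := (2 * π)⁻¹ * ∫ x, ψ x with hmdef
    -- the primitive of `ψ` minus its mean is again periodic
    have hcont : Continuous fun p : ℝ => ψ p - m := (ContDiff.continuous hψ).sub continuous_const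
    have hd : ∀ p : ℝ, HasDerivAt (fun p => ∫ t in (0 : ℝ)..p, (ψ t - m)) (ψ p - m) p :=
      fun p => (hcont.integral_hasStrictDerivAt 0 p).hasDerivAt
    have hper : Function.Periodic (fun p : ℝ => ∫ t in (0 : ℝ)..p, (ψ t - m)) (2 * π) := by
      intro p
      have hp : Function.Periodic (fun t : ℝ => ψ t - m) (2 * π) := fun t => by simp
      have h1 := hp.intervalIntegral_add_eq p 0
      have h2 : ∫ t in (0 : ℝ)..(0 + 2 * π), (ψ t - m) = 0 := by
        rw [AddCircle.intervalIntegral_preimage (2 * π) 0 (fun x : S1 => ψ x - m),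
          integral_sub (hψ.continuous.integrable_of_hasCompactSupport
            (HasCompactSupport.of_compactSpace _)) (integrable_const _)]
        simp only [hmdef, integral_const, smul_eq_mul, Measure.real, AddCircle.measure_univ,
          ENNReal.toReal_ofReal Real.two_pi_pos.le]
        have := pi_pos.ne'
        field_simp
        ring
      have h3 := intervalIntegral.integral_add_adjacent_intervals
        (hcont.intervalIntegrable 0 p) (hcont.intervalIntegrable (μ := volume) p (p + 2 * π))
      simp only
      rw [← h3, h1, h2, add_zero]
    have hΨ : SmoothCircle hper.lift := by
      change ContDiff ℝ (⊤ : ℕ∞) fun p : ℝ => ∫ t in (0 : ℝ)..p, (ψ t - m)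
      rw [contDiff_infty_iff_deriv]
      refine ⟨fun p => (hd p).differentiableAt, ?_⟩
      have : deriv (fun p => ∫ t in (0 : ℝ)..p, (ψ t - m)) = fun p : ℝ => ψ p - m :=
        funext fun θ => (hd θ).deriv
      rw [this]; exact ContDiff.sub hψ contDiff_const
    have TΨ := hg.isTestFunction hΨ
    have h1 := h _ TΨ
    have h2 : ∀ z : ℝ × S1, partialPhi (fun z => g z.1 * hper.lift z.2) z =
        g z.1 * ψ z.2 - m * (g z.1 * 1) := by
      rintro ⟨θ, x⟩
      obtain ⟨p, rfl⟩ := QuotientAddGroup.mk_surjective x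
      refine (TΨ.hasDerivAt_phi θ p).unique ?_
      exact ((hd p).const_mul (g θ)).congr_deriv
        (show g θ * (ψ p - m) = g θ * ψ p - m * (g θ * 1) by ring)
    simp_rw [h2, mul_sub, mul_left_comm _ m] at h1
    rw [integral_sub (T.integrable_mul hw) ((T1.integrable_mul hw).const_mul _),
      integral_const_mul] at h1
    have h3 : ∫ z, w z * (g z.1 * 1) ∂coordMeasure =
        2 * π * ∫ θ in Ioo 0 (π / 2), c θ * g θ := by
      rw [coordMeasure, integral_prod _ (T1.integrable_mul hw), ← integral_const_mul]
      refine integral_congr_ae (Eventually.of_forall fun θ => ?_)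
      simp only [hc, mul_one]
      rw [integral_mul_const]
      field_simp
    have h4 : ∫ z, c z.1 * (g z.1 * ψ z.2) ∂coordMeasure =
        (∫ θ in Ioo 0 (π / 2), c θ * g θ) * ∫ x, ψ x := by
      simp_rw [← mul_assoc]
      rw [coordMeasure, integral_prod_mul (f := fun θ => c θ * g θ) (g := ψ)]
    have h5 : ∫ x, ψ x = 2 * π * m := by rw [hmdef]; field_simp
    rw [h4, h5]
    rw [h3] at h1
    linarith

/-! ### Absolute continuity on lines -/

/-- The representative in `(0, 2π]` of a point of the circle. -/
def ang (x : S1) : ℝ := AddCircle.equivIoc (2 * π) 0 x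

lemma measurable_ang : Measurable ang :=
  measurable_subtype_coe.comp (AddCircle.measurableEquivIoc (2 * π) 0).measurable

lemma coe_ang (x : S1) : (ang x : S1) = x := (AddCircle.equivIoc (2 * π) 0).symm_apply_apply x

lemma ang_mem (x : S1) : ang x ∈ Ioc 0 (2 * π) := by
  have h := (AddCircle.equivIoc (2 * π) 0 x).2
  exact ⟨h.1, h.2.trans_eq (zero_add _)⟩

lemma ang_coe {p : ℝ} (hp : p ∈ Ioc 0 (2 * π)) : ang p = p := by
  unfold ang
  rw [AddCircle.equivIoc_coe_eq]
  rwa [zero_add]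

lemma integral_circle (f : S1 → ℝ) : ∫ x, f x = ∫ p in (0 : ℝ)..2 * π, f p := by
  rw [← AddCircle.intervalIntegral_preimage (2 * π) 0 f, zero_add]

lemma intervalIntegrable_circle {f : S1 → ℝ} (hf : Integrable f) :
    IntervalIntegrable (fun p : ℝ => f p) volume 0 (2 * π) := by
  rw [intervalIntegrable_iff_integrableOn_Ioc_of_le Real.two_pi_pos.le]
  have := (AddCircle.measurePreserving_mk (2 * π) 0).integrable_comp_of_integrable hf
  rwa [zero_add] at this

lemma ae_circle_iff {p : S1 → Prop} :
    (∀ᵐ x, p x) → ∀ᵐ t : ℝ, t ∈ Ioc 0 (2 * π) → p t := by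
  intro h
  have := (AddCircle.measurePreserving_mk (2 * π) 0).quasiMeasurePreserving.ae h
  rwa [zero_add, ae_restrict_iff' measurableSet_Ioc] at this

/-- The primitive in `θ` that vanishes at `θ = 0`. -/
def thetaPrim (f : ℝ × S1 → ℝ) (z : ℝ × S1) : ℝ := ∫ t in Ioc 0 z.1, f (t, z.2)

/-- The primitive in `φ ∈ (0, 2π]` that vanishes at `φ = 0`. -/
def phiPrim (f : ℝ × S1 → ℝ) (z : ℝ × S1) : ℝ := ∫ r in Ioc 0 (ang z.2), f (z.1, (r : S1))

lemma thetaPrim_eq {f : ℝ × S1 → ℝ} {θ : ℝ} (h : 0 ≤ θ) (x : S1) :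
    thetaPrim f (θ, x) = ∫ t in (0 : ℝ)..θ, f (t, x) := by
  rw [intervalIntegral.integral_of_le h]; rfl

lemma phiPrim_eq {f : ℝ × S1 → ℝ} (θ : ℝ) {p : ℝ} (hp : p ∈ Ioc 0 (2 * π)) :
    phiPrim f (θ, p) = ∫ r in (0 : ℝ)..p, f (θ, (r : S1)) := by
  rw [intervalIntegral.integral_of_le hp.1.le, phiPrim]
  simp only [ang_coe hp]

lemma measurable_thetaPrim {f : ℝ × S1 → ℝ} (hf : Measurable f) : Measurable (thetaPrim f) := by
  have h1 : StronglyMeasurable (Function.uncurry fun (z : ℝ × S1) (t : ℝ) =>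
      (Ioc 0 z.1).indicator (fun t => f (t, z.2)) t) := by
    refine Measurable.stronglyMeasurable ?_
    have : (Function.uncurry fun (z : ℝ × S1) (t : ℝ) =>
      (Ioc 0 z.1).indicator (fun t => f (t, z.2)) t) =
        {q : (ℝ × S1) × ℝ | 0 < q.2 ∧ q.2 ≤ q.1.1}.indicator fun q => f (q.2, q.1.2) := by
      ext q; simp only [Function.uncurry, indicator, mem_Ioc, mem_ofPred_eq]
    rw [this]
    refine (hf.comp (by fun_prop)).indicator ?_
    exact (measurableSet_lt measurable_const measurable_snd).inter
      (measurableSet_le measurable_snd (by fun_prop))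
  convert (h1.integral_prod_right (ν := volume)).measurable using 1
  ext z
  rw [integral_indicator measurableSet_Ioc]; rfl

lemma measurable_phiPrim {f : ℝ × S1 → ℝ} (hf : Measurable f) : Measurable (phiPrim f) := by
  have h1 : StronglyMeasurable (Function.uncurry fun (z : ℝ × S1) (t : ℝ) =>
      (Ioc 0 (ang z.2)).indicator (fun t : ℝ => f (z.1, (t : S1))) t) := by
    refine Measurable.stronglyMeasurable ?_
    have : (Function.uncurry fun (z : ℝ × S1) (t : ℝ) =>
      (Ioc 0 (ang z.2)).indicator (fun t : ℝ => f (z.1, (t : S1))) t) =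
        {q : (ℝ × S1) × ℝ | 0 < q.2 ∧ q.2 ≤ ang q.1.2}.indicator
          fun q => f (q.1.1, (q.2 : S1)) := by
      ext q; simp only [Function.uncurry, indicator, mem_Ioc, mem_ofPred_eq]
    rw [this]
    have hc : Measurable fun t : ℝ => (t : S1) := AddCircle.measurable_mk'
    refine (hf.comp (by fun_prop)).indicator ?_
    exact (measurableSet_lt measurable_const measurable_snd).inter
      (measurableSet_le measurable_snd (measurable_ang.comp (by fun_prop)))
  convert (h1.integral_prod_right (ν := volume)).measurable using 1
  ext z
  rw [integral_indicator measurableSet_Ioc]; rfl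

lemma CollarIntegrable.ae_intervalIntegrable {f : ℝ × S1 → ℝ} (hf : CollarIntegrable f) {b : ℝ}
    (hb0 : 0 ≤ b) (hb : b < π / 2) :
    ∀ᵐ x : S1, IntervalIntegrable (fun θ => f (θ, x)) volume 0 b := by
  filter_upwards [(hf b hb).prod_left_ae] with x hx
  rw [intervalIntegrable_iff_integrableOn_Ioo_of_le hb0]
  exact hx

lemma CollarIntegrable.thetaPrim {f : ℝ × S1 → ℝ} (hm : Measurable f) (hf : CollarIntegrable f) :
    CollarIntegrable (thetaPrim f) := by
  intro b hb
  have h1 : Integrable fun x : S1 => ∫ t in Ioo 0 b, ‖f (t, x)‖ := (hf b hb).norm.integral_prod_right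
  refine (h1.comp_snd ((volume : Measure ℝ).restrict (Ioo 0 b))).mono'
    (measurable_thetaPrim hm).aestronglyMeasurable ?_
  have h2 : ∀ᵐ z ∂collar b, IntegrableOn (fun t => f (t, z.2)) (Ioo 0 b) :=
    Measure.quasiMeasurePreserving_snd.ae (hf b hb).prod_left_ae
  have h3 : ∀ᵐ z ∂collar b, z.1 ∈ Ioo 0 b :=
    Measure.quasiMeasurePreserving_fst.ae (ae_restrict_mem measurableSet_Ioo)
  filter_upwards [h2, h3] with z hz hzb
  exact (norm_integral_le_integral_norm _).trans (setIntegral_mono_set hz.norm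
    (Eventually.of_forall fun t => norm_nonneg _)
    (Eventually.of_forall fun t ht => ⟨ht.1, ht.2.trans_lt hzb.2⟩))

lemma CollarIntegrable.phiPrim {f : ℝ × S1 → ℝ} (hm : Measurable f) (hf : CollarIntegrable f) :
    CollarIntegrable (phiPrim f) := by
  intro b hb
  have h1 : Integrable (fun θ => ∫ x : S1, ‖f (θ, x)‖) ((volume : Measure ℝ).restrict (Ioo 0 b)) :=
    (hf b hb).norm.integral_prod_left
  refine (h1.comp_fst (volume : Measure S1)).mono'
    (measurable_phiPrim hm).aestronglyMeasurable ?_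
  have h2 : ∀ᵐ z ∂collar b, Integrable (fun x => f (z.1, x)) :=
    Measure.quasiMeasurePreserving_fst.ae (hf b hb).prod_right_ae
  filter_upwards [h2] with z hz
  have h4 := intervalIntegrable_circle hz.norm
  rw [intervalIntegrable_iff_integrableOn_Ioc_of_le Real.two_pi_pos.le] at h4
  rw [integral_circle, intervalIntegral.integral_of_le Real.two_pi_pos.le]
  exact (norm_integral_le_integral_norm _).trans (setIntegral_mono_set h4
    (Eventually.of_forall fun t => norm_nonneg _)
    (Eventually.of_forall fun t ht => ⟨ht.1, ht.2.trans (ang_mem _).2⟩))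

/-- Fubini for the pairing with a test function, integrating along the meridians first. -/
lemma IsTestFunction.integral_mul_eq_meridians {η f : ℝ × S1 → ℝ} (hη : IsTestFunction η)
    (hf : CollarIntegrable f) {b : ℝ} (hb0 : 0 < b) (hb : b < π / 2)
    (hs : ∀ z : ℝ × S1, b ≤ z.1 → η z = 0) :
    ∫ z, f z * η z ∂coordMeasure = ∫ x : S1, ∫ θ in (0 : ℝ)..b, f (θ, x) * η (θ, x) := by
  have hi := hη.integrable_mul hf
  rw [coordMeasure, integral_prod_symm _ hi]
  refine integral_congr_ae (Eventually.of_forall fun x => ?_)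
  simp only
  rw [intervalIntegral.integral_of_le hb0.le, integral_Ioc_eq_integral_Ioo]
  refine setIntegral_eq_of_subset_of_forall_sdiff_eq_zero measurableSet_Ioo
    (Ioo_subset_Ioo_right hb.le) fun θ hθ => ?_
  rw [hs (θ, x), mul_zero]
  by_contra h
  exact hθ.2 ⟨hθ.1.1, not_le.mp h⟩

/-- Fubini for the pairing with a test function, integrating along the parallels first. -/
lemma IsTestFunction.integral_mul_eq_parallels {η f : ℝ × S1 → ℝ} (hη : IsTestFunction η)
    (hf : CollarIntegrable f) :
    ∫ z, f z * η z ∂coordMeasure =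
      ∫ θ in Ioo 0 (π / 2), ∫ p in (0 : ℝ)..2 * π, f (θ, (p : S1)) * η (θ, (p : S1)) := by
  rw [coordMeasure, integral_prod _ (hη.integrable_mul hf)]
  simp_rw [integral_circle]

lemma IsTestFunction.continuous_partialTheta_line {η : ℝ × S1 → ℝ} (hη : IsTestFunction η)
    (x : S1) : Continuous fun t => partialTheta η (t, x) :=
  hη.partialTheta_isTest.continuous.comp (by fun_prop)

lemma IsTestFunction.continuous_partialPhi_line {η : ℝ × S1 → ℝ} (hη : IsTestFunction η)
    (θ : ℝ) : Continuous fun p : ℝ => partialPhi η (θ, (p : S1)) :=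
  hη.partialPhi_isTest.continuous.comp (by
    have : Continuous fun p : ℝ => (p : S1) := AddCircle.continuous_mk' _
    fun_prop)

lemma IsTestFunction.exists_common_lt {η : ℝ × S1 → ℝ} (hη : IsTestFunction η) :
    ∃ b, 0 < b ∧ b < π / 2 ∧ (∀ z : ℝ × S1, b ≤ z.1 → η z = 0) ∧
      ∀ z : ℝ × S1, b ≤ z.1 → partialTheta η z = 0 := by
  obtain ⟨b, hb0, hb, hs⟩ := hη.exists_lt
  obtain ⟨b', _, hb', hs'⟩ := hη.partialTheta_isTest.exists_lt
  exact ⟨max b b', hb0.trans_le (le_max_left _ _), max_lt hb hb',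
    fun z hz => hs z ((le_max_left _ _).trans hz), fun z hz => hs' z ((le_max_right _ _).trans hz)⟩

lemma integral_thetaPrim_mul {η f : ℝ × S1 → ℝ} (hη : IsTestFunction η) (hm : Measurable f)
    (hf : CollarIntegrable f) :
    ∫ z, thetaPrim f z * partialTheta η z ∂coordMeasure = -∫ z, f z * η z ∂coordMeasure := by
  obtain ⟨b, hb0, hb, hs, hs'⟩ := hη.exists_common_lt
  rw [hη.partialTheta_isTest.integral_mul_eq_meridians (hf.thetaPrim hm) hb0 hb hs',
    hη.integral_mul_eq_meridians hf hb0 hb hs, ← integral_neg]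
  refine integral_congr_ae ?_
  filter_upwards [hf.ae_intervalIntegrable hb0.le hb] with x hx
  have := integral_primitive_mul (c := 0) hx (fun t => hη.hasDerivAt_theta t x)
    (hη.continuous_partialTheta_line x)
  rw [hs (b, x) le_rfl] at this
  simp only [mul_zero, zero_mul, sub_zero, zero_sub, zero_add] at this
  rw [← this]
  refine intervalIntegral.integral_congr fun t ht => ?_
  rw [uIcc_of_le hb0.le] at ht
  simp only [thetaPrim_eq ht.1]

lemma integral_phiPrim_mul {η f : ℝ × S1 → ℝ} (hη : IsTestFunction η) (hm : Measurable f)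
    (hf : CollarIntegrable f) (h0 : ∀ᵐ θ ∂thetaMeasure, ∫ x : S1, f (θ, x) = 0) :
    ∫ z, phiPrim f z * partialPhi η z ∂coordMeasure = -∫ z, f z * η z ∂coordMeasure := by
  rw [hη.partialPhi_isTest.integral_mul_eq_parallels (hf.phiPrim hm),
    hη.integral_mul_eq_parallels hf, ← integral_neg]
  refine integral_congr_ae ?_
  filter_upwards [hf.slice_integrable, h0] with θ hx h0
  have := integral_primitive_mul (c := 0) (intervalIntegrable_circle hx)
    (fun p => hη.hasDerivAt_phi θ p) (hη.continuous_partialPhi_line θ)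
  rw [integral_circle] at h0
  rw [h0] at this
  simp only [zero_mul, sub_zero, zero_sub, zero_add] at this
  rw [← this]
  refine intervalIntegral.integral_congr_ae (Eventually.of_forall fun p hp => ?_)
  rw [uIoc_of_le Real.two_pi_pos.le] at hp
  simp only [phiPrim_eq θ hp]

namespace WeightedH1

variable {a : ℝ}

/-- Along almost every meridian, `u` is the primitive of its weak derivative, starting from a value
on the boundary circle. -/
lemma exists_thetaPrim (ha : a < 1) {u : WeightedH1 a} (hu : u.IsMeasurable) :
    ∃ g : S1 → ℝ, Measurable g ∧
      u.fn =ᵐ[coordMeasure] fun z => g z.2 + thetaPrim u.dTheta z := by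
  have c1 := collarIntegrable_of_memLp ha u.memLp_fn
  have c2 := collarIntegrable_of_memLp ha u.memLp_dTheta
  obtain ⟨g, hg, -, h⟩ := exists_eq_snd_of_weak_theta (w := fun z => u.fn z - thetaPrim u.dTheta z)
    (hu.fn.sub (measurable_thetaPrim hu.dTheta)) (c1.sub (c2.thetaPrim hu.dTheta)) fun η hη => by
      simp_rw [sub_mul]
      rw [integral_sub (hη.partialTheta_isTest.integrable_mul c1)
        (hη.partialTheta_isTest.integrable_mul (c2.thetaPrim hu.dTheta)), u.weak_dTheta η hη,
        integral_thetaPrim_mul hη hu.dTheta c2, sub_self]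
  refine ⟨g, hg, ?_⟩
  filter_upwards [h] with z hz
  linarith

lemma integral_dPhi_eq_zero (ha : a < 1) (u : WeightedH1 a) :
    ∀ᵐ θ ∂thetaMeasure, ∫ x : S1, u.dPhi (θ, x) = 0 := by
  have c := collarIntegrable_of_memLp ha u.memLp_dPhi'
  have one : SmoothCircle fun _ => 1 := contDiff_const
  rw [ae_restrict_iff' measurableSet_Ioo]
  refine isOpen_Ioo.ae_eq_zero_of_integral_contDiff_smul_eq_zero ?_ ?_
  · rw [locallyIntegrableOn_iff (isOpen_Ioo.isLocallyClosed)]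
    intro k hk hkc
    rcases k.eq_empty_or_nonempty with rfl | hne
    · simp
    obtain ⟨β, hβ⟩ := hkc.exists_isGreatest hne
    have hb : (β + π / 2) / 2 < π / 2 := by linarith [(hk hβ.1).2]
    have hsub : k ⊆ Ioo 0 ((β + π / 2) / 2) := fun t ht =>
      ⟨(hk ht).1, by linarith [hβ.2 ht, (hk hβ.1).2]⟩
    exact IntegrableOn.mono_set (c _ hb).integral_prod_left hsub
  · intro g h1 h2 h3
    have hg := isBump_of_tsupport h1 h2 h3
    have hT := hg.isTestFunction one
    have h4 := u.weak_dPhi _ hT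
    have h5 : ∀ z, partialPhi (fun z : ℝ × S1 => g z.1 * 1) z = 0 := fun z => by
      simp [partialPhi]
    have h6 := hT.integrable_mul c
    simp_rw [h5, mul_zero, integral_zero] at h4
    rw [coordMeasure, integral_prod _ h6] at h4
    rw [← neg_eq_zero, h4, ← integral_indicator measurableSet_Ioo]
    congr 1
    refine integral_congr_ae (Eventually.of_forall fun θ => ?_)
    by_cases hθ : θ ∈ Ioo 0 (π / 2)
    · simp only [hθ, indicator_of_mem, smul_eq_mul, mul_one]
      rw [integral_mul_const, mul_comm]
    · have : g θ = 0 := by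
        by_contra hne
        exact hθ (h3 (subset_tsupport g hne))
      simp [hθ, this]

/-- Along almost every parallel, `u` is a primitive of its weak derivative. -/
lemma exists_phiPrim (ha : a < 1) {u : WeightedH1 a} (hu : u.IsMeasurable) :
    ∃ h : ℝ → ℝ, Measurable h ∧
      u.fn =ᵐ[coordMeasure] fun z => h z.1 + phiPrim u.dPhi z := by
  have c1 := collarIntegrable_of_memLp ha u.memLp_fn
  have c2 := collarIntegrable_of_memLp ha u.memLp_dPhi'
  obtain ⟨g, hg, h⟩ := exists_eq_fst_of_weak_phi (w := fun z => u.fn z - phiPrim u.dPhi z)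
    (hu.fn.sub (measurable_phiPrim hu.dPhi)) (c1.sub (c2.phiPrim hu.dPhi)) fun η hη => by
      simp_rw [sub_mul]
      rw [integral_sub (hη.partialPhi_isTest.integrable_mul c1)
        (hη.partialPhi_isTest.integrable_mul (c2.phiPrim hu.dPhi)), u.weak_dPhi η hη,
        integral_phiPrim_mul hη hu.dPhi c2 (u.integral_dPhi_eq_zero ha), sub_self]
  refine ⟨g, hg, ?_⟩
  filter_upwards [h] with z hz
  linarith

end WeightedH1

/-! ### Absolute values, with a sign on each half of the circle -/

/-- The function on the circle with the value `c₁` on the half `(0, π]` and `c₂` on `(π, 2π]`. -/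
def halfSign (c₁ c₂ : ℝ) (x : S1) : ℝ := if ang x ≤ π then c₁ else c₂

lemma measurable_halfSign (c₁ c₂ : ℝ) : Measurable (halfSign c₁ c₂) :=
  Measurable.ite (measurableSet_le measurable_ang measurable_const) measurable_const
    measurable_const

lemma halfSign_coe (c₁ c₂ : ℝ) {p : ℝ} (hp : p ∈ Ioc 0 (2 * π)) :
    halfSign c₁ c₂ p = if p ≤ π then c₁ else c₂ := by
  rw [halfSign, ang_coe hp]

lemma abs_halfSign_le {c₁ c₂ : ℝ} (h₁ : |c₁| ≤ 1) (h₂ : |c₂| ≤ 1) (x : S1) :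
    |halfSign c₁ c₂ x| ≤ 1 := by
  unfold halfSign; split_ifs <;> assumption

lemma CollarIntegrable.congr {f g : ℝ × S1 → ℝ} (hf : CollarIntegrable f)
    (h : f =ᵐ[coordMeasure] g) : CollarIntegrable g := by
  intro b hb
  refine (hf b hb).congr ?_
  rw [collar_eq hb.le]
  exact ae_restrict_of_ae h

section Circle

variable {f ρ ρ' : ℝ → ℝ} {c c₁ c₂ : ℝ}

lemma integral_halfSign_mul (c₁ c₂ : ℝ) {F : ℝ → ℝ} (hF : IntervalIntegrable F volume 0 (2 * π)) :
    ∫ p in (0 : ℝ)..2 * π, halfSign c₁ c₂ p * F p =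
      c₁ * (∫ p in (0 : ℝ)..π, F p) + c₂ * ∫ p in π..2 * π, F p := by
  have hπ := pi_pos
  have h1 : IntervalIntegrable F volume 0 π := hF.mono_set (by
    rw [uIcc_of_le hπ.le, uIcc_of_le (by linarith)]; exact Icc_subset_Icc_right (by linarith))
  have h2 : IntervalIntegrable F volume π (2 * π) := hF.mono_set (by
    rw [uIcc_of_le (by linarith), uIcc_of_le (by linarith)]
    exact Icc_subset_Icc_left (by linarith))
  have e1 : EqOn (fun p => c₁ * F p) (fun p : ℝ => halfSign c₁ c₂ p * F p) (uIoc 0 π) := by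
    intro p hp
    rw [uIoc_of_le hπ.le] at hp
    simp only [halfSign_coe c₁ c₂ ⟨hp.1, hp.2.trans (by linarith)⟩, hp.2, if_true]
  have e2 : EqOn (fun p => c₂ * F p) (fun p : ℝ => halfSign c₁ c₂ p * F p) (uIoc π (2 * π)) := by
    intro p hp
    rw [uIoc_of_le (by linarith)] at hp
    simp only [halfSign_coe c₁ c₂ ⟨hπ.trans hp.1, hp.2⟩, not_le.mpr hp.1, if_false]
  have i1 := (h1.const_mul c₁).congr e1
  have i2 := (h2.const_mul c₂).congr e2
  rw [← intervalIntegral.integral_add_adjacent_intervals i1 i2,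
    ← intervalIntegral.integral_const_mul, ← intervalIntegral.integral_const_mul]
  congr 1
  · exact intervalIntegral.integral_congr_ae (Eventually.of_forall fun p hp => (e1 hp).symm)
  · exact intervalIntegral.integral_congr_ae (Eventually.of_forall fun p hp => (e2 hp).symm)

/-- Integration by parts on the circle for `χ |v|`, where `χ` is constant on the two halves of the
circle. Either `χ` is constant, or `v` vanishes at the two points where `χ` jumps. -/
lemma integral_halfSign_abs_mul (hf : IntervalIntegrable f volume 0 (2 * π))
    (h0 : ∫ p in (0 : ℝ)..2 * π, f p = 0)
    (H : c₁ = c₂ ∨ (c = 0 ∧ c + ∫ p in (0 : ℝ)..π, f p = 0))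
    (hρ : ∀ t, HasDerivAt ρ (ρ' t) t) (hρ' : Continuous ρ') (hper : ρ (2 * π) = ρ 0) :
    ∫ p in (0 : ℝ)..2 * π, halfSign c₁ c₂ p * (|c + ∫ r in (0 : ℝ)..p, f r| * ρ' p) =
      -∫ p in (0 : ℝ)..2 * π,
        halfSign c₁ c₂ p * (Real.sign (c + ∫ r in (0 : ℝ)..p, f r) * f p * ρ p) := by
  have hπ := pi_pos
  have h1 : IntervalIntegrable f volume 0 π := hf.mono_set (by
    rw [uIcc_of_le hπ.le, uIcc_of_le (by linarith)]; exact Icc_subset_Icc_right (by linarith))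
  have h2 : IntervalIntegrable f volume π (2 * π) := hf.mono_set (by
    rw [uIcc_of_le (by linarith), uIcc_of_le (by linarith)]
    exact Icc_subset_Icc_left (by linarith))
  have hcont : ContinuousOn (fun p => c + ∫ r in (0 : ℝ)..p, f r) (uIcc 0 (2 * π)) :=
    (absolutelyContinuous_primitive hf c).continuousOn
  have hρc : Continuous ρ := continuous_iff_continuousAt.mpr fun t => (hρ t).continuousAt
  have i1 : IntervalIntegrable (fun p => |c + ∫ r in (0 : ℝ)..p, f r| * ρ' p) volume 0 (2 * π) :=
    (hcont.abs.mul hρ'.continuousOn).intervalIntegrable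
  have hsm : AEStronglyMeasurable (fun p => Real.sign (c + ∫ r in (0 : ℝ)..p, f r))
      (volume.restrict (uIoc 0 (2 * π))) :=
    (measurable_realSign.comp_aemeasurable
      ((hcont.mono uIoc_subset_uIcc).aemeasurable measurableSet_uIoc)).aestronglyMeasurable
  have i2 : IntervalIntegrable (fun p => Real.sign (c + ∫ r in (0 : ℝ)..p, f r) * f p * ρ p)
      volume 0 (2 * π) := by
    refine IntervalIntegrable.mul_continuousOn ?_ hρc.continuousOn
    rw [intervalIntegrable_iff] at hf ⊢
    exact hf.bdd_mul (c := 1) hsm (Eventually.of_forall fun p => abs_realSign_le _)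
  rw [integral_halfSign_mul c₁ c₂ i1, integral_halfSign_mul c₁ c₂ i2]
  have e1 := integral_abs_primitive_mul (c := c) h1 hρ hρ'
  have e2 := integral_abs_primitive_mul (c := c + ∫ r in (0 : ℝ)..π, f r) h2 hρ hρ'
  have e3 : ∀ p ∈ uIcc π (2 * π), c + (∫ r in (0 : ℝ)..π, f r) + ∫ r in π..p, f r =
      c + ∫ r in (0 : ℝ)..p, f r := by
    intro p hp
    rw [add_assoc, intervalIntegral.integral_add_adjacent_intervals h1]
    exact h2.mono_set (uIcc_subset_uIcc_left hp)
  have e4 : c + (∫ r in (0 : ℝ)..π, f r) + ∫ r in π..2 * π, f r = c := by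
    rw [e3 _ right_mem_uIcc, h0, add_zero]
  have r1 : ∫ p in π..2 * π, |c + (∫ r in (0 : ℝ)..π, f r) + ∫ r in π..p, f r| * ρ' p =
      ∫ p in π..2 * π, |c + ∫ r in (0 : ℝ)..p, f r| * ρ' p :=
    intervalIntegral.integral_congr fun p hp => by simp only [e3 p hp]
  have r2 : ∫ p in π..2 * π,
        Real.sign (c + (∫ r in (0 : ℝ)..π, f r) + ∫ r in π..p, f r) * f p * ρ p =
      ∫ p in π..2 * π, Real.sign (c + ∫ r in (0 : ℝ)..p, f r) * f p * ρ p :=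
    intervalIntegral.integral_congr fun p hp => by simp only [e3 p hp]
  rw [e4, r1, r2, hper] at e2
  rw [e1, e2]
  rcases H with rfl | ⟨hc, hc'⟩
  · ring
  · rw [hc', hc]; simp only [abs_zero]; ring

end Circle

namespace WeightedH1

variable {a : ℝ}

lemma memLp_bdd_mul {χ f : ℝ × S1 → ℝ} (hχ : Measurable χ) (h1 : ∀ z, |χ z| ≤ 1)
    (hf : MemLp f 2 (weightedArea a)) : MemLp (fun z => χ z * f z) 2 (weightedArea a) := by
  refine hf.mono (hχ.aestronglyMeasurable.mul hf.1) (Eventually.of_forall fun z => ?_)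
  rw [norm_mul]
  exact mul_le_of_le_one_left (norm_nonneg _) (h1 z)

lemma ae_coord_slices {p : ℝ × S1 → Prop} (h : ∀ᵐ z ∂coordMeasure, p z) :
    ∀ᵐ θ ∂thetaMeasure, ∀ᵐ x : S1, p (θ, x) := Measure.ae_ae_of_ae_prod h

/-- An odd function on a parallel that is absolutely continuous vanishes at the fixed points
`φ = 0` and `φ = π` of the reflection. -/
lemma odd_primitive_eq_zero {f : ℝ → ℝ} {c : ℝ} (hf : IntervalIntegrable f volume 0 (2 * π))
    (h0 : ∫ p in (0 : ℝ)..2 * π, f p = 0)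
    (hodd : ∀ᵐ p : ℝ, p ∈ Ioo 0 (2 * π) →
      c + ∫ r in (0 : ℝ)..(2 * π - p), f r = -(c + ∫ r in (0 : ℝ)..p, f r)) :
    c = 0 ∧ c + ∫ p in (0 : ℝ)..π, f p = 0 := by
  have hπ := pi_pos
  have hcont : ContinuousOn (fun p => c + ∫ r in (0 : ℝ)..p, f r) (Icc 0 (2 * π)) := by
    have := (absolutelyContinuous_primitive hf c).continuousOn
    rwa [uIcc_of_le (by linarith)] at this
  have hcont2 : ContinuousOn (fun p => c + ∫ r in (0 : ℝ)..(2 * π - p), f r) (Icc 0 (2 * π)) :=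
    hcont.comp (f := fun p => 2 * π - p) (by fun_prop)
      (fun p hp => ⟨by linarith [hp.2], by linarith [hp.1]⟩)
  have hE := Measure.eqOn_Icc_of_ae_eq volume (a := 0) (b := 2 * π) (by positivity)
    (f := fun p => c + ∫ r in (0 : ℝ)..(2 * π - p), f r)
    (g := fun p => -(c + ∫ r in (0 : ℝ)..p, f r)) (by
      rw [← restrict_Ioo_eq_restrict_Icc]
      rw [EventuallyEq, ae_restrict_iff' measurableSet_Ioo]
      exact hodd) hcont2 hcont.neg
  have h1 := hE (left_mem_Icc.mpr (by linarith))
  have h2 := hE (x := π) ⟨hπ.le, by linarith⟩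
  simp only [sub_zero, h0, intervalIntegral.integral_same] at h1
  simp only [show 2 * π - π = π by ring] at h2
  constructor <;> linarith

/-- `χ |u|` is again in the weighted Sobolev space, where `χ` is constant on each half of the
circle, provided that `χ` is constant or `u` is odd under `φ ↦ -φ`. -/
lemma exists_halfSign_abs (ha : a < 1) {u : WeightedH1 a} (hu : u.IsMeasurable) {c₁ c₂ : ℝ}
    (h₁ : |c₁| ≤ 1) (h₂ : |c₂| ≤ 1)
    (H : c₁ = c₂ ∨ ∀ᵐ z ∂coordMeasure, u.fn (z.1, -z.2) = -u.fn z) :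
    ∃ v : WeightedH1 a, v.fn = (fun z => halfSign c₁ c₂ z.2 * |u.fn z|) ∧
      v.dTheta = (fun z => halfSign c₁ c₂ z.2 * (Real.sign (u.fn z) * u.dTheta z)) ∧
      v.dPhi = (fun z => halfSign c₁ c₂ z.2 * (Real.sign (u.fn z) * u.dPhi z)) := by
  have hχm : Measurable fun z : ℝ × S1 => halfSign c₁ c₂ z.2 :=
    (measurable_halfSign c₁ c₂).comp measurable_snd
  have hχ : ∀ z : ℝ × S1, |halfSign c₁ c₂ z.2| ≤ 1 := fun z => abs_halfSign_le h₁ h₂ z.2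
  have hsm : Measurable fun z => Real.sign (u.fn z) := measurable_realSign.comp hu.fn
  have m1 : MemLp (fun z => halfSign c₁ c₂ z.2 * |u.fn z|) 2 (weightedArea a) :=
    memLp_bdd_mul hχm hχ u.memLp_fn.abs
  have m2 : MemLp (fun z => halfSign c₁ c₂ z.2 * (Real.sign (u.fn z) * u.dTheta z)) 2
      (weightedArea a) :=
    memLp_bdd_mul hχm hχ (memLp_bdd_mul hsm (fun z => abs_realSign_le _) u.memLp_dTheta)
  have m3 : MemLp (fun z => halfSign c₁ c₂ z.2 * (Real.sign (u.fn z) * u.dPhi z)) 2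
      (weightedArea a) :=
    memLp_bdd_mul hχm hχ (memLp_bdd_mul hsm (fun z => abs_realSign_le _) u.memLp_dPhi')
  have m3' : MemLp (fun z => halfSign c₁ c₂ z.2 * (Real.sign (u.fn z) * u.dPhi z) / cos z.1) 2
      (weightedArea a) := by
    have := memLp_bdd_mul hχm hχ (memLp_bdd_mul hsm (fun z => abs_realSign_le _) u.memLp_dPhi)
    refine this.ae_eq (Eventually.of_forall fun z => ?_)
    simp only; ring
  have C1 := collarIntegrable_of_memLp ha m1
  have C2 := collarIntegrable_of_memLp ha m2
  have C3 := collarIntegrable_of_memLp ha m3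
  refine ⟨⟨_, _, _, m1, m2, m3', fun η hη => ?_, fun η hη => ?_⟩, rfl, rfl, rfl⟩
  · obtain ⟨g, hg, hug⟩ := exists_thetaPrim ha hu
    obtain ⟨b, hb0, hb, hs, hs'⟩ := hη.exists_common_lt
    have e1 : (fun z => halfSign c₁ c₂ z.2 * |u.fn z|) =ᵐ[coordMeasure]
        fun z => halfSign c₁ c₂ z.2 * |g z.2 + thetaPrim u.dTheta z| := by
      filter_upwards [hug] with z hz; rw [hz]
    have e2 : (fun z => halfSign c₁ c₂ z.2 * (Real.sign (u.fn z) * u.dTheta z)) =ᵐ[coordMeasure]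
        fun z => halfSign c₁ c₂ z.2 *
          (Real.sign (g z.2 + thetaPrim u.dTheta z) * u.dTheta z) := by
      filter_upwards [hug] with z hz; rw [hz]
    rw [integral_mul_congr e1, integral_mul_congr e2,
      hη.partialTheta_isTest.integral_mul_eq_meridians (C1.congr e1) hb0 hb hs',
      hη.integral_mul_eq_meridians (C2.congr e2) hb0 hb hs, ← integral_neg]
    refine integral_congr_ae ?_
    filter_upwards [(collarIntegrable_of_memLp ha u.memLp_dTheta).ae_intervalIntegrable hb0.le hb]
      with x hx
    have := integral_abs_primitive_mul (c := g x) hx (fun t => hη.hasDerivAt_theta t x)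
      (hη.continuous_partialTheta_line x)
    have hz : η (0, x) = 0 := by
      obtain ⟨α, β, hα, hβ, hs⟩ := hη.compactSupport
      exact IsTestFunction.eq_zero_of_notMem hs fun h => absurd h.1 (not_le.mpr hα)
    rw [hs (b, x) le_rfl, hz] at this
    simp only [mul_zero, sub_zero, zero_sub] at this
    simp_rw [mul_assoc (halfSign _ _ _)]
    rw [intervalIntegral.integral_const_mul, intervalIntegral.integral_const_mul, ← mul_neg]
    congr 1
    have r1 : ∀ t ∈ uIcc 0 b, thetaPrim u.dTheta (t, x) = ∫ r in (0 : ℝ)..t, u.dTheta (r, x) := by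
      intro t ht
      rw [uIcc_of_le hb0.le] at ht
      exact thetaPrim_eq ht.1 x
    rw [intervalIntegral.integral_congr (g := fun t =>
      |g x + ∫ r in (0 : ℝ)..t, u.dTheta (r, x)| * partialTheta η (t, x))
      (fun t ht => by simp only [r1 t ht]), this]
    congr 1
    exact intervalIntegral.integral_congr fun t ht => by simp only [r1 t ht]
  · obtain ⟨h, hh, huh⟩ := exists_phiPrim ha hu
    have e1 : (fun z => halfSign c₁ c₂ z.2 * |u.fn z|) =ᵐ[coordMeasure]
        fun z => halfSign c₁ c₂ z.2 * |h z.1 + phiPrim u.dPhi z| := by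
      filter_upwards [huh] with z hz; rw [hz]
    have e2 : (fun z => halfSign c₁ c₂ z.2 * (Real.sign (u.fn z) * u.dPhi z)) =ᵐ[coordMeasure]
        fun z => halfSign c₁ c₂ z.2 * (Real.sign (h z.1 + phiPrim u.dPhi z) * u.dPhi z) := by
      filter_upwards [huh] with z hz; rw [hz]
    rw [integral_mul_congr e1, integral_mul_congr e2,
      hη.partialPhi_isTest.integral_mul_eq_parallels (C1.congr e1),
      hη.integral_mul_eq_parallels (C3.congr e2), ← integral_neg]
    have hodd : c₁ = c₂ ∨ ∀ᵐ θ ∂thetaMeasure, ∀ᵐ x : S1, u.fn (θ, -x) = -u.fn (θ, x) :=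
      H.imp id (ae_coord_slices (p := fun z => u.fn (z.1, -z.2) = -u.fn z))
    have hodd' : ∀ᵐ θ ∂thetaMeasure, c₁ = c₂ ∨ ∀ᵐ x : S1, u.fn (θ, -x) = -u.fn (θ, x) := by
      rcases hodd with h | h
      · exact Eventually.of_forall fun _ => Or.inl h
      · filter_upwards [h] with θ h using Or.inr h
    refine integral_congr_ae ?_
    filter_upwards [(collarIntegrable_of_memLp ha u.memLp_dPhi').slice_integrable,
      u.integral_dPhi_eq_zero ha, ae_coord_slices huh, hodd'] with θ hi h0 hrep hod
    have hii := intervalIntegrable_circle hi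
    rw [integral_circle] at h0
    have r1 : ∀ p ∈ uIoc 0 (2 * π), phiPrim u.dPhi (θ, ((p : ℝ) : S1)) =
        ∫ r in (0 : ℝ)..p, u.dPhi (θ, (r : S1)) := by
      intro p hp
      rw [uIoc_of_le Real.two_pi_pos.le] at hp
      exact phiPrim_eq θ hp
    have H' : c₁ = c₂ ∨ (h θ = 0 ∧ h θ + ∫ p in (0 : ℝ)..π, u.dPhi (θ, (p : S1)) = 0) := by
      refine hod.imp id fun hod => odd_primitive_eq_zero hii h0 ?_
      have n1 := ae_circle_iff hrep
      have n2 := ae_circle_iff ((Measure.measurePreserving_neg (volume : Measure S1)).quasiMeasurePreserving.ae hrep)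
      have n3 := ae_circle_iff hod
      filter_upwards [n1, n2, n3] with p n1 n2 n3 hp
      have hp' : p ∈ Ioc 0 (2 * π) := ⟨hp.1, hp.2.le⟩
      have hq : 2 * π - p ∈ Ioc 0 (2 * π) := ⟨by linarith [hp.2], by linarith [hp.1]⟩
      have hneg : (-(p : S1)) = ((2 * π - p : ℝ) : S1) := by
        rw [AddCircle.coe_sub, AddCircle.coe_period, zero_sub]
      have n1 := n1 hp'
      have n2 := n2 hp'
      have n3 := n3 hp'
      rw [hneg, phiPrim_eq θ hq] at n2
      rw [phiPrim_eq θ hp'] at n1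
      rw [hneg, n1, n2] at n3
      exact n3
    have := integral_halfSign_abs_mul (c := h θ) hii h0 H' (fun p => hη.hasDerivAt_phi θ p)
      (hη.continuous_partialPhi_line θ) (by
        rw [AddCircle.coe_period]; rfl)
    simp_rw [mul_assoc (halfSign _ _ _)]
    rw [intervalIntegral.integral_congr_ae (g := fun p : ℝ => halfSign c₁ c₂ p *
      (|h θ + ∫ r in (0 : ℝ)..p, u.dPhi (θ, (r : S1))| * partialPhi η (θ, (p : S1))))
      (Eventually.of_forall fun p hp => by simp only [r1 p hp]), this]
    congr 1
    exact intervalIntegral.integral_congr_ae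
      (Eventually.of_forall fun p hp => by simp only [r1 p hp])

end WeightedH1

/-! ### The trace on the boundary circle -/

/-- The squared norm of `L²(S²₊, y^a dS)`, with values in `[0, ∞]`. -/
def normSq (a : ℝ) (f : ℝ × S1 → ℝ) : ℝ≥0∞ := ∫⁻ z, ‖f z‖ₑ ^ 2 ∂weightedArea a

lemma normSq_congr {a : ℝ} {f g : ℝ × S1 → ℝ} (h : f =ᵐ[coordMeasure] g) :
    normSq a f = normSq a g := by
  refine lintegral_congr_ae ?_
  filter_upwards [ae_weightedArea_iff.mpr h] with z hz
  rw [hz]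

lemma enorm_sq_eq_ofReal (x : ℝ) : ‖x‖ₑ ^ 2 = ENNReal.ofReal (x ^ 2) := by
  rw [Real.enorm_eq_ofReal_abs, ← ENNReal.ofReal_pow (abs_nonneg _), sq_abs]

lemma normSq_eq_ofReal {a : ℝ} {f : ℝ × S1 → ℝ} (hf : MemLp f 2 (weightedArea a)) :
    normSq a f = ENNReal.ofReal (∫ z, f z ^ 2 ∂weightedArea a) := by
  rw [ofReal_integral_eq_lintegral_ofReal ((memLp_two_iff_integrable_sq hf.1).mp hf)
    (Eventually.of_forall fun z => sq_nonneg _)]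
  simp_rw [normSq, enorm_sq_eq_ofReal]

lemma normSq_lt_top {a : ℝ} {f : ℝ × S1 → ℝ} (hf : MemLp f 2 (weightedArea a)) :
    normSq a f < ∞ := by
  rw [normSq_eq_ofReal hf]; exact ENNReal.ofReal_lt_top

lemma lintegral_weightedArea_symm {a : ℝ} {f : ℝ × S1 → ℝ≥0∞} (hf : Measurable f) :
    ∫⁻ z, f z ∂weightedArea a =
      ∫⁻ x : S1, ∫⁻ θ in Ioo 0 (π / 2), ENNReal.ofReal (wt a θ) * f (θ, x) := by
  rw [weightedArea_eq_prod, lintegral_prod_symm _ hf.aemeasurable]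
  refine lintegral_congr fun x => ?_
  rw [heightMeasure, lintegral_withDensity_eq_lintegral_mul _ (measurable_wt a).ennreal_ofReal
    (by fun_prop)]
  rfl

/-- The Cauchy–Schwarz inequality with an auxiliary weight `p`. -/
lemma enorm_integral_sq_le {α : Type*} [MeasurableSpace α] {μ : Measure α} {f : α → ℝ}
    {p : α → ℝ≥0∞} (hf : AEMeasurable f μ) (hp : AEMeasurable p μ) (h0 : ∀ᵐ t ∂μ, p t ≠ 0)
    (ht : ∀ᵐ t ∂μ, p t ≠ ∞) :
    ‖∫ t, f t ∂μ‖ₑ ^ 2 ≤ (∫⁻ t, p t ∂μ) * ∫⁻ t, ‖f t‖ₑ ^ 2 / p t ∂μ := by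
  have h1 : ‖∫ t, f t ∂μ‖ₑ ≤ ∫⁻ t, ((fun t => p t ^ (1 / 2 : ℝ)) *
      fun t => ‖f t‖ₑ * p t ^ (-(1 / 2) : ℝ)) t ∂μ := by
    refine (enorm_integral_le_lintegral_enorm _).trans_eq (lintegral_congr_ae ?_)
    filter_upwards [h0, ht] with t h0 ht
    simp only [Pi.mul_apply]
    rw [mul_left_comm, ← ENNReal.rpow_add _ _ h0 ht]
    simp
  have h2 := ENNReal.lintegral_mul_le_Lp_mul_Lq μ Real.HolderConjugate.two_two
    (hp.pow_const (1 / 2 : ℝ)) (hf.enorm.mul (hp.pow_const (-(1 / 2) : ℝ)))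
  have h3 := ENNReal.rpow_le_rpow (h1.trans h2) (by norm_num : (0 : ℝ) ≤ 2)
  rw [ENNReal.mul_rpow_of_nonneg _ _ (by norm_num), ← ENNReal.rpow_mul, ← ENNReal.rpow_mul] at h3
  norm_num at h3
  refine h3.trans_eq ?_
  congr 1
  · refine lintegral_congr fun t => ?_
    rw [← ENNReal.rpow_natCast, ← ENNReal.rpow_mul]; norm_num
  · refine lintegral_congr_ae ?_
    filter_upwards [h0, ht] with t h0 ht
    rw [mul_pow, ENNReal.div_eq_inv_mul, mul_comm, ← ENNReal.rpow_natCast (p t ^ _),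
      ← ENNReal.rpow_mul]
    norm_num
    rw [ENNReal.rpow_neg_one]

/-- The function `Φ(θ) = ∫₀^θ dt / ((sin t)^a cos t)`, which controls the oscillation along
meridians. -/
def oscBound (a θ : ℝ) : ℝ≥0∞ := ∫⁻ t in Ioc 0 θ, ENNReal.ofReal (1 / wt a t)

lemma oscBound_mono (a : ℝ) {θ θ' : ℝ} (h : θ ≤ θ') : oscBound a θ ≤ oscBound a θ' :=
  lintegral_mono_set (Ioc_subset_Ioc_right h)

lemma enorm_integral_meridian_sq_le {a θ₀ θ : ℝ} (h0 : 0 ≤ θ₀) (hθ : θ < π / 2) {f : ℝ → ℝ}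
    (hf : Measurable f) :
    ‖∫ t in Ioc θ₀ θ, f t‖ₑ ^ 2 ≤ (∫⁻ t in Ioc θ₀ θ, ENNReal.ofReal (1 / wt a t)) *
      ∫⁻ t in Ioo 0 (π / 2), ENNReal.ofReal (wt a t) * ‖f t‖ₑ ^ 2 := by
  have hm : ∀ᵐ t ∂(volume : Measure ℝ).restrict (Ioc θ₀ θ), t ∈ Ioo 0 (π / 2) := by
    filter_upwards [ae_restrict_mem measurableSet_Ioc] with t ht
    exact ⟨h0.trans_lt ht.1, ht.2.trans_lt hθ⟩
  refine (enorm_integral_sq_le (p := fun t => ENNReal.ofReal (1 / wt a t)) hf.aemeasurable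
    ((measurable_wt a).const_div 1).ennreal_ofReal.aemeasurable ?_ (by simp)).trans ?_
  · filter_upwards [hm] with t ht
    have := wt_pos (a := a) ht
    simpa using this
  · refine mul_le_mul' le_rfl ?_
    have e : ∫⁻ t in Ioc θ₀ θ, ‖f t‖ₑ ^ 2 / ENNReal.ofReal (1 / wt a t) =
        ∫⁻ t in Ioc θ₀ θ, ENNReal.ofReal (wt a t) * ‖f t‖ₑ ^ 2 := by
      refine lintegral_congr_ae ?_
      filter_upwards [hm] with t ht
      have := wt_pos (a := a) ht
      rw [one_div, ENNReal.ofReal_inv_of_pos this, ENNReal.div_eq_inv_mul, inv_inv]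
    rw [e]
    exact lintegral_mono_set fun t ht => ⟨h0.trans_lt ht.1, ht.2.trans_lt hθ⟩

lemma lintegral_thetaPrim_sq_le {a θ : ℝ} (hθ : θ < π / 2) {f : ℝ × S1 → ℝ}
    (hf : Measurable f) :
    ∫⁻ x : S1, ‖thetaPrim f (θ, x)‖ₑ ^ 2 ≤ oscBound a θ * normSq a f := by
  rw [normSq, lintegral_weightedArea_symm (by fun_prop), ← lintegral_const_mul]
  · exact lintegral_mono fun x => enorm_integral_meridian_sq_le le_rfl hθ (by fun_prop)
  · have := measurable_wt a
    exact Measurable.lintegral_prod_right' (f := fun q : S1 × ℝ =>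
      ENNReal.ofReal (wt a q.2) * ‖f (q.2, q.1)‖ₑ ^ 2) (by fun_prop)

lemma oscBound_lt_top {a θ : ℝ} (ha : a < 1) (hθ : θ < π / 2) : oscBound a θ < ∞ := by
  unfold oscBound
  rw [restrict_Ioo_eq_restrict_Ioc.symm]
  exact (integrableOn_one_div_wt ha hθ).lintegral_lt_top

lemma tendsto_oscBound {a : ℝ} (ha : a < 1) : Tendsto (oscBound a) (𝓝[>] 0) (𝓝 0) := by
  have h4 : π / 4 < π / 2 := by linarith [pi_pos]
  have h1 := tendsto_setLIntegral_zero (μ := (volume : Measure ℝ).restrict (Ioc 0 (π / 4)))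
    (f := fun t => ENNReal.ofReal (1 / wt a t)) (oscBound_lt_top ha h4).ne
    (l := 𝓝[>] (0 : ℝ)) (s := fun ε => Ioc 0 ε) ?_
  · refine h1.congr' ?_
    have : Ioo (0 : ℝ) (π / 4) ∈ 𝓝[>] (0 : ℝ) := Ioo_mem_nhdsGT (by positivity)
    filter_upwards [this] with ε hε
    rw [Measure.restrict_restrict measurableSet_Ioc,
      inter_eq_self_of_subset_left (Ioc_subset_Ioc_right hε.2.le)]
    rfl
  · refine tendsto_of_tendsto_of_tendsto_of_le_of_le (h := fun ε : ℝ => ENNReal.ofReal (ε - 0))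
      tendsto_const_nhds ?_ (fun _ => zero_le) (fun ε => ?_)
    · have : Tendsto (fun ε : ℝ => ENNReal.ofReal (ε - 0)) (𝓝 0) (𝓝 (ENNReal.ofReal (0 - 0))) :=
        ENNReal.tendsto_ofReal (tendsto_id.sub_const 0)
      simp only [sub_zero, ENNReal.ofReal_zero] at this ⊢
      exact this.mono_left nhdsWithin_le_nhds
    · exact (Measure.restrict_apply_le _ _).trans_eq Real.volume_Ioc

/-- `∫ Φ dμ < ∞` in the `θ` variable: near the pole `Φ` only has a logarithmic singularity. -/
lemma lintegral_oscBound_lt_top {a : ℝ} (ha : -1 < a) (ha' : a < 1) :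
    ∫⁻ θ in Ioo 0 (π / 2), ENNReal.ofReal (wt a θ) * oscBound a θ < ∞ := by
  have hC : ∫⁻ t in Ioo 0 (π / 2), ENNReal.ofReal (sin t ^ (-a)) < ∞ :=
    (integrableOn_sin_rpow (b := -a) (by linarith)).lintegral_lt_top
  have hD : ∫⁻ t in Ioo 0 (π / 2), ENNReal.ofReal (sin t ^ a) < ∞ :=
    (integrableOn_sin_rpow ha).lintegral_lt_top
  refine lt_of_le_of_lt (b := ∫⁻ θ in Ioo 0 (π / 2), ENNReal.ofReal (sin θ ^ a) *
    ∫⁻ t in Ioo 0 (π / 2), ENNReal.ofReal (sin t ^ (-a))) ?_ ?_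
  · refine setLIntegral_mono' measurableSet_Ioo fun θ hθ => ?_
    unfold oscBound
    rw [← lintegral_const_mul _ ((measurable_wt a).const_div 1).ennreal_ofReal,
      ← lintegral_const_mul _ (measurable_sin.pow_const (-a)).ennreal_ofReal]
    refine (setLIntegral_mono' measurableSet_Ioc fun t ht => ?_).trans
      (lintegral_mono_set fun t ht => ⟨ht.1, ht.2.trans_lt hθ.2⟩)
    have hm : t ∈ Ioo 0 (π / 2) := ⟨ht.1, ht.2.trans_lt hθ.2⟩
    have hs := sin_pos_of_mem hm
    have hc := cos_pos_of_mem hm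
    rw [← ENNReal.ofReal_mul (wt_pos hθ).le,
      ← ENNReal.ofReal_mul (rpow_nonneg (sin_pos_of_mem hθ).le _)]
    refine ENNReal.ofReal_le_ofReal ?_
    have hcc : cos θ ≤ cos t := cos_le_cos_of_nonneg_of_le_pi ht.1.le (by linarith [hθ.2, pi_pos]) ht.2
    have e : wt a θ * (1 / wt a t) = sin θ ^ a * sin t ^ (-a) * (cos θ / cos t) := by
      unfold wt; rw [rpow_neg hs.le]
      have := (rpow_pos_of_pos hs a).ne'
      field_simp
    rw [e]
    refine mul_le_of_le_one_right (mul_nonneg (rpow_nonneg (sin_pos_of_mem hθ).le _)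
      (rpow_nonneg hs.le _)) ?_
    rw [div_le_one hc]; exact hcc
  · rw [lintegral_mul_const _ (measurable_sin.pow_const a).ennreal_ofReal]
    exact ENNReal.mul_lt_top hD hC

lemma setLIntegral_strip (ε : ℝ) (f : ℝ × S1 → ℝ≥0∞) :
    ∫⁻ z in Ioo (0 : ℝ) ε ×ˢ (univ : Set S1), f z = ∫⁻ z, f z ∂collar ε := by
  rw [collar, Measure.volume_eq_prod, ← Measure.prod_restrict, Measure.restrict_univ]

lemma eventually_lt_half_pi : ∀ᶠ ε : ℝ in 𝓝[>] 0, ε ∈ Ioo 0 (π / 2) :=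
  Ioo_mem_nhdsGT (by positivity)

lemma IsTrace.congr {u v : ℝ × S1 → ℝ} {g : S1 → ℝ} (h : u =ᵐ[coordMeasure] v)
    (hu : IsTrace u g) : IsTrace v g := by
  refine ⟨hu.1, hu.2.congr' ?_⟩
  filter_upwards [eventually_lt_half_pi] with ε hε
  rw [setLIntegral_strip, setLIntegral_strip, collar_eq hε.2.le]
  congr 1
  refine lintegral_congr_ae (ae_restrict_of_ae ?_)
  filter_upwards [h] with z hz
  rw [hz]

lemma enorm_add_sq_le (x y : ℝ) : ‖x + y‖ₑ ^ 2 ≤ 2 * ‖x‖ₑ ^ 2 + 2 * ‖y‖ₑ ^ 2 := by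
  simp_rw [enorm_sq_eq_ofReal]
  rw [show (2 : ℝ≥0∞) = ENNReal.ofReal 2 by simp, ← ENNReal.ofReal_mul two_pos.le,
    ← ENNReal.ofReal_mul two_pos.le, ← ENNReal.ofReal_add (by positivity) (by positivity)]
  exact ENNReal.ofReal_le_ofReal (by nlinarith [sq_nonneg (x - y)])

/-- A function of `z` that is dominated, pointwise almost everywhere near the boundary, by the
deviations of two functions from their traces has zero limiting mean. -/
lemma tendsto_strip_of_le {u v w : ℝ × S1 → ℝ} {g h : S1 → ℝ} {C : ℝ≥0∞} (hC : C ≠ ∞)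
    (hu : IsTrace u g) (hv : IsTrace v h) (hum : Measurable u)
    (hle : ∀ᵐ z ∂coordMeasure,
      ‖w z‖ₑ ^ 2 ≤ C * (‖u z - g z.2‖ₑ ^ 2 + ‖v z - h z.2‖ₑ ^ 2)) :
    Tendsto (fun ε : ℝ => (ENNReal.ofReal ε)⁻¹ *
      ∫⁻ z in Ioo (0 : ℝ) ε ×ˢ (univ : Set S1), ‖w z‖ₑ ^ 2) (𝓝[>] 0) (𝓝 0) := by
  have h1 := ENNReal.Tendsto.const_mul (hu.2.add hv.2) (Or.inr hC)
  rw [add_zero, mul_zero] at h1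
  refine tendsto_of_tendsto_of_tendsto_of_le_of_le' tendsto_const_nhds h1
    (Eventually.of_forall fun _ => zero_le) ?_
  filter_upwards [eventually_lt_half_pi] with ε hε
  rw [setLIntegral_strip, setLIntegral_strip, setLIntegral_strip, ← mul_add, mul_left_comm]
  gcongr
  have hgm : AEMeasurable (fun z : ℝ × S1 => g z.2) (collar ε) :=
    hu.1.1.aemeasurable.comp_snd
  have hm : AEMeasurable (fun z => ‖u z - g z.2‖ₑ ^ 2) (collar ε) :=
    (hum.aemeasurable.sub hgm).enorm.pow_const 2
  rw [← lintegral_add_left' hm, ← lintegral_const_mul' _ _ hC]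
  refine lintegral_mono_ae ?_
  rw [collar_eq hε.2.le]
  exact ae_restrict_of_ae hle

/-- The trace is unique. -/
lemma IsTrace.unique {u : ℝ × S1 → ℝ} {g h : S1 → ℝ} (hum : Measurable u)
    (hg : IsTrace u g) (hh : IsTrace u h) : g =ᵐ[volume] h := by
  have h1 := tendsto_strip_of_le (w := fun z => g z.2 - h z.2) (C := 2) (by simp) hg hh hum
    (Eventually.of_forall fun z => by
      have := enorm_add_sq_le (-(u z - g z.2)) (u z - h z.2)
      rw [enorm_neg] at this
      rw [mul_add]
      convert this using 3
      ring)
  have hm : AEMeasurable (fun x => ‖g x - h x‖ₑ ^ 2) :=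
    (hg.1.1.aemeasurable.sub hh.1.1.aemeasurable).enorm.pow_const 2
  have h2 : ∀ᶠ ε : ℝ in 𝓝[>] 0, (ENNReal.ofReal ε)⁻¹ *
      ∫⁻ z in Ioo (0 : ℝ) ε ×ˢ (univ : Set S1), ‖g z.2 - h z.2‖ₑ ^ 2 =
      ∫⁻ x, ‖g x - h x‖ₑ ^ 2 := by
    filter_upwards [self_mem_nhdsWithin] with ε hε
    rw [setLIntegral_strip, collar, lintegral_prod _ hm.comp_snd]
    simp only [lintegral_const, Measure.restrict_apply MeasurableSet.univ, univ_inter,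
      Real.volume_Ioo, sub_zero]
    rw [mul_comm, mul_assoc, ENNReal.mul_inv_cancel (by simpa using hε) (by simp), mul_one]
  have h3 := tendsto_nhds_unique (h1.congr' h2) tendsto_const_nhds
  rw [eq_comm, lintegral_eq_zero_iff' hm] at h3
  filter_upwards [h3] with x hx
  simpa [sub_eq_zero] using hx

lemma isTrace_of_strip {u w : ℝ × S1 → ℝ} {g h : S1 → ℝ} {C : ℝ≥0∞} (hC : C ≠ ∞)
    (hu : IsTrace u g) (hum : Measurable u) (hh : MemLp h 2 (volume : Measure S1))
    (hle : ∀ᵐ z ∂coordMeasure, ‖w z - h z.2‖ₑ ^ 2 ≤ C * ‖u z - g z.2‖ₑ ^ 2) : IsTrace w h := by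
  refine ⟨hh, tendsto_strip_of_le (C := C) hC hu hu hum ?_⟩
  filter_upwards [hle] with z hz
  refine hz.trans ?_
  gcongr
  exact le_self_add

lemma IsTrace.lin {u v : ℝ × S1 → ℝ} {g h : S1 → ℝ} (hum : Measurable u)
    (hu : IsTrace u g) (hv : IsTrace v h) (c d : ℝ) :
    IsTrace (fun z => c * u z + d * v z) (fun x => c * g x + d * h x) := by
  refine ⟨(hu.1.const_mul c).add (hv.1.const_mul d),
    tendsto_strip_of_le (C := 2 * ‖c‖ₑ ^ 2 + 2 * ‖d‖ₑ ^ 2) ?_ hu hv hum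
      (Eventually.of_forall fun z => ?_)⟩
  · finiteness
  · have := enorm_add_sq_le (c * (u z - g z.2)) (d * (v z - h z.2))
    rw [enorm_mul, enorm_mul, mul_pow, mul_pow, ← mul_assoc, ← mul_assoc] at this
    refine (le_of_eq ?_).trans (this.trans ?_)
    · congr 2; ring
    · rw [mul_add]
      gcongr
      · exact le_self_add
      · exact le_add_self

lemma IsTrace.halfSign_abs {u : ℝ × S1 → ℝ} {g : S1 → ℝ} (hum : Measurable u)
    (hu : IsTrace u g) {c₁ c₂ : ℝ} (h₁ : |c₁| ≤ 1) (h₂ : |c₂| ≤ 1) :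
    IsTrace (fun z => halfSign c₁ c₂ z.2 * |u z|) (fun x => halfSign c₁ c₂ x * |g x|) := by
  refine isTrace_of_strip (C := 1) (by simp) hu hum ?_ (Eventually.of_forall fun z => ?_)
  · refine hu.1.abs.mono ((measurable_halfSign c₁ c₂).aestronglyMeasurable.mul hu.1.1.norm)
      (Eventually.of_forall fun x => ?_)
    rw [norm_mul]
    exact mul_le_of_le_one_left (norm_nonneg _) (abs_halfSign_le h₁ h₂ x)
  · rw [one_mul, ← mul_sub, enorm_sq_eq_ofReal, enorm_sq_eq_ofReal]
    refine ENNReal.ofReal_le_ofReal (sq_le_sq.mpr ?_)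
    rw [abs_mul]
    exact (mul_le_of_le_one_left (abs_nonneg _) (abs_halfSign_le h₁ h₂ _)).trans
      (abs_abs_sub_abs_le_abs_sub _ _)

namespace WeightedH1

variable {a : ℝ}

/-- Every element of the weighted Sobolev space has a trace, the initial value of its absolutely
continuous representative along almost every meridian, and the trace is bounded in `L²(S¹)`. -/
lemma exists_isTrace_le (ha : -1 < a) (ha' : a < 1) : ∃ C : ℝ≥0∞, C ≠ ∞ ∧
    ∀ u : WeightedH1 a, u.IsMeasurable → ∃ g : S1 → ℝ, Measurable g ∧
      (u.fn =ᵐ[coordMeasure] fun z => g z.2 + thetaPrim u.dTheta z) ∧ IsTrace u.fn g ∧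
      ∫⁻ x, ‖g x‖ₑ ^ 2 ≤ C * (normSq a u.fn + normSq a u.dTheta) := by
  set M := ∫⁻ θ in Ioo 0 (π / 2), ENNReal.ofReal (wt a θ) with hM
  set K := ∫⁻ θ in Ioo 0 (π / 2), ENNReal.ofReal (wt a θ) * oscBound a θ with hK
  have hK' : K ≠ ∞ := (lintegral_oscBound_lt_top ha ha').ne
  have hMt : M ≠ ∞ := (integrableOn_wt ha).lintegral_lt_top.ne
  have hM0 : M ≠ 0 := by
    rw [hM, Ne, lintegral_eq_zero_iff (measurable_wt a).ennreal_ofReal]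
    intro h
    have h2 : ∀ᵐ θ ∂thetaMeasure, False := by
      filter_upwards [h, ae_thetaMeasure_mem] with θ h1 h2
      have := wt_pos (a := a) h2
      simp only [Pi.zero_apply, ENNReal.ofReal_eq_zero] at h1
      linarith
    have h3 : thetaMeasure univ = 0 := measure_mono_null (fun x _ => not_false) (ae_iff.mp h2)
    rw [Measure.restrict_apply_univ, Real.volume_Ioo, ENNReal.ofReal_eq_zero] at h3
    linarith [pi_pos]
  refine ⟨M⁻¹ * (2 + 2 * K), by finiteness, fun u hu => ?_⟩
  obtain ⟨g, hg, hug⟩ := exists_thetaPrim ha' hu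
  have hFm := measurable_thetaPrim hu.dTheta
  have bound : ∫⁻ x, ‖g x‖ₑ ^ 2 ≤ M⁻¹ * (2 + 2 * K) * (normSq a u.fn + normSq a u.dTheta) := by
    have h1 : M * ∫⁻ x, ‖g x‖ₑ ^ 2 = ∫⁻ z, ‖g z.2‖ₑ ^ 2 ∂weightedArea a := by
      rw [lintegral_weightedArea (by fun_prop)]
      exact (lintegral_mul_const _ (measurable_wt a).ennreal_ofReal).symm
    have h2 : ∫⁻ z, ‖g z.2‖ₑ ^ 2 ∂weightedArea a ≤
        2 * normSq a u.fn + 2 * (K * normSq a u.dTheta) := by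
      calc ∫⁻ z, ‖g z.2‖ₑ ^ 2 ∂weightedArea a
          ≤ ∫⁻ z, (2 * ‖u.fn z‖ₑ ^ 2 + 2 * ‖thetaPrim u.dTheta z‖ₑ ^ 2) ∂weightedArea a := by
            refine lintegral_mono_ae ?_
            filter_upwards [ae_weightedArea_iff.mpr hug] with z hz
            have := enorm_add_sq_le (u.fn z) (-thetaPrim u.dTheta z)
            rw [enorm_neg] at this
            refine le_trans (le_of_eq ?_) this
            rw [hz]; congr 2; ring
        _ = 2 * normSq a u.fn + 2 * ∫⁻ z, ‖thetaPrim u.dTheta z‖ₑ ^ 2 ∂weightedArea a := by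
            have := hu.fn
            rw [lintegral_add_left (by fun_prop), lintegral_const_mul _ (by fun_prop),
              lintegral_const_mul _ (by fun_prop)]
            rfl
        _ ≤ _ := by
            gcongr
            rw [lintegral_weightedArea (by fun_prop), hK, ← lintegral_mul_const]
            · refine setLIntegral_mono' measurableSet_Ioo fun θ hθ => ?_
              rw [mul_assoc]
              gcongr
              exact lintegral_thetaPrim_sq_le hθ.2 hu.dTheta
            · have : Measurable (oscBound a) :=
                Monotone.measurable fun θ θ' h => oscBound_mono a h
              have := measurable_wt a
              fun_prop
    rw [← h1] at h2
    rw [mul_assoc, mul_comm M⁻¹, ← div_eq_mul_inv, ENNReal.le_div_iff_mul_le (Or.inl hM0)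
      (Or.inl hMt), mul_comm _ M]
    refine h2.trans ?_
    rw [add_mul, mul_assoc]
    gcongr
    · exact le_self_add
    · exact le_add_self
  have hgm : MemLp g 2 (volume : Measure S1) := by
    refine ⟨hg.aestronglyMeasurable, ?_⟩
    rw [eLpNorm_lt_top_iff_lintegral_rpow_enorm_lt_top (by simp) (by simp)]
    refine lt_of_eq_of_lt ?_ (bound.trans_lt ?_)
    · refine lintegral_congr fun x => ?_
      norm_num
    · have := normSq_lt_top u.memLp_fn
      have := normSq_lt_top u.memLp_dTheta
      finiteness
  refine ⟨g, hg, hug, ⟨hgm, ?_⟩, bound⟩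
  have hN : normSq a u.dTheta ≠ ∞ := (normSq_lt_top u.memLp_dTheta).ne
  have h1 := ENNReal.Tendsto.mul_const (tendsto_oscBound ha') (Or.inr hN)
  rw [zero_mul] at h1
  refine tendsto_of_tendsto_of_tendsto_of_le_of_le' tendsto_const_nhds h1
    (Eventually.of_forall fun _ => zero_le) ?_
  filter_upwards [eventually_lt_half_pi] with ε hε
  rw [setLIntegral_strip]
  have e : ∫⁻ z, ‖u.fn z - g z.2‖ₑ ^ 2 ∂collar ε =
      ∫⁻ z, ‖thetaPrim u.dTheta z‖ₑ ^ 2 ∂collar ε := by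
    refine lintegral_congr_ae ?_
    rw [collar_eq hε.2.le]
    refine ae_restrict_of_ae ?_
    filter_upwards [hug] with z hz
    rw [hz, add_sub_cancel_left]
  rw [e, collar, lintegral_prod _ (by fun_prop)]
  have h2 : ∫⁻ θ in Ioo 0 ε, ∫⁻ x : S1, ‖thetaPrim u.dTheta (θ, x)‖ₑ ^ 2 ≤
      ∫⁻ θ in Ioo 0 ε, oscBound a ε * normSq a u.dTheta := by
    refine setLIntegral_mono' measurableSet_Ioo fun θ hθ => ?_
    refine (lintegral_thetaPrim_sq_le (a := a) (hθ.2.trans hε.2) hu.dTheta).trans ?_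
    gcongr
    exact oscBound_mono a hθ.2.le
  rw [setLIntegral_const, Real.volume_Ioo, sub_zero] at h2
  calc _ ≤ (ENNReal.ofReal ε)⁻¹ * (oscBound a ε * normSq a u.dTheta * ENNReal.ofReal ε) := by gcongr
    _ = _ := by
      rw [mul_comm, mul_assoc, ENNReal.mul_inv_cancel (by simpa using hε.1) (by simp), mul_one]

lemma VanishesOff.congr {u v : WeightedH1 a} {ω : Set S1} (hu : u.VanishesOff ω)
    (h : u.fn =ᵐ[coordMeasure] v.fn) : v.VanishesOff ω := by
  obtain ⟨g, hg, h0⟩ := hu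
  exact ⟨g, hg.congr h, h0⟩

/-- For a function with vanishing trace off `ω` the trace `g` given by the representation along
meridians vanishes off `ω`. -/
lemma VanishesOff.trace_eq_zero {u : WeightedH1 a} (hu : u.IsMeasurable) {ω : Set S1}
    (h : u.VanishesOff ω) {g : S1 → ℝ} (hg : IsTrace u.fn g) : ∀ᵐ x : S1, x ∉ ω → g x = 0 := by
  obtain ⟨g', hg', h0⟩ := h
  filter_upwards [hg.unique hu.fn hg', h0] with x h1 h2 hx
  rw [h1, h2 hx]

lemma VanishesOff.mono {u : WeightedH1 a} {ω ω' : Set S1} (h : u.VanishesOff ω) (hs : ω ⊆ ω') :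
    u.VanishesOff ω' := by
  obtain ⟨g, hg, h0⟩ := h
  exact ⟨g, hg, h0.mono fun x hx hn => hx fun hm => hn (hs hm)⟩

lemma VanishesOff.lin (ha : a < 1) {u v : WeightedH1 a} {ω : Set S1} (hu : u.VanishesOff ω)
    (hv : v.VanishesOff ω) (c d : ℝ) : (WeightedH1.lin ha c d u v).VanishesOff ω := by
  obtain ⟨u', hu', eu⟩ := u.exists_measurable
  obtain ⟨g, hg, h0⟩ := hu
  obtain ⟨h, hh, h1⟩ := hv
  have := (hg.congr eu.fn).lin hu'.fn hh c d
  refine ⟨_, this.congr ?_, ?_⟩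
  · filter_upwards [eu.fn] with z hz
    change _ = c * u.fn z + d * v.fn z
    rw [hz]
  · filter_upwards [h0, h1] with x h0 h1 hx
    rw [h0 hx, h1 hx]; ring

/-- The condition of a vanishing trace off `ω` is closed in the Sobolev space. -/
lemma vanishesOff_of_tendsto (ha : -1 < a) (ha' : a < 1) {ω : Set S1} (hω : MeasurableSet ω)
    {u : ℕ → WeightedH1 a} {v : WeightedH1 a} (hu : ∀ n, (u n).VanishesOff ω)
    (h1 : Tendsto (fun n => normSq a fun z => (u n).fn z - v.fn z) atTop (𝓝 0))
    (h2 : Tendsto (fun n => normSq a fun z => (u n).dTheta z - v.dTheta z) atTop (𝓝 0)) :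
    v.VanishesOff ω := by
  obtain ⟨C, hC, H⟩ := exists_isTrace_le ha ha'
  obtain ⟨v', hv', ev⟩ := v.exists_measurable
  obtain ⟨g, hgm, -, hg, -⟩ := H v' hv'
  have key : ∀ n, ∫⁻ x in ωᶜ, ‖g x‖ₑ ^ 2 ≤
      C * ((normSq a fun z => (u n).fn z - v.fn z) +
        normSq a fun z => (u n).dTheta z - v.dTheta z) := by
    intro n
    obtain ⟨w, hw, ew⟩ := (WeightedH1.lin ha' 1 (-1) (u n) v).exists_measurable
    obtain ⟨h, hhm, -, hh, hb⟩ := H w hw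
    obtain ⟨u', hu', eu⟩ := (u n).exists_measurable
    have hvan := (hu n).congr eu.fn
    obtain ⟨k, hk, hk0⟩ := hvan
    have hwk : IsTrace w.fn (fun x => 1 * k x + -1 * g x) := by
      refine (hk.lin hu'.fn hg 1 (-1)).congr ?_
      filter_upwards [eu.fn, ev.fn, ew.fn] with z z1 z2 z3
      rw [← z1, ← z2, ← z3]; rfl
    have e1 := hh.unique hw.fn hwk
    have e2 : ∫⁻ x in ωᶜ, ‖g x‖ₑ ^ 2 = ∫⁻ x in ωᶜ, ‖h x‖ₑ ^ 2 := by
      refine lintegral_congr_ae ?_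
      filter_upwards [ae_restrict_of_ae e1, ae_restrict_of_ae hk0,
        ae_restrict_mem hω.compl] with x x1 x2 x3
      rw [x1, x2 x3]; simp
    rw [e2]
    refine (setLIntegral_le_lintegral _ _).trans (hb.trans_eq ?_)
    congr 2
    · refine (normSq_congr ew.fn).symm.trans (congrArg _ (funext fun z => ?_))
      change 1 * _ + -1 * _ = _
      ring
    · refine (normSq_congr ew.dTheta).symm.trans (congrArg _ (funext fun z => ?_))
      change 1 * _ + -1 * _ = _
      ring
  have hlim := ENNReal.Tendsto.const_mul (h1.add h2) (Or.inr hC)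
  rw [add_zero, mul_zero] at hlim
  have h0 : ∫⁻ x in ωᶜ, ‖g x‖ₑ ^ 2 = 0 :=
    le_antisymm (ge_of_tendsto' hlim key) zero_le
  refine ⟨g, hg.congr ev.fn.symm, ?_⟩
  rw [lintegral_eq_zero_iff (by fun_prop), EventuallyEq, ae_restrict_iff' hω.compl] at h0
  filter_upwards [h0] with x hx hxω
  simpa using hx hxω

end WeightedH1

/-! ### The first eigenvalue with vanishing trace -/

section Hardy

variable {s : ℝ}

/-- The derivative of `(sin θ)^{2s}`. -/
def groundDeriv (s θ : ℝ) : ℝ := 2 * s * sin θ ^ (2 * s - 1) * cos θ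

lemma measurable_groundDeriv (s : ℝ) : Measurable (groundDeriv s) := by
  unfold groundDeriv
  exact ((measurable_sin.pow_const _).const_mul _).mul measurable_cos

lemma groundDeriv_pos (hs : 0 < s) {θ : ℝ} (h : θ ∈ Ioo 0 (π / 2)) : 0 < groundDeriv s θ :=
  mul_pos (mul_pos (by positivity) (rpow_pos_of_pos (sin_pos_of_mem h) _)) (cos_pos_of_mem h)

lemma hasDerivAt_sin_rpow (b : ℝ) {θ : ℝ} (h : θ ∈ Ioo 0 (π / 2)) :
    HasDerivAt (fun θ => sin θ ^ b) (b * sin θ ^ (b - 1) * cos θ) θ := by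
  have := (hasDerivAt_sin θ).rpow_const (p := b) (Or.inl (sin_pos_of_mem h).ne')
  exact this.congr_deriv (by ring)

lemma integrableOn_groundDeriv (hs : 0 < s) :
    IntegrableOn (groundDeriv s) (Ioo 0 (π / 2)) := by
  refine ((integrableOn_sin_rpow (b := 2 * s - 1) (by linarith)).const_mul (2 * s)).mono'
    (measurable_groundDeriv s).aestronglyMeasurable ?_
  filter_upwards [ae_thetaMeasure_mem] with θ hθ
  rw [norm_of_nonneg (groundDeriv_pos hs hθ).le]
  exact mul_le_of_le_one_right (mul_nonneg (by positivity)
    (rpow_nonneg (sin_pos_of_mem hθ).le _)) (cos_le_one _)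

lemma integral_groundDeriv (hs : 0 < s) {θ : ℝ} (h : θ ∈ Ioo 0 (π / 2)) :
    ∫ t in (0 : ℝ)..θ, groundDeriv s t = sin θ ^ (2 * s) := by
  have hsub : Ioo 0 θ ⊆ Ioo 0 (π / 2) := Ioo_subset_Ioo_right h.2.le
  rw [intervalIntegral.integral_eq_sub_of_hasDerivAt_of_le h.1.le
    (f := fun θ => sin θ ^ (2 * s))]
  · rw [sin_zero, zero_rpow (by positivity), sub_zero]
  · exact (continuous_sin.rpow_const fun _ => Or.inr (by positivity)).continuousOn
  · intro t ht
    exact hasDerivAt_sin_rpow _ (hsub ht)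
  · rw [intervalIntegrable_iff_integrableOn_Ioo_of_le h.1.le]
    exact (integrableOn_groundDeriv hs).mono_set hsub

lemma lintegral_groundDeriv (hs : 0 < s) {θ : ℝ} (h : θ ∈ Ioo 0 (π / 2)) :
    ∫⁻ t in Ioc 0 θ, ENNReal.ofReal (groundDeriv s t) = ENNReal.ofReal (sin θ ^ (2 * s)) := by
  have hsub : Ioo 0 θ ⊆ Ioo 0 (π / 2) := Ioo_subset_Ioo_right h.2.le
  rw [← integral_groundDeriv hs h, intervalIntegral.integral_of_le h.1.le,
    integral_Ioc_eq_integral_Ioo, restrict_Ioo_eq_restrict_Ioc.symm,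
    ofReal_integral_eq_lintegral_ofReal ((integrableOn_groundDeriv hs).mono_set hsub)]
  filter_upwards [ae_restrict_mem measurableSet_Ioo] with t ht
  exact (groundDeriv_pos hs (hsub ht)).le

lemma lintegral_sin_mul_cos {t : ℝ} (h : t ∈ Ioo 0 (π / 2)) :
    ∫⁻ θ in Ico t (π / 2), ENNReal.ofReal (sin θ * cos θ) = ENNReal.ofReal (cos t ^ 2 / 2) := by
  have e : ∫ θ in t..π / 2, sin θ * cos θ = cos t ^ 2 / 2 := by
    rw [integral_sin_mul_cos₁]
    rw [sin_pi_div_two, sin_sq]; ring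
  rw [← e, intervalIntegral.integral_of_le h.2.le, integral_Ioc_eq_integral_Ioo,
    restrict_Ioo_eq_restrict_Ico.symm, ofReal_integral_eq_lintegral_ofReal]
  · exact ((continuous_sin.mul continuous_cos).integrableOn_Icc (a := t) (b := π / 2)).mono_set
      Ioo_subset_Icc_self
  · filter_upwards [ae_restrict_mem measurableSet_Ioo] with θ hθ
    have hm : θ ∈ Ioo 0 (π / 2) := ⟨h.1.trans hθ.1, hθ.2⟩
    exact mul_nonneg (sin_pos_of_mem hm).le (cos_pos_of_mem hm).le

/-- The one-dimensional Hardy inequality with the sharp constant `4s`. The Cauchy–Schwarz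
inequality is applied with the derivative of the ground state `(sin θ)^{2s}` as a weight. -/
lemma hardy_meridian (hs : 0 < s) {f : ℝ → ℝ} (hf : Measurable f) :
    ENNReal.ofReal (4 * s) * ∫⁻ θ in Ioo 0 (π / 2),
        ENNReal.ofReal (wt (1 - 2 * s) θ) * ‖∫ t in Ioc 0 θ, f t‖ₑ ^ 2 ≤
      ∫⁻ t in Ioo 0 (π / 2), ENNReal.ofReal (wt (1 - 2 * s) t) * ‖f t‖ₑ ^ 2 := by
  have hgm := measurable_groundDeriv s
  set k : ℝ → ℝ≥0∞ := fun t => ‖f t‖ₑ ^ 2 / ENNReal.ofReal (groundDeriv s t) with hk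
  have hkm : Measurable k := by fun_prop
  have h1 : ∫⁻ θ in Ioo 0 (π / 2),
        ENNReal.ofReal (wt (1 - 2 * s) θ) * ‖∫ t in Ioc 0 θ, f t‖ₑ ^ 2 ≤
      ∫⁻ θ in Ioo 0 (π / 2), ∫⁻ t in Ioo 0 (π / 2),
        (if t ≤ θ then ENNReal.ofReal (sin θ * cos θ) else 0) * k t := by
    refine setLIntegral_mono' measurableSet_Ioo fun θ hθ => ?_
    have hm : ∀ᵐ t ∂(volume : Measure ℝ).restrict (Ioc 0 θ), t ∈ Ioo 0 (π / 2) := by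
      filter_upwards [ae_restrict_mem measurableSet_Ioc] with t ht
      exact ⟨ht.1, ht.2.trans_lt hθ.2⟩
    have h2 := enorm_integral_sq_le (f := f) (p := fun t => ENNReal.ofReal (groundDeriv s t))
      hf.aemeasurable (μ := (volume : Measure ℝ).restrict (Ioc 0 θ))
      hgm.ennreal_ofReal.aemeasurable
      (by filter_upwards [hm] with t ht; simpa using groundDeriv_pos hs ht) (by simp)
    rw [lintegral_groundDeriv hs hθ] at h2
    refine (mul_le_mul' le_rfl h2).trans ?_
    rw [← mul_assoc, ← ENNReal.ofReal_mul (wt_pos hθ).le]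
    have e1 : wt (1 - 2 * s) θ * sin θ ^ (2 * s) = sin θ * cos θ := by
      unfold wt
      rw [mul_right_comm, ← rpow_add (sin_pos_of_mem hθ)]
      norm_num
    rw [e1, ← lintegral_const_mul _ hkm, ← lintegral_indicator measurableSet_Ioc,
      ← lintegral_indicator measurableSet_Ioo]
    refine lintegral_mono fun t => ?_
    by_cases ht : t ∈ Ioc 0 θ
    · have ht' : t ∈ Ioo 0 (π / 2) := ⟨ht.1, ht.2.trans_lt hθ.2⟩
      simp [ht, ht', ht.2]
    · simp [ht]
  have h2 : ∫⁻ θ in Ioo 0 (π / 2), ∫⁻ t in Ioo 0 (π / 2),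
        (if t ≤ θ then ENNReal.ofReal (sin θ * cos θ) else 0) * k t =
      ∫⁻ t in Ioo 0 (π / 2), ENNReal.ofReal (cos t ^ 2 / 2) * k t := by
    rw [lintegral_lintegral_swap]
    · refine setLIntegral_congr_fun measurableSet_Ioo fun t ht => ?_
      rw [lintegral_mul_const]
      · congr 1
        rw [← lintegral_sin_mul_cos ht, ← lintegral_indicator measurableSet_Ioo,
          ← lintegral_indicator measurableSet_Ico]
        refine lintegral_congr fun θ => ?_
        by_cases hθ : t ≤ θ
        · by_cases hθ' : θ < π / 2
          · simp [hθ, hθ', ht.1.trans_le hθ]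
          · simp [hθ']
        · simp [hθ]
      · exact Measurable.ite measurableSet_Ici (by fun_prop) measurable_const
    · refine Measurable.aemeasurable (Measurable.mul ?_ (by fun_prop))
      exact Measurable.ite (measurableSet_le measurable_snd measurable_fst) (by fun_prop)
        measurable_const
  rw [h2] at h1
  refine (mul_le_mul' le_rfl h1).trans (le_of_eq ?_)
  rw [← lintegral_const_mul _ (by fun_prop)]
  refine setLIntegral_congr_fun measurableSet_Ioo fun t ht => ?_
  have hp := groundDeriv_pos hs ht
  have hsn := sin_pos_of_mem ht
  have hc := cos_pos_of_mem ht
  simp only [hk]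
  rw [ENNReal.div_eq_inv_mul, ← ENNReal.ofReal_inv_of_pos hp, ← mul_assoc, ← mul_assoc,
    ← ENNReal.ofReal_mul (by positivity), ← ENNReal.ofReal_mul (by positivity)]
  congr 2
  unfold groundDeriv wt
  rw [rpow_sub hsn, rpow_sub hsn, rpow_one]
  have := (rpow_pos_of_pos hsn (2 * s)).ne'
  field_simp
  ring

end Hardy

namespace WeightedH1

variable {s : ℝ}

/-- Functions with zero trace satisfy the Poincaré inequality with the constant `4s`. -/
lemma four_mul_normSq_le (hs0 : 0 < s) (hs1 : s < 1) {u : WeightedH1 (1 - 2 * s)}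
    (h : u.VanishesOff ∅) :
    ENNReal.ofReal (4 * s) * normSq (1 - 2 * s) u.fn ≤ normSq (1 - 2 * s) u.dTheta := by
  obtain ⟨v, hv, ev⟩ := u.exists_measurable
  rw [normSq_congr ev.fn, normSq_congr ev.dTheta]
  obtain ⟨C, hC, H⟩ := exists_isTrace_le (a := 1 - 2 * s) (by linarith) (by linarith)
  obtain ⟨g, hg, hvg, htr, -⟩ := H v hv
  have h0 := (h.congr ev.fn).trace_eq_zero hv htr
  have e : v.fn =ᵐ[coordMeasure] thetaPrim v.dTheta := by
    have h0' : ∀ᵐ z ∂coordMeasure, g z.2 = 0 :=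
      Measure.quasiMeasurePreserving_snd.ae (h0.mono fun x hx => hx (notMem_empty _))
    filter_upwards [hvg, h0'] with z h1 h2
    rw [h1, h2, zero_add]
  have m1 := measurable_thetaPrim hv.dTheta
  have m2 := hv.dTheta
  have m3 := measurable_wt (1 - 2 * s)
  rw [normSq_congr e, normSq, normSq, lintegral_weightedArea_symm (by fun_prop),
    lintegral_weightedArea_symm (by fun_prop), ← lintegral_const_mul]
  · exact lintegral_mono fun x => hardy_meridian hs0 (f := fun t => v.dTheta (t, x)) (by fun_prop)
  · exact Measurable.lintegral_prod_right' (f := fun q : S1 × ℝ =>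
      ENNReal.ofReal (wt (1 - 2 * s) q.2) * ‖thetaPrim v.dTheta (q.2, q.1)‖ₑ ^ 2) (by fun_prop)

lemma integrable_comp_fst {a : ℝ} {F : ℝ → ℝ}
    (h : IntegrableOn (fun θ => wt a θ * F θ) (Ioo 0 (π / 2))) :
    Integrable (fun z : ℝ × S1 => F z.1) (weightedArea a) := by
  rw [weightedArea_eq_prod]
  have : Integrable F (heightMeasure a) := by
    rw [heightMeasure, integrable_withDensity_iff_integrable_smul'
      (measurable_wt a).ennreal_ofReal (by simp)]
    refine IntegrableOn.congr_fun h (fun θ hθ => ?_) measurableSet_Ioo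
    rw [ENNReal.toReal_ofReal (wt_pos hθ).le, smul_eq_mul]
  exact this.comp_fst _

lemma integral_comp_fst {a : ℝ} {F : ℝ → ℝ} :
    ∫ z, F z.1 ∂weightedArea a = 2 * π * ∫ θ in Ioo 0 (π / 2), wt a θ * F θ := by
  have e : ∫ θ, F θ ∂heightMeasure a = ∫ θ in Ioo 0 (π / 2), wt a θ * F θ := by
    rw [heightMeasure, integral_withDensity_eq_integral_toReal_smul
      (measurable_wt a).ennreal_ofReal (by simp)]
    refine setIntegral_congr_fun measurableSet_Ioo fun θ hθ => ?_
    rw [ENNReal.toReal_ofReal (wt_pos hθ).le, smul_eq_mul]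
  have := integral_prod_mul (μ := heightMeasure a) (ν := (volume : Measure S1)) F fun _ => (1 : ℝ)
  rw [← weightedArea_eq_prod, e] at this
  simp only [mul_one, integral_const, smul_eq_mul, Measure.real, AddCircle.measure_univ,
    ENNReal.toReal_ofReal Real.two_pi_pos.le] at this
  rw [this, mul_comm]

lemma wt_mul_groundDeriv_sq {θ : ℝ} (hθ : θ ∈ Ioo 0 (π / 2)) :
    wt (1 - 2 * s) θ * groundDeriv s θ ^ 2 = 2 * s * (groundDeriv s θ * cos θ ^ 2) := by
  have hsn := sin_pos_of_mem hθ
  unfold groundDeriv wt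
  have e : sin θ ^ (1 - 2 * s) * sin θ ^ (2 * s - 1) = 1 := by
    rw [← rpow_add hsn]; norm_num
  calc _ = (sin θ ^ (1 - 2 * s) * sin θ ^ (2 * s - 1)) * (4 * s ^ 2 * sin θ ^ (2 * s - 1)
        * cos θ ^ 3) := by ring
    _ = _ := by rw [e]; ring

lemma wt_mul_sin_rpow {θ : ℝ} (hθ : θ ∈ Ioo 0 (π / 2)) :
    wt (1 - 2 * s) θ * (sin θ ^ (2 * s) * sin θ ^ (2 * s)) =
      sin θ * cos θ * sin θ ^ (2 * s) := by
  have e : sin θ ^ (1 - 2 * s) * sin θ ^ (2 * s) = sin θ := by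
    rw [← rpow_add (sin_pos_of_mem hθ)]; norm_num
  unfold wt
  calc _ = (sin θ ^ (1 - 2 * s) * sin θ ^ (2 * s)) * (cos θ * sin θ ^ (2 * s)) := by ring
    _ = _ := by rw [e]; ring

lemma integrableOn_groundDeriv_mul_cos (hs : 0 < s) :
    IntegrableOn (fun θ => groundDeriv s θ * cos θ ^ 2) (Ioo 0 (π / 2)) :=
  Integrable.mul_bdd (c := 1) (integrableOn_groundDeriv hs) (by fun_prop)
    (Eventually.of_forall fun θ => by
      rw [norm_pow]; exact pow_le_one₀ (norm_nonneg _) (abs_cos_le_one θ))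

/-- The function `y^{2s} = (sin θ)^{2s}`, the restriction to the sphere of a homogeneous solution
of degree `2s`. -/
lemma exists_groundState (hs0 : 0 < s) (hs1 : s < 1) : ∃ u : WeightedH1 (1 - 2 * s),
    u.fn = (fun z => sin z.1 ^ (2 * s)) ∧ u.dTheta = (fun z => groundDeriv s z.1) ∧
      u.dPhi = 0 := by
  have m1 : MemLp (fun z : ℝ × S1 => groundDeriv s z.1) 2 (weightedArea (1 - 2 * s)) := by
    have hm := measurable_groundDeriv s
    rw [memLp_two_iff_integrable_sq (by exact Measurable.aestronglyMeasurable (by fun_prop))]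
    refine integrable_comp_fst (F := fun θ => groundDeriv s θ ^ 2) ?_
    refine IntegrableOn.congr_fun ((integrableOn_groundDeriv_mul_cos hs0).const_mul (2 * s))
      (fun θ hθ => ?_) measurableSet_Ioo
    exact (wt_mul_groundDeriv_sq hθ).symm
  have hcont : Continuous fun z : ℝ × S1 => sin z.1 ^ (2 * s) :=
    (continuous_sin.comp continuous_fst).rpow_const fun _ => Or.inr (by positivity)
  have m0 : MemLp (fun z : ℝ × S1 => sin z.1 ^ (2 * s)) 2 (weightedArea (1 - 2 * s)) := by
    have := isFiniteMeasure_weightedArea (a := 1 - 2 * s) (by linarith)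
    refine MemLp.of_bound hcont.aestronglyMeasurable 1 ?_
    filter_upwards [ae_weightedArea_iff.mpr ae_coordMeasure_mem] with z hz
    rw [norm_of_nonneg (rpow_nonneg (sin_pos_of_mem hz).le _)]
    exact rpow_le_one (sin_pos_of_mem hz).le (sin_le_one _) (by positivity)
  have ha : 1 - 2 * s < 1 := by linarith
  have C0 := collarIntegrable_of_memLp ha m0
  have C1 := collarIntegrable_of_memLp ha m1
  refine ⟨⟨_, _, 0, m0, m1, by simp, fun η hη => ?_, fun η hη => ?_⟩, rfl, rfl, rfl⟩
  · rw [← integral_thetaPrim_mul (f := fun z => groundDeriv s z.1) hη ((measurable_groundDeriv s).comp measurable_fst) C1]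
    refine integral_mul_congr ?_
    filter_upwards [ae_coordMeasure_mem] with z hz
    obtain ⟨θ, x⟩ := z
    rw [thetaPrim_eq (le_of_lt hz.1)]
    exact (integral_groundDeriv hs0 hz).symm
  · rw [hη.partialPhi_isTest.integral_mul_eq_parallels C0]
    simp only [Pi.zero_apply, zero_mul, integral_zero, neg_zero]
    refine integral_eq_zero_of_ae (Eventually.of_forall fun θ => ?_)
    simp only [intervalIntegral.integral_const_mul, Pi.zero_apply]
    rw [intervalIntegral.integral_eq_sub_of_hasDerivAt (fun p _ => hη.hasDerivAt_phi θ p)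
      ((hη.continuous_partialPhi_line θ).intervalIntegrable _ _), AddCircle.coe_period]
    simp

lemma integral_groundState (hs0 : 0 < s) :
    ∫ z, groundDeriv s z.1 * groundDeriv s z.1 ∂weightedArea (1 - 2 * s) =
      4 * s * ∫ z, sin z.1 ^ (2 * s) * sin z.1 ^ (2 * s) ∂weightedArea (1 - 2 * s) := by
  rw [integral_comp_fst (F := fun θ => groundDeriv s θ * groundDeriv s θ),
    integral_comp_fst (F := fun θ => sin θ ^ (2 * s) * sin θ ^ (2 * s)),
    setIntegral_congr_fun (g := fun θ => 2 * s * (groundDeriv s θ * cos θ ^ 2))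
      measurableSet_Ioo fun θ hθ => by
        simpa only [sq (groundDeriv s θ)] using wt_mul_groundDeriv_sq (s := s) hθ,
    setIntegral_congr_fun measurableSet_Ioo fun θ hθ => wt_mul_sin_rpow hθ, integral_const_mul]
  have hπ : (0 : ℝ) < π / 2 := by positivity
  -- the derivative of `(sin θ)^{2s} (cos θ)^2` has integral zero
  have hc : Continuous fun θ => sin θ ^ (2 * s) :=
    continuous_sin.rpow_const fun _ => Or.inr (by positivity)
  have i1 : IntervalIntegrable (fun θ => groundDeriv s θ * cos θ ^ 2) volume 0 (π / 2) := by
    rw [intervalIntegrable_iff_integrableOn_Ioo_of_le hπ.le]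
    exact integrableOn_groundDeriv_mul_cos hs0
  have i2 : IntervalIntegrable (fun θ => 2 * (sin θ * cos θ * sin θ ^ (2 * s))) volume 0 (π / 2) :=
    Continuous.intervalIntegrable (by fun_prop) _ _
  have h := intervalIntegral.integral_eq_sub_of_hasDerivAt_of_le hπ.le
    (f := fun θ => sin θ ^ (2 * s) * cos θ ^ 2)
    (f' := fun θ => groundDeriv s θ * cos θ ^ 2 - 2 * (sin θ * cos θ * sin θ ^ (2 * s)))
    (by fun_prop) (fun θ hθ => by
      refine ((hasDerivAt_sin_rpow (2 * s) hθ).mul ((hasDerivAt_cos θ).pow 2)).congr_deriv ?_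
      simp only [groundDeriv, Pi.pow_apply]
      push_cast
      ring) (i1.sub i2)
  rw [intervalIntegral.integral_sub i1 i2, intervalIntegral.integral_const_mul, cos_pi_div_two,
    sin_zero, zero_rpow (by positivity), intervalIntegral.integral_of_le hπ.le,
    intervalIntegral.integral_of_le hπ.le, integral_Ioc_eq_integral_Ioo,
    integral_Ioc_eq_integral_Ioo] at h
  linear_combination 2 * π * (2 * s) * h

end WeightedH1

/-! ### Poincaré inequality on short arcs -/

/-- On an interval of length `β - α`, the square of a primitive of `f` is controlled by its integral
and by `f`: it differs from its mean by at most `∫ |f|`. -/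
lemma lintegral_sq_arc_le {α β c : ℝ} (h0 : 0 ≤ α) (hαβ : α < β) {f v : ℝ → ℝ}
    (hf : IntegrableOn f (Ioc 0 β))
    (hv : ∀ᵐ p ∂(volume : Measure ℝ).restrict (Ioc α β), v p = c + ∫ r in Ioc 0 p, f r) :
    ∫⁻ p in Ioc α β, ‖v p‖ₑ ^ 2 ≤
      ENNReal.ofReal (2 / (β - α)) * ‖∫ p in Ioc α β, v p‖ₑ ^ 2 +
        ENNReal.ofReal (2 * (β - α) ^ 2) * ∫⁻ p in Ioc α β, ‖f p‖ₑ ^ 2 := by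
  have hL : 0 < β - α := sub_pos.mpr hαβ
  set V : ℝ → ℝ := fun p => c + ∫ r in Ioc 0 p, f r with hV
  set I := ∫ r in Ioc α β, ‖f r‖ with hI
  have hfJ : IntegrableOn f (Ioc α β) := hf.mono_set (Ioc_subset_Ioc_left h0)
  have hVc : ContinuousOn V (Icc 0 β) := by
    refine continuousOn_const.add ?_
    exact intervalIntegral.continuousOn_primitive ((integrableOn_Icc_iff_integrableOn_Ioc (by simp)).mpr hf)
  have hVi : IntegrableOn V (Ioc α β) :=
    ((hVc.mono (Icc_subset_Icc_left h0)).integrableOn_Icc).mono_set Ioc_subset_Icc_self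
  have key : ∀ p q, p ∈ Ioc α β → q ∈ Ioc α β → p ≤ q → |V p - V q| ≤ I := by
    intro p q hp hq hpq
    have hp0 : 0 ≤ p := h0.trans hp.1.le
    have e : V q - V p = ∫ r in Ioc p q, f r := by
      have i1 : IntervalIntegrable f volume 0 p :=
        (intervalIntegrable_iff_integrableOn_Ioc_of_le hp0).mpr
          (hf.mono_set (Ioc_subset_Ioc_right hp.2))
      have i2 : IntervalIntegrable f volume 0 q :=
        (intervalIntegrable_iff_integrableOn_Ioc_of_le (hp0.trans hpq)).mpr
          (hf.mono_set (Ioc_subset_Ioc_right hq.2))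
      have := intervalIntegral.integral_interval_sub_left i2 i1
      rw [intervalIntegral.integral_of_le hp0, intervalIntegral.integral_of_le hpq,
        intervalIntegral.integral_of_le (hp0.trans hpq)] at this
      simp only [hV]; linarith
    rw [abs_sub_comm, e]
    rw [← Real.norm_eq_abs]
    refine (norm_integral_le_integral_norm _).trans ?_
    exact setIntegral_mono_set hfJ.norm (Eventually.of_forall fun _ => norm_nonneg _)
      (Ioc_subset_Ioc hp.1.le hq.2).eventuallyLE
  have key' : ∀ p ∈ Ioc α β, ∀ q ∈ Ioc α β, ‖V p - V q‖ ≤ I := by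
    intro p hp q hq
    rcases le_total p q with h | h
    · exact key p q hp hq h
    · rw [norm_sub_rev]; exact key q p hq hp h
  have hvol : (volume : Measure ℝ).real (Ioc α β) = β - α := by
    rw [Real.volume_real_Ioc_of_le hαβ.le]
  have key2 : ∀ p ∈ Ioc α β, |V p - (∫ q in Ioc α β, V q) / (β - α)| ≤ I := by
    intro p hp
    have h1 := norm_setIntegral_le_of_norm_le_const (μ := volume) (s := Ioc α β)
      (f := fun q => V p - V q) (C := I) (by simp) (key' p hp)
    rw [integral_sub (integrable_const _) hVi, setIntegral_const, hvol, smul_eq_mul] at h1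
    have h2 : V p - (∫ q in Ioc α β, V q) / (β - α) =
        ((β - α) * V p - ∫ q in Ioc α β, V q) / (β - α) := by field_simp
    rw [h2, abs_div, abs_of_pos hL, div_le_iff₀ hL]
    exact h1
  have hvV : ∫ p in Ioc α β, v p = ∫ p in Ioc α β, V p := integral_congr_ae hv
  rw [hvV]
  set m := ∫ q in Ioc α β, V q
  have hI2 : ‖I‖ₑ ^ 2 ≤ ENNReal.ofReal (β - α) * ∫⁻ p in Ioc α β, ‖f p‖ₑ ^ 2 := by
    have := enorm_integral_sq_le (μ := (volume : Measure ℝ).restrict (Ioc α β))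
      (f := fun r => ‖f r‖) (p := fun _ => 1) hfJ.norm.aemeasurable aemeasurable_const
      (by simp) (by simp)
    rw [hI]
    simpa only [enorm_norm, div_one, lintegral_const, one_mul, Measure.restrict_apply_univ,
      Real.volume_Ioc] using this
  calc ∫⁻ p in Ioc α β, ‖v p‖ₑ ^ 2
      ≤ ∫⁻ p in Ioc α β, (2 * ‖m / (β - α)‖ₑ ^ 2 + 2 * ‖I‖ₑ ^ 2) := by
        refine lintegral_mono_ae ?_
        filter_upwards [hv, ae_restrict_mem measurableSet_Ioc] with p h1 hp
        have h2 := enorm_add_sq_le (m / (β - α)) (V p - m / (β - α))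
        rw [h1]
        change ‖V p‖ₑ ^ 2 ≤ _
        rw [add_sub_cancel] at h2
        refine h2.trans ?_
        gcongr 2 * ‖m / (β - α)‖ₑ ^ 2 + 2 * ?_ ^ 2
        rw [Real.enorm_eq_ofReal_abs, Real.enorm_eq_ofReal_abs]
        exact ENNReal.ofReal_le_ofReal ((key2 p hp).trans (le_abs_self _))
    _ = ENNReal.ofReal (2 / (β - α)) * ‖m‖ₑ ^ 2 + ENNReal.ofReal (β - α) * (2 * ‖I‖ₑ ^ 2) := by
        rw [lintegral_const, Measure.restrict_apply_univ, Real.volume_Ioc, add_mul,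
          mul_comm (2 * ‖I‖ₑ ^ 2)]
        congr 1
        simp_rw [enorm_sq_eq_ofReal]
        rw [show (2 : ℝ≥0∞) = ENNReal.ofReal 2 by simp, ← ENNReal.ofReal_mul two_pos.le,
          ← ENNReal.ofReal_mul (by positivity), ← ENNReal.ofReal_mul (by positivity)]
        congr 1
        field_simp
    _ ≤ _ := by
        refine add_le_add le_rfl ?_
        calc ENNReal.ofReal (β - α) * (2 * ‖I‖ₑ ^ 2)
            ≤ ENNReal.ofReal (β - α) * (2 * (ENNReal.ofReal (β - α) *
              ∫⁻ p in Ioc α β, ‖f p‖ₑ ^ 2)) := by gcongr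
          _ = _ := by
            rw [pow_two (β - α), ENNReal.ofReal_mul two_pos.le, ENNReal.ofReal_mul hL.le]
            simp only [ENNReal.ofReal_ofNat]
            ring

/-- The `j`-th of the `N` arcs of equal length into which the circle is divided. -/
def arcPiece (N j : ℕ) : Set S1 := {x | ang x ∈ Ioc (2 * π / N * j) (2 * π / N * (j + 1))}

lemma measurableSet_arcPiece (N j : ℕ) : MeasurableSet (arcPiece N j) :=
  measurable_ang measurableSet_Ioc

lemma measurePreserving_arcPiece {N j : ℕ} (h : j < N) :
    MeasurePreserving (fun p : ℝ => (p : S1))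
      (volume.restrict (Ioc (2 * π / N * j) (2 * π / N * (j + 1))))
      ((volume : Measure S1).restrict (arcPiece N j)) := by
  have h1 := (AddCircle.measurePreserving_mk (2 * π) 0).restrict_preimage
    (measurableSet_arcPiece N j)
  rw [zero_add, Measure.restrict_restrict
    ((AddCircle.measurePreserving_mk (2 * π) 0).measurable (measurableSet_arcPiece N j))] at h1
  have hN : (0 : ℝ) < N := by exact_mod_cast (Nat.zero_le _).trans_lt h
  have hj : (j : ℝ) + 1 ≤ N := by exact_mod_cast h
  have h2 : 2 * π / N * (j + 1) ≤ 2 * π := by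
    rw [div_mul_eq_mul_div, div_le_iff₀ hN]
    exact mul_le_mul_of_nonneg_left hj two_pi_pos.le
  have h3 : 0 ≤ 2 * π / N * j := by positivity
  have e : Ioc (2 * π / N * j) (2 * π / N * (j + 1)) =
      (fun p : ℝ => (p : S1)) ⁻¹' arcPiece N j ∩ Ioc 0 (2 * π) := by
    refine Set.ext fun p => ?_
    simp only [mem_inter_iff, mem_preimage, arcPiece, mem_ofPred_eq]
    constructor
    · intro hp
      have hp' : p ∈ Ioc 0 (2 * π) := ⟨h3.trans_lt hp.1, hp.2.trans h2⟩
      exact ⟨by rw [ang_coe hp']; exact hp, hp'⟩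
    · rintro ⟨hp, hp'⟩
      rwa [ang_coe hp'] at hp
  rw [e]
  exact h1

lemma iUnion_arcPiece {N : ℕ} (hN : 0 < N) : ⋃ j ∈ Finset.range N, arcPiece N j = univ := by
  have hc : (0 : ℝ) < 2 * π / N := by
    have : (0 : ℝ) < N := by exact_mod_cast hN
    positivity
  refine eq_univ_of_forall fun x => ?_
  obtain ⟨h1, h2⟩ := ang_mem x
  obtain ⟨n, hn⟩ := Nat.exists_eq_succ_of_ne_zero (n := ⌈ang x / (2 * π / N)⌉₊)
    (by rw [Ne, Nat.ceil_eq_zero, not_le]; positivity)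
  have hn1 : ang x / (2 * π / N) ≤ n + 1 := by
    have := Nat.le_ceil (ang x / (2 * π / N)); rw [hn] at this; exact_mod_cast this
  have hn2 : (n : ℝ) < ang x / (2 * π / N) := by
    rw [← Nat.lt_ceil, hn]; exact Nat.lt_succ_self n
  have hnN : n < N := by
    have : ang x / (2 * π / N) ≤ N := by
      rw [div_le_iff₀ hc, mul_div_cancel₀]
      · exact h2
      · exact_mod_cast hN.ne'
    exact_mod_cast hn2.trans_le this
  simp only [mem_iUnion, Finset.mem_range]
  refine ⟨n, hnN, ?_, ?_⟩
  · rw [lt_div_iff₀ hc] at hn2; linarith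
  · rw [div_le_iff₀ hc] at hn1; linarith

lemma disjoint_arcPiece {N i j : ℕ} (hN : 0 < N) (hij : i ≠ j) :
    Disjoint (arcPiece N i) (arcPiece N j) := by
  have hc : (0 : ℝ) < 2 * π / N := by
    have : (0 : ℝ) < N := by exact_mod_cast hN
    positivity
  rw [Set.disjoint_left]
  rintro x ⟨h1, h2⟩ ⟨h3, h4⟩
  have a1 : (i : ℝ) < j + 1 := lt_of_mul_lt_mul_left (h1.trans_le h4) hc.le
  have a2 : (j : ℝ) < i + 1 := lt_of_mul_lt_mul_left (h3.trans_le h2) hc.le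
  have a1' : i < j + 1 := by exact_mod_cast a1
  have a2' : j < i + 1 := by exact_mod_cast a2
  omega

lemma lintegral_eq_sum_arcPiece {N : ℕ} (hN : 0 < N) (F : S1 → ℝ≥0∞) :
    ∫⁻ x, F x = ∑ j ∈ Finset.range N, ∫⁻ x in arcPiece N j, F x := by
  rw [← lintegral_biUnion_finset (fun i _ j _ hij => disjoint_arcPiece hN hij)
    (fun j _ => measurableSet_arcPiece N j), iUnion_arcPiece hN, setLIntegral_univ]

/-- On almost every parallel, `u` is controlled in `L²` by its integrals over `N` arcs and, with a
factor of order `N⁻²`, by `∂_φ u`. -/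
lemma WeightedH1.lintegral_sq_slice_le {a : ℝ} (ha : a < 1) {u : WeightedH1 a}
    (hu : u.IsMeasurable) {N : ℕ} (hN : 0 < N) :
    ∀ᵐ θ ∂thetaMeasure, ∫⁻ x, ‖u.fn (θ, x)‖ₑ ^ 2 ≤
      ENNReal.ofReal (N / π) * (∑ j ∈ Finset.range N, ‖∫ x in arcPiece N j, u.fn (θ, x)‖ₑ ^ 2) +
        ENNReal.ofReal (2 * (2 * π / N) ^ 2) * ∫⁻ x, ‖u.dPhi (θ, x)‖ₑ ^ 2 := by
  obtain ⟨h, -, hh⟩ := exists_phiPrim ha hu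
  have c2 := collarIntegrable_of_memLp ha u.memLp_dPhi'
  have hN' : (0 : ℝ) < N := by exact_mod_cast hN
  have hc : (0 : ℝ) < 2 * π / N := by positivity
  filter_upwards [Measure.ae_ae_of_ae_prod hh, c2.slice_integrable] with θ h1 h2
  rw [lintegral_eq_sum_arcPiece hN, lintegral_eq_sum_arcPiece hN (fun x => ‖u.dPhi (θ, x)‖ₑ ^ 2),
    Finset.mul_sum, Finset.mul_sum, ← Finset.sum_add_distrib]
  refine Finset.sum_le_sum fun j hj => ?_
  have hj := Finset.mem_range.mp hj
  have mp := measurePreserving_arcPiece hj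
  have m1 : Measurable fun x => u.fn (θ, x) := hu.fn.comp measurable_prodMk_left
  have m2 : Measurable fun x => u.dPhi (θ, x) := hu.dPhi.comp measurable_prodMk_left
  rw [← mp.lintegral_comp (m1.enorm.pow_const 2), ← mp.lintegral_comp (m2.enorm.pow_const 2),
    ← mp.map_eq, integral_map mp.measurable.aemeasurable m1.aestronglyMeasurable]
  have hjN : (j : ℝ) + 1 ≤ N := by exact_mod_cast hj
  have hle : 2 * π / N * (j + 1) ≤ 2 * π := by
    rw [div_mul_eq_mul_div, div_le_iff₀ hN']
    exact mul_le_mul_of_nonneg_left hjN two_pi_pos.le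
  have hj0 : 0 ≤ 2 * π / N * j := by positivity
  have := lintegral_sq_arc_le (α := 2 * π / N * j) (β := 2 * π / N * (j + 1)) (c := h θ) hj0
    (by linarith) (f := fun r => u.dPhi (θ, (r : S1))) (v := fun p => u.fn (θ, (p : S1))) ?_ ?_
  · rw [show 2 * π / N * (j + 1) - 2 * π / N * j = 2 * π / N by ring,
      show 2 / (2 * π / N) = N / π by field_simp] at this
    exact this
  · have := intervalIntegrable_circle h2
    rw [intervalIntegrable_iff_integrableOn_Ioc_of_le two_pi_pos.le] at this
    exact this.mono_set (Ioc_subset_Ioc_right hle)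
  · rw [ae_restrict_iff' measurableSet_Ioc]
    filter_upwards [ae_circle_iff h1] with p hp hp'
    have hp2 : p ∈ Ioc 0 (2 * π) := ⟨hj0.trans_lt hp'.1, hp'.2.trans hle⟩
    rw [hp hp2, phiPrim, ang_coe hp2]

/-! ### Weak limits and compactness -/

/-- Bounded sequences of a separable Hilbert space have weakly convergent subsequences. -/
lemma exists_subseq_inner_tendsto {H : Type*} [NormedAddCommGroup H] [InnerProductSpace ℝ H]
    [CompleteSpace H] [TopologicalSpace.SeparableSpace H] (x : ℕ → H) (r : ℝ)
    (hx : ∀ n, ‖x n‖ ≤ r) :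
    ∃ φ : ℕ → ℕ, StrictMono φ ∧ ∀ y, ∃ l, Tendsto (fun n => inner ℝ (x (φ n)) y) atTop (𝓝 l) := by
  obtain ⟨L, -, φ, hφ, h⟩ := WeakDual.isSeqCompact_closedBall ℝ H 0 r
    (x := fun n => StrongDual.toWeakDual (InnerProductSpace.toDual ℝ H (x n))) (fun n => by
      simp only [mem_preimage, Metric.mem_closedBall, dist_zero_right]
      exact ((InnerProductSpace.toDual ℝ H).norm_map (x n)).trans_le (hx n))
  exact ⟨φ, hφ, fun y => ⟨L y, (WeakDual.eval_continuous y).continuousAt.tendsto.comp h⟩⟩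

lemma eLpNorm_two_sq {α : Type*} [MeasurableSpace α] (μ : Measure α) (f : α → ℝ) :
    eLpNorm f 2 μ ^ 2 = ∫⁻ x, ‖f x‖ₑ ^ 2 ∂μ := by
  have := eLpNorm_nnreal_pow_eq_lintegral (μ := μ) (f := f) (p := 2) (by norm_num)
  simpa using this

lemma memLp_two_of_lintegral_lt_top {α : Type*} [MeasurableSpace α] {μ : Measure α} {f : α → ℝ}
    (hf : AEStronglyMeasurable f μ) (h : ∫⁻ x, ‖f x‖ₑ ^ 2 ∂μ < ∞) : MemLp f 2 μ := by
  refine ⟨hf, ?_⟩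
  rw [← eLpNorm_two_sq] at h
  by_contra hn
  rw [not_lt, top_le_iff] at hn
  simp [hn] at h

lemma exists_subseq_integral_mul_tendsto {α : Type*} [MeasurableSpace α]
    [MeasurableSpace.CountablyGenerated α] {μ : Measure α} [SFinite μ] {f : ℕ → α → ℝ}
    {B : ℝ≥0∞} (hB : B ≠ ∞) (hf : ∀ n, AEStronglyMeasurable (f n) μ)
    (h : ∀ n, ∫⁻ x, ‖f n x‖ₑ ^ 2 ∂μ ≤ B) :
    ∃ φ : ℕ → ℕ, StrictMono φ ∧ ∀ k, MemLp k 2 μ →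
      ∃ l, Tendsto (fun n => ∫ x, f (φ n) x * k x ∂μ) atTop (𝓝 l) := by
  have hm : ∀ n, MemLp (f n) 2 μ := fun n =>
    memLp_two_of_lintegral_lt_top (hf n) ((h n).trans_lt hB.lt_top)
  have : Fact ((1 : ℝ≥0∞) ≤ 2) := ⟨by norm_num⟩
  have : Fact ((2 : ℝ≥0∞) ≠ ∞) := ⟨by norm_num⟩
  obtain ⟨φ, hφ, H⟩ := exists_subseq_inner_tendsto (fun n => (hm n).toLp (f n)) (√B.toReal)
    fun n => by
      rw [Lp.norm_toLp]
      refine Real.le_sqrt_of_sq_le ?_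
      rw [← ENNReal.toReal_pow, eLpNorm_two_sq]
      exact ENNReal.toReal_mono hB (h n)
  refine ⟨φ, hφ, fun k hk => ?_⟩
  obtain ⟨l, hl⟩ := H (hk.toLp k)
  refine ⟨l, hl.congr fun n => ?_⟩
  rw [L2.inner_def]
  refine integral_congr_ae ?_
  filter_upwards [(hm (φ n)).coeFn_toLp, hk.coeFn_toLp] with x h1 h2
  rw [h1, h2]
  simp [mul_comm]

lemma integral_weightedArea_eq (a : ℝ) (f : ℝ × S1 → ℝ) :
    ∫ z, f z ∂weightedArea a = ∫ z, wt a z.1 * f z ∂coordMeasure := by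
  have hm : Measurable fun z : ℝ × S1 => sin z.1 ^ a * cos z.1 := by fun_prop
  rw [weightedArea, integral_withDensity_eq_integral_toReal_smul hm.ennreal_ofReal
    (Eventually.of_forall fun _ => ENNReal.ofReal_lt_top)]
  refine integral_congr_ae ?_
  filter_upwards [ae_coordMeasure_mem] with z hz
  have := wt_pos (a := a) hz
  rw [wt] at this ⊢
  rw [ENNReal.toReal_ofReal this.le, smul_eq_mul]

/-- The weight that represents integration along meridians up to the height `θ`, over the directions
in `A`, as a pairing in `L²(y^a dS)`. -/
def meridianWeight (a θ : ℝ) (A : Set S1) : ℝ × S1 → ℝ :=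
  (Ioo 0 θ ×ˢ A).indicator fun z => 1 / wt a z.1

lemma memLp_meridianWeight {a θ : ℝ} (ha : a < 1) (hθ : θ < π / 2) {A : Set S1}
    (hA : MeasurableSet A) : MemLp (meridianWeight a θ A) 2 (weightedArea a) := by
  have hw := measurable_wt a
  have hm : Measurable (meridianWeight a θ A) :=
    ((hw.comp measurable_fst).const_div 1).indicator (measurableSet_Ioo.prod hA)
  refine memLp_two_of_lintegral_lt_top hm.aestronglyMeasurable ?_
  rw [lintegral_weightedArea (hm.enorm.pow_const 2)]
  calc _ ≤ ∫⁻ t in Ioo 0 (π / 2),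
        (Ioc 0 θ).indicator (fun t => ENNReal.ofReal (1 / wt a t)) t * volume (univ : Set S1) := by
        refine lintegral_mono_ae ?_
        filter_upwards [ae_thetaMeasure_mem] with t ht
        have hp := wt_pos (a := a) ht
        by_cases h : t ∈ Ioo 0 θ
        · rw [indicator_of_mem (Ioo_subset_Ioc_self h)]
          calc _ ≤ ENNReal.ofReal (wt a t) * ∫⁻ x : S1, ENNReal.ofReal (1 / wt a t) ^ 2 := by
                gcongr with x
                rw [meridianWeight, indicator]
                split_ifs
                · rw [Real.enorm_of_nonneg (by positivity)]
                · simp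
            _ = _ := by
                rw [lintegral_const, ← mul_assoc, ← ENNReal.ofReal_pow (by positivity),
                  ← ENNReal.ofReal_mul hp.le]
                congr 2
                field_simp
        · have : ∀ x : S1, meridianWeight a θ A (t, x) = 0 := fun x =>
            indicator_of_notMem (fun hh => h hh.1) _
          simp [this]
    _ = (∫⁻ t in Ioo 0 (π / 2), (Ioc 0 θ).indicator (fun t => ENNReal.ofReal (1 / wt a t)) t) *
          volume (univ : Set S1) := by
        rw [lintegral_mul_const _ ((hw.const_div 1).ennreal_ofReal.indicator measurableSet_Ioc)]
    _ ≤ oscBound a θ * volume (univ : Set S1) := by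
        gcongr
        rw [oscBound, ← lintegral_indicator measurableSet_Ioc]
        exact setLIntegral_le_lintegral _ _
    _ < ∞ := ENNReal.mul_lt_top (oscBound_lt_top ha hθ) (measure_lt_top _ _)

lemma integral_mul_meridianWeight {a θ : ℝ} (hθ : θ < π / 2) {A : Set S1}
    (hA : MeasurableSet A) {f : ℝ × S1 → ℝ} (hf : CollarIntegrable f) :
    ∫ z, f z * meridianWeight a θ A z ∂weightedArea a = ∫ x in A, thetaPrim f (θ, x) := by
  rw [integral_weightedArea_eq]
  have h1 : ∫ z, wt a z.1 * (f z * meridianWeight a θ A z) ∂coordMeasure =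
      ∫ z, (Ioo 0 θ ×ˢ A).indicator f z ∂coordMeasure := by
    refine integral_congr_ae ?_
    filter_upwards [ae_coordMeasure_mem] with z hz
    have hp := wt_pos (a := a) hz
    by_cases h : z ∈ Ioo 0 θ ×ˢ A
    · rw [meridianWeight, indicator_of_mem h, indicator_of_mem h]; field_simp
    · rw [meridianWeight, indicator_of_notMem h, indicator_of_notMem h]; simp
  have h2 : coordMeasure.restrict (Ioo 0 θ ×ˢ A) =
      ((volume : Measure ℝ).restrict (Ioo 0 θ)).prod ((volume : Measure S1).restrict A) := by
    rw [coordMeasure, ← Measure.prod_restrict, Measure.restrict_restrict measurableSet_Ioo,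
      inter_eq_self_of_subset_left (Ioo_subset_Ioo_right hθ.le)]
  have h3 : Integrable f
      (((volume : Measure ℝ).restrict (Ioo 0 θ)).prod ((volume : Measure S1).restrict A)) := by
    have := (hf θ hθ).mono_measure (μ := (((volume : Measure ℝ).restrict (Ioo 0 θ)).prod
      ((volume : Measure S1).restrict A))) ?_
    · exact this
    · rw [collar]
      exact Measure.prod_mono le_rfl Measure.restrict_le_self
  rw [h1, integral_indicator (measurableSet_Ioo.prod hA), h2, integral_prod_symm _ h3]
  refine integral_congr_ae (Eventually.of_forall fun x => ?_)
  simp only [thetaPrim]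
  rw [integral_Ioc_eq_integral_Ioo]

lemma enorm_sub_sq_le (x y : ℝ) : ‖x - y‖ₑ ^ 2 ≤ 2 * ‖x‖ₑ ^ 2 + 2 * ‖y‖ₑ ^ 2 := by
  simpa [sub_eq_add_neg] using enorm_add_sq_le x (-y)

lemma enorm_setIntegral_circle_sq_le {f : S1 → ℝ} (hf : Measurable f) (A : Set S1) :
    ‖∫ x in A, f x‖ₑ ^ 2 ≤ volume (univ : Set S1) * ∫⁻ x, ‖f x‖ₑ ^ 2 := by
  refine (enorm_integral_sq_le (p := fun _ => 1) hf.aemeasurable aemeasurable_const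
    (by simp) (by simp)).trans ?_
  simp only [lintegral_const, one_mul, Measure.restrict_apply_univ, div_one]
  exact mul_le_mul' (measure_mono (subset_univ _)) (setLIntegral_le_lintegral _ _)

namespace WeightedH1

variable {a : ℝ}

lemma normSq_dPhi_le (u : WeightedH1 a) :
    normSq a u.dPhi ≤ normSq a fun z => u.dPhi z / cos z.1 := by
  refine lintegral_mono_ae ?_
  filter_upwards [ae_weightedArea_iff.mpr ae_coordMeasure_mem] with z hz
  have := cos_pos_of_mem hz
  gcongr ?_ ^ 2
  rw [Real.enorm_eq_ofReal_abs, Real.enorm_eq_ofReal_abs]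
  refine ENNReal.ofReal_le_ofReal ?_
  rw [abs_div, abs_of_pos this, le_div_iff₀ this]
  exact mul_le_of_le_one_right (abs_nonneg _) (cos_le_one _)

lemma normSq_sub_le {f g : ℝ × S1 → ℝ} (hf : Measurable f) {B : ℝ≥0∞}
    (h1 : normSq a f ≤ B) (h2 : normSq a g ≤ B) : normSq a (fun z => f z - g z) ≤ 4 * B := by
  calc normSq a (fun z => f z - g z)
      ≤ ∫⁻ z, (2 * ‖f z‖ₑ ^ 2 + 2 * ‖g z‖ₑ ^ 2) ∂weightedArea a :=
        lintegral_mono fun z => enorm_sub_sq_le _ _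
    _ = 2 * normSq a f + 2 * normSq a g := by
        rw [lintegral_add_left (by fun_prop), lintegral_const_mul' _ _ (by simp),
          lintegral_const_mul' _ _ (by simp)]; rfl
    _ ≤ 2 * B + 2 * B := by gcongr
    _ = 4 * B := by ring

/-- Along a subsequence, the integrals over arcs of a bounded sequence form Cauchy sequences in the
weighted `L²` space of the height: the traces and the `θ`-derivatives converge weakly, and the
integral over an arc at a given height is a bounded functional of these. -/
lemma exists_subseq_arc_cauchy (ha : -1 < a) (ha' : a < 1) {u : ℕ → WeightedH1 a}
    (hm : ∀ n, (u n).IsMeasurable) {B : ℝ≥0∞} (hB : B ≠ ∞) (h1 : ∀ n, normSq a (u n).fn ≤ B)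
    (h2 : ∀ n, normSq a (u n).dTheta ≤ B) :
    ∃ φ : ℕ → ℕ, StrictMono φ ∧ ∀ A : Set S1, MeasurableSet A →
      Tendsto (fun p : ℕ × ℕ => ∫⁻ θ in Ioo 0 (π / 2), ENNReal.ofReal (wt a θ) *
        ‖∫ x in A, ((u (φ p.1)).fn (θ, x) - (u (φ p.2)).fn (θ, x))‖ₑ ^ 2) atTop (𝓝 0) := by
  obtain ⟨C, hC, H⟩ := exists_isTrace_le ha ha'
  choose g hg hrep _ hgC using fun n => H (u n) (hm n)
  have hg2 : ∀ n, ∫⁻ x, ‖g n x‖ₑ ^ 2 ≤ C * (2 * B) := fun n => (hgC n).trans (by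
    rw [two_mul]; exact mul_le_mul' le_rfl (add_le_add (h1 n) (h2 n)))
  have hCB : C * (2 * B) ≠ ∞ := ENNReal.mul_ne_top hC (ENNReal.mul_ne_top (by simp) hB)
  have : SFinite (weightedArea a) := by
    have := isFiniteMeasure_weightedArea ha
    infer_instance
  obtain ⟨φ, hφ, hφc⟩ := exists_subseq_integral_mul_tendsto hCB
    (fun n => (hg n).aestronglyMeasurable) hg2
  obtain ⟨ψ, hψ, hψc⟩ := exists_subseq_integral_mul_tendsto hB
    (f := fun n => (u (φ n)).dTheta) (fun n => (hm (φ n)).dTheta.aestronglyMeasurable)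
    (fun n => h2 (φ n))
  refine ⟨φ ∘ ψ, hφ.comp hψ, fun A hA => ?_⟩
  have hgi : ∀ n, Integrable (g n) := fun n =>
    (memLp_two_of_lintegral_lt_top (hg n).aestronglyMeasurable
      ((hg2 n).trans_lt hCB.lt_top)).integrable (by norm_num)
  have hFm : ∀ n, Measurable (thetaPrim (u n).dTheta) := fun n => measurable_thetaPrim (hm n).dTheta
  have hFs : ∀ n θ, Measurable fun x => thetaPrim (u n).dTheta (θ, x) := fun n θ =>
    (hFm n).comp measurable_prodMk_left
  have hF2 : ∀ n, ∀ θ < π / 2, ∫⁻ x, ‖thetaPrim (u n).dTheta (θ, x)‖ₑ ^ 2 ≤ oscBound a θ * B :=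
    fun n θ hθ => (lintegral_thetaPrim_sq_le hθ (hm n).dTheta).trans (by gcongr; exact h2 n)
  have hFi : ∀ n, ∀ θ < π / 2, Integrable fun x => thetaPrim (u n).dTheta (θ, x) := fun n θ hθ =>
    (memLp_two_of_lintegral_lt_top (hFs n θ).aestronglyMeasurable
      ((hF2 n θ hθ).trans_lt (ENNReal.mul_lt_top (oscBound_lt_top ha' hθ) hB.lt_top))).integrable
        (by norm_num)
  set V : ℕ → ℝ → ℝ := fun n θ => ∫ x in A, (g n x + thetaPrim (u n).dTheta (θ, x)) with hV
  have hVlim : ∀ θ < π / 2, ∃ l, Tendsto (fun n => V (φ (ψ n)) θ) atTop (𝓝 l) := by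
    intro θ hθ
    obtain ⟨l₁, hl₁⟩ := hφc (A.indicator fun _ => 1)
      ((memLp_const (1 : ℝ)).indicator hA)
    obtain ⟨l₂, hl₂⟩ := hψc _ (memLp_meridianWeight ha' hθ hA)
    refine ⟨l₁ + l₂, ((hl₁.comp hψ.tendsto_atTop).add hl₂).congr fun n => ?_⟩
    simp only [hV, Function.comp_def]
    rw [integral_add (hgi _).integrableOn (hFi _ θ hθ).integrableOn,
      integral_mul_meridianWeight hθ hA (collarIntegrable_of_memLp ha' (u (φ (ψ n))).memLp_dTheta),
      ← integral_indicator (f := g (φ (ψ n))) hA]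
    refine congrArg (· + _) (integral_congr_ae (Eventually.of_forall fun x => ?_))
    by_cases hx : x ∈ A <;> simp [hx]
  have hVm : ∀ n, Measurable (V n) := by
    intro n
    have hj : Measurable fun z : ℝ × S1 => g n z.2 + thetaPrim (u n).dTheta z :=
      ((hg n).comp measurable_snd).add (hFm n)
    exact (hj.stronglyMeasurable.integral_prod_right'
      (ν := (volume : Measure S1).restrict A)).measurable
  set D : ℝ → ℝ≥0∞ := fun θ =>
    volume (univ : Set S1) * (2 * (C * (2 * B)) + 2 * (oscBound a θ * B)) with hD
  have hVD : ∀ n, ∀ θ < π / 2, ‖V n θ‖ₑ ^ 2 ≤ D θ := by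
    intro n θ hθ
    refine (enorm_setIntegral_circle_sq_le ((hg n).add (hFs n θ)) A).trans ?_
    simp only [hD]
    gcongr
    calc _ ≤ ∫⁻ x, (2 * ‖g n x‖ₑ ^ 2 + 2 * ‖thetaPrim (u n).dTheta (θ, x)‖ₑ ^ 2) :=
          lintegral_mono fun x => enorm_add_sq_le _ _
      _ = 2 * (∫⁻ x, ‖g n x‖ₑ ^ 2) + 2 * ∫⁻ x, ‖thetaPrim (u n).dTheta (θ, x)‖ₑ ^ 2 := by
          rw [lintegral_add_left (by have := hg n; fun_prop), lintegral_const_mul' _ _ (by simp),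
            lintegral_const_mul' _ _ (by simp)]
      _ ≤ _ := by gcongr; exacts [hg2 n, hF2 n θ hθ]
  have hmo : Measurable (oscBound a) := (show Monotone (oscBound a) from
    fun _ _ h => oscBound_mono a h).measurable
  have hw := measurable_wt a
  have hlim := tendsto_lintegral_filter_of_dominated_convergence (l := (atTop : Filter (ℕ × ℕ)))
    (μ := thetaMeasure)
    (F := fun p θ => ENNReal.ofReal (wt a θ) * ‖V (φ (ψ p.1)) θ - V (φ (ψ p.2)) θ‖ₑ ^ 2)
    (f := fun _ => 0) (fun θ => ENNReal.ofReal (wt a θ) * (4 * D θ))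
    (Eventually.of_forall fun p => by
      have := hVm (φ (ψ p.1)); have := hVm (φ (ψ p.2)); fun_prop)
    (Eventually.of_forall fun p => by
      filter_upwards [ae_thetaMeasure_mem] with θ hθ
      gcongr
      refine (enorm_sub_sq_le _ _).trans ?_
      calc _ ≤ 2 * D θ + 2 * D θ := by gcongr <;> exact hVD _ θ hθ.2
        _ = 4 * D θ := by ring)
    ?_ ?_
  · rw [lintegral_zero] at hlim
    refine hlim.congr fun p => lintegral_congr_ae ?_
    filter_upwards [ae_thetaMeasure_mem, Measure.ae_ae_of_ae_prod (hrep (φ (ψ p.1))),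
      Measure.ae_ae_of_ae_prod (hrep (φ (ψ p.2)))] with θ hθ e1 e2
    simp only [hV, Function.comp_apply]
    have hi : ∀ n, IntegrableOn (fun x => g n x + thetaPrim (u n).dTheta (θ, x)) A := fun n =>
      ((hgi n).add (hFi n θ hθ.2)).integrableOn
    rw [← integral_sub (hi _) (hi _)]
    congr 3
    refine integral_congr_ae ?_
    filter_upwards [ae_restrict_of_ae e1, ae_restrict_of_ae e2] with x h1 h2
    rw [h1, h2]
  · set M := volume (univ : Set S1)
    have hM : M ≠ ∞ := measure_ne_top _ _
    have e : ∀ θ, ENNReal.ofReal (wt a θ) * (4 * D θ) =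
        (4 * (M * (2 * (C * (2 * B))))) * ENNReal.ofReal (wt a θ) +
          (4 * (M * (2 * B))) * (ENNReal.ofReal (wt a θ) * oscBound a θ) := fun θ => by
      simp only [hD]; ring
    simp_rw [e]
    rw [lintegral_add_left (by fun_prop), lintegral_const_mul _ (by fun_prop),
      lintegral_const_mul _ (by fun_prop)]
    have f4 : (4 : ℝ≥0∞) ≠ ∞ := by simp
    have f2 : (2 : ℝ≥0∞) ≠ ∞ := by simp
    refine ENNReal.add_ne_top.mpr ⟨ENNReal.mul_ne_top ?_ ?_, ENNReal.mul_ne_top ?_ ?_⟩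
    · exact ENNReal.mul_ne_top f4 (ENNReal.mul_ne_top hM (ENNReal.mul_ne_top f2 hCB))
    · exact (integrableOn_wt ha).lintegral_lt_top.ne
    · exact ENNReal.mul_ne_top f4 (ENNReal.mul_ne_top hM (ENNReal.mul_ne_top f2 hB))
    · exact (lintegral_oscBound_lt_top ha ha').ne
  · filter_upwards [ae_thetaMeasure_mem] with θ hθ
    obtain ⟨l, hl⟩ := hVlim θ hθ.2
    have h3 : Tendsto (fun p : ℕ × ℕ => V (φ (ψ p.1)) θ - V (φ (ψ p.2)) θ) atTop (𝓝 0) := by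
      rw [← prod_atTop_atTop_eq, ← sub_self l]
      exact (hl.comp tendsto_fst).sub (hl.comp tendsto_snd)
    have h4 : Tendsto (fun p : ℕ × ℕ => ‖V (φ (ψ p.1)) θ - V (φ (ψ p.2)) θ‖ₑ ^ 2) atTop (𝓝 0) := by
      have := (ENNReal.continuous_pow 2).tendsto _ |>.comp (continuous_enorm.tendsto _ |>.comp h3)
      simpa [Function.comp_def] using this
    have := ENNReal.Tendsto.const_mul (a := ENNReal.ofReal (wt a θ)) h4
      (Or.inr ENNReal.ofReal_ne_top)
    simpa using this

/-- A bounded sequence in the weighted Sobolev space has a subsequence that is Cauchy in the weighted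
`L²` space: on short arcs functions are close to their means, and the means converge. -/
theorem exists_subseq_cauchy (ha : -1 < a) (ha' : a < 1) (u : ℕ → WeightedH1 a) {B : ℝ≥0∞}
    (hB : B ≠ ∞) (h1 : ∀ n, normSq a (u n).fn ≤ B) (h2 : ∀ n, normSq a (u n).dTheta ≤ B)
    (h3 : ∀ n, normSq a (fun z => (u n).dPhi z / cos z.1) ≤ B) :
    ∃ φ : ℕ → ℕ, StrictMono φ ∧ Tendsto (fun p : ℕ × ℕ =>
      normSq a fun z => (u (φ p.1)).fn z - (u (φ p.2)).fn z) atTop (𝓝 0) := by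
  choose v hv e using fun n => (u n).exists_measurable
  have h1' : ∀ n, normSq a (v n).fn ≤ B := fun n => by rw [← normSq_congr (e n).fn]; exact h1 n
  have h2' : ∀ n, normSq a (v n).dTheta ≤ B := fun n => by
    rw [← normSq_congr (e n).dTheta]; exact h2 n
  have h3' : ∀ n, normSq a (v n).dPhi ≤ B := fun n => by
    rw [← normSq_congr (e n).dPhi]; exact (normSq_dPhi_le _).trans (h3 n)
  obtain ⟨φ, hφ, H⟩ := exists_subseq_arc_cauchy ha ha' hv hB h1' h2'
  refine ⟨φ, hφ, ?_⟩
  have hcongr : ∀ p : ℕ × ℕ, normSq a (fun z => (v (φ p.1)).fn z - (v (φ p.2)).fn z) =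
      normSq a fun z => (u (φ p.1)).fn z - (u (φ p.2)).fn z := fun p =>
    normSq_congr (((e _).fn.symm).sub ((e _).fn.symm))
  refine Tendsto.congr hcongr ?_
  have hw := measurable_wt a
  have key : ∀ N : ℕ, 0 < N → ∀ p : ℕ × ℕ,
      normSq a (fun z => (v (φ p.1)).fn z - (v (φ p.2)).fn z) ≤
        ENNReal.ofReal (N / π) * (∑ j ∈ Finset.range N, ∫⁻ θ in Ioo 0 (π / 2),
          ENNReal.ofReal (wt a θ) * ‖∫ x in arcPiece N j,
            ((v (φ p.1)).fn (θ, x) - (v (φ p.2)).fn (θ, x))‖ₑ ^ 2) +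
        ENNReal.ofReal (2 * (2 * π / N) ^ 2) * (4 * B) := by
    intro N hN p
    have m1 : Measurable fun z => (v (φ p.1)).fn z - (v (φ p.2)).fn z := (hv _).fn.sub (hv _).fn
    have m2 : Measurable fun z => (v (φ p.1)).dPhi z - (v (φ p.2)).dPhi z :=
      (hv _).dPhi.sub (hv _).dPhi
    set w := lin ha' 1 (-1) (v (φ p.1)) (v (φ p.2)) with hw'
    have ew : w.fn = fun z => (v (φ p.1)).fn z - (v (φ p.2)).fn z := by
      funext z; simp only [hw', lin]; ring
    have ew2 : w.dPhi = fun z => (v (φ p.1)).dPhi z - (v (φ p.2)).dPhi z := by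
      funext z; simp only [hw', lin]; ring
    have hwm : w.IsMeasurable := ⟨by rw [ew]; exact m1,
      by have := (hv (φ p.1)).dTheta; have := (hv (φ p.2)).dTheta
         simp only [hw', lin]; fun_prop, by rw [ew2]; exact m2⟩
    have hs := lintegral_sq_slice_le ha' hwm hN
    rw [ew, ew2] at hs
    have hmI : ∀ j, Measurable fun θ => ∫ x in arcPiece N j,
        ((v (φ p.1)).fn (θ, x) - (v (φ p.2)).fn (θ, x)) := fun j =>
      (m1.stronglyMeasurable.integral_prod_right'
        (ν := (volume : Measure S1).restrict (arcPiece N j))).measurable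
    rw [normSq, lintegral_weightedArea (m1.enorm.pow_const 2)]
    calc _ ≤ ∫⁻ θ in Ioo 0 (π / 2), (ENNReal.ofReal (N / π) * (∑ j ∈ Finset.range N,
          ENNReal.ofReal (wt a θ) * ‖∫ x in arcPiece N j,
            ((v (φ p.1)).fn (θ, x) - (v (φ p.2)).fn (θ, x))‖ₑ ^ 2) +
          ENNReal.ofReal (2 * (2 * π / N) ^ 2) * (ENNReal.ofReal (wt a θ) *
            ∫⁻ x, ‖(v (φ p.1)).dPhi (θ, x) - (v (φ p.2)).dPhi (θ, x)‖ₑ ^ 2)) := by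
          refine lintegral_mono_ae ?_
          filter_upwards [hs] with θ hθ
          refine (mul_le_mul' le_rfl hθ).trans (le_of_eq ?_)
          rw [← Finset.mul_sum]
          ring
      _ = ENNReal.ofReal (N / π) * (∑ j ∈ Finset.range N, ∫⁻ θ in Ioo 0 (π / 2),
          ENNReal.ofReal (wt a θ) * ‖∫ x in arcPiece N j,
            ((v (φ p.1)).fn (θ, x) - (v (φ p.2)).fn (θ, x))‖ₑ ^ 2) +
          ENNReal.ofReal (2 * (2 * π / N) ^ 2) *
            normSq a (fun z => (v (φ p.1)).dPhi z - (v (φ p.2)).dPhi z) := by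
          have hms : ∀ j, Measurable fun θ => ENNReal.ofReal (wt a θ) * ‖∫ x in arcPiece N j,
              ((v (φ p.1)).fn (θ, x) - (v (φ p.2)).fn (θ, x))‖ₑ ^ 2 := fun j => by
            have := hmI j; fun_prop
          rw [lintegral_add_left ((Finset.measurable_sum _ fun j _ => hms j).const_mul _),
            lintegral_const_mul' _ _ ENNReal.ofReal_ne_top,
            lintegral_const_mul' _ _ ENNReal.ofReal_ne_top,
            lintegral_finsetSum _ fun j _ => hms j, normSq,
            lintegral_weightedArea (m2.enorm.pow_const 2)]
      _ ≤ _ := by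
          gcongr
          exact normSq_sub_le (hv _).dPhi (h3' _) (h3' _)
  rw [ENNReal.tendsto_nhds_zero]
  intro ε hε
  have hN : Tendsto (fun N : ℕ => ENNReal.ofReal (2 * (2 * π / N) ^ 2) * (4 * B)) atTop (𝓝 0) := by
    have t1 : Tendsto (fun N : ℕ => 2 * (2 * π / (N : ℝ)) ^ 2) atTop (𝓝 (2 * 0 ^ 2)) :=
      ((tendsto_const_div_atTop_nhds_zero_nat (2 * π)).pow 2).const_mul 2
    have t2 := ENNReal.Tendsto.mul_const (b := 4 * B) (ENNReal.tendsto_ofReal t1)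
      (Or.inr (ENNReal.mul_ne_top (by simp) hB))
    simpa using t2
  obtain ⟨N, hN1, hN2⟩ := ((ENNReal.tendsto_nhds_zero.mp hN (ε / 2) (by simpa using hε.ne')).and
    (eventually_gt_atTop 0)).exists
  have hS : Tendsto (fun p : ℕ × ℕ => ENNReal.ofReal (N / π) *
      (∑ j ∈ Finset.range N, ∫⁻ θ in Ioo 0 (π / 2),
          ENNReal.ofReal (wt a θ) * ‖∫ x in arcPiece N j,
            ((v (φ p.1)).fn (θ, x) - (v (φ p.2)).fn (θ, x))‖ₑ ^ 2)) atTop (𝓝 0) := by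
    have t1 := tendsto_finsetSum (Finset.range N)
      fun j _ => H (arcPiece N j) (measurableSet_arcPiece N j)
    have t2 := ENNReal.Tendsto.const_mul (a := ENNReal.ofReal (N / π)) t1
      (Or.inr ENNReal.ofReal_ne_top)
    simpa using t2
  filter_upwards [ENNReal.tendsto_nhds_zero.mp hS (ε / 2) (by simpa using hε.ne')] with p hp
  calc _ ≤ _ := key N hN2 p
    _ ≤ ε / 2 + ε / 2 := add_le_add hp hN1
    _ = ε := ENNReal.add_halves ε

end WeightedH1

/-! ### The Sobolev space as a subspace of a product of Hilbert spaces -/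

/-- The Hilbert space `L²(y^a dS)`. -/
abbrev WeightedL2 (a : ℝ) : Type := Lp ℝ 2 (weightedArea a)

lemma inner_toLp {a : ℝ} {f g : ℝ × S1 → ℝ} (hf : MemLp f 2 (weightedArea a))
    (hg : MemLp g 2 (weightedArea a)) :
    inner ℝ (hf.toLp f) (hg.toLp g) = ∫ z, f z * g z ∂weightedArea a := by
  rw [L2.inner_def]
  refine integral_congr_ae ?_
  filter_upwards [hf.coeFn_toLp, hg.coeFn_toLp] with x h1 h2
  rw [h1, h2]
  simp [mul_comm]

lemma integrable_mul_of_memLp {a : ℝ} {f g : ℝ × S1 → ℝ} (hf : MemLp f 2 (weightedArea a))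
    (hg : MemLp g 2 (weightedArea a)) : Integrable (fun z => f z * g z) (weightedArea a) :=
  hf.integrable_mul hg

lemma normSq_eq_norm_toLp {a : ℝ} {f : ℝ × S1 → ℝ} (hf : MemLp f 2 (weightedArea a)) :
    normSq a f = ENNReal.ofReal (‖hf.toLp f‖ ^ 2) := by
  rw [normSq_eq_ofReal hf, ← real_inner_self_eq_norm_sq, inner_toLp]
  simp_rw [pow_two]

namespace WeightedH1

variable {a : ℝ}

/-- `u` as an element of `L²(y^a dS)`. -/
def valL2 (u : WeightedH1 a) : WeightedL2 a := u.memLp_fn.toLp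

/-- The component `∂_θ u` of the gradient as an element of `L²(y^a dS)`. -/
def thetaL2 (u : WeightedH1 a) : WeightedL2 a := u.memLp_dTheta.toLp

/-- The component `(cos θ)⁻¹ ∂_φ u` of the gradient as an element of `L²(y^a dS)`. -/
def phiL2 (u : WeightedH1 a) : WeightedL2 a := u.memLp_dPhi.toLp

/-- The energy form in which the derivative in `φ` is multiplied by `κ`. On the functions with
`κ`-fold symmetry it is the energy form of the hemisphere, seen in the angle `κ φ`. -/
def energyK (κ : ℝ) (u v : WeightedH1 a) : ℝ :=
  inner ℝ u.thetaL2 v.thetaL2 + κ ^ 2 * inner ℝ u.phiL2 v.phiL2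

lemma massForm_eq (u v : WeightedH1 a) : u.massForm v = inner ℝ u.valL2 v.valL2 :=
  (inner_toLp u.memLp_fn v.memLp_fn).symm

lemma massForm_self (u : WeightedH1 a) : u.massForm u = ‖u.valL2‖ ^ 2 := by
  rw [massForm_eq, real_inner_self_eq_norm_sq]

lemma energyForm_eq (u v : WeightedH1 a) : u.energyForm v = energyK 1 u v := by
  rw [energyForm, energyK, one_pow, one_mul, thetaL2, thetaL2, phiL2, phiL2, inner_toLp, inner_toLp,
    integral_add (integrable_mul_of_memLp u.memLp_dTheta v.memLp_dTheta)
      (integrable_mul_of_memLp u.memLp_dPhi v.memLp_dPhi)]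

lemma energyK_self (κ : ℝ) (u : WeightedH1 a) :
    energyK κ u u = ‖u.thetaL2‖ ^ 2 + κ ^ 2 * ‖u.phiL2‖ ^ 2 := by
  rw [energyK, real_inner_self_eq_norm_sq, real_inner_self_eq_norm_sq]

lemma energyK_self_nonneg (κ : ℝ) (u : WeightedH1 a) : 0 ≤ energyK κ u u := by
  rw [energyK_self]; positivity

lemma energyK_mono {κ κ' : ℝ} (h0 : 0 ≤ κ) (h : κ ≤ κ') (u : WeightedH1 a) :
    energyK κ u u ≤ energyK κ' u u := by
  rw [energyK_self, energyK_self]; gcongr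

lemma lin_valL2 (ha : a < 1) (c d : ℝ) (u v : WeightedH1 a) :
    (lin ha c d u v).valL2 = c • u.valL2 + d • v.valL2 := rfl

lemma lin_thetaL2 (ha : a < 1) (c d : ℝ) (u v : WeightedH1 a) :
    (lin ha c d u v).thetaL2 = c • u.thetaL2 + d • v.thetaL2 := rfl

lemma lin_phiL2 (ha : a < 1) (c d : ℝ) (u v : WeightedH1 a) :
    (lin ha c d u v).phiL2 = c • u.phiL2 + d • v.phiL2 := by
  simp only [phiL2]
  rw [← MemLp.toLp_const_smul, ← MemLp.toLp_const_smul, ← MemLp.toLp_add]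
  refine MemLp.toLp_congr _ _ (Eventually.of_forall fun z => ?_)
  simp only [lin, Pi.add_apply, Pi.smul_apply, smul_eq_mul]
  ring

lemma energyK_lin_self (ha : a < 1) (κ c d : ℝ) (u v : WeightedH1 a) :
    energyK κ (lin ha c d u v) (lin ha c d u v) =
      c ^ 2 * energyK κ u u + 2 * c * d * energyK κ u v + d ^ 2 * energyK κ v v := by
  simp only [energyK, lin_thetaL2, lin_phiL2, inner_add_left, inner_add_right, inner_smul_left,
    inner_smul_right, conj_trivial, real_inner_comm u.thetaL2 v.thetaL2,
    real_inner_comm u.phiL2 v.phiL2]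
  ring

lemma massForm_lin_self (ha : a < 1) (c d : ℝ) (u v : WeightedH1 a) :
    (lin ha c d u v).massForm (lin ha c d u v) =
      c ^ 2 * u.massForm u + 2 * c * d * u.massForm v + d ^ 2 * v.massForm v := by
  simp only [massForm_eq, lin_valL2, inner_add_left, inner_add_right, inner_smul_left,
    inner_smul_right, conj_trivial, real_inner_comm u.valL2 v.valL2]
  ring

lemma AEEq.valL2 {u v : WeightedH1 a} (h : u.AEEq v) : u.valL2 = v.valL2 :=
  MemLp.toLp_congr _ _ (ae_weightedArea_iff.mpr h.fn)

lemma AEEq.thetaL2 {u v : WeightedH1 a} (h : u.AEEq v) : u.thetaL2 = v.thetaL2 :=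
  MemLp.toLp_congr _ _ (ae_weightedArea_iff.mpr h.dTheta)

lemma AEEq.phiL2 {u v : WeightedH1 a} (h : u.AEEq v) : u.phiL2 = v.phiL2 := by
  refine MemLp.toLp_congr _ _ ?_
  filter_upwards [ae_weightedArea_iff.mpr h.dPhi] with z hz
  rw [hz]

lemma AEEq.energyK_self {u v : WeightedH1 a} (h : u.AEEq v) (κ : ℝ) :
    WeightedH1.energyK κ u u = WeightedH1.energyK κ v v := by
  rw [WeightedH1.energyK, WeightedH1.energyK, h.thetaL2, h.phiL2]

lemma isNonzero_iff (u : WeightedH1 a) : u.IsNonzero ↔ u.valL2 ≠ 0 := by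
  rw [IsNonzero, Ne, valL2, ← MemLp.toLp_zero (MemLp.zero' (ε := ℝ) (p := 2)),
    MemLp.toLp_eq_toLp_iff]

lemma IsNonzero.massForm_pos {u : WeightedH1 a} (h : u.IsNonzero) : 0 < u.massForm u := by
  rw [massForm_self]
  have := norm_pos_iff.mpr (u.isNonzero_iff.mp h)
  positivity

lemma valL2_eq_zero {u : WeightedH1 a} (h : ¬ u.IsNonzero) : u.valL2 = 0 := by
  rwa [isNonzero_iff, not_not] at h

/-- Test functions, divided by the weight, represent the pairing in coordinates as an inner product of
`L²(y^a dS)`. -/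
lemma memLp_test_div (ha : a < 1) {η : ℝ × S1 → ℝ} (hη : IsTestFunction η) :
    MemLp (fun z => η z / wt a z.1) 2 (weightedArea a) := by
  obtain ⟨b, _, hb, hs⟩ := hη.exists_lt
  obtain ⟨C, hC⟩ := hη.exists_bound
  have hw := measurable_wt a
  have hm : Measurable η := hη.continuous.measurable
  refine ((memLp_meridianWeight ha hb MeasurableSet.univ).const_mul C).mono
    (hm.div (hw.comp measurable_fst)).aestronglyMeasurable ?_
  filter_upwards [ae_weightedArea_iff.mpr ae_coordMeasure_mem] with z hz
  have hp := wt_pos (a := a) hz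
  by_cases h : z.1 < b
  · rw [meridianWeight, indicator_of_mem (show z ∈ Ioo 0 b ×ˢ univ from ⟨⟨hz.1, h⟩, mem_univ _⟩),
      norm_div, norm_mul, norm_div, norm_one, mul_one_div]
    gcongr
    exact (hC z).trans (le_abs_self C)
  · rw [hs z (not_lt.mp h), zero_div, norm_zero]
    exact norm_nonneg _

lemma integral_mul_test (ha : a < 1) {η f : ℝ × S1 → ℝ} (hη : IsTestFunction η)
    (hf : MemLp f 2 (weightedArea a)) :
    ∫ z, f z * η z ∂coordMeasure = inner ℝ hf.toLp (memLp_test_div ha hη).toLp := by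
  rw [inner_toLp, integral_weightedArea_eq]
  refine integral_congr_ae ?_
  filter_upwards [ae_coordMeasure_mem] with z hz
  have hp := wt_pos (a := a) hz
  field_simp

lemma isTest_mul_cos {η : ℝ × S1 → ℝ} (hη : IsTestFunction η) :
    IsTestFunction fun z => cos z.1 * η z := by
  obtain ⟨α, β, h1, h2, h3⟩ := hη.compactSupport
  exact ⟨(contDiff_cos.comp contDiff_fst).mul hη.smooth, α, β, h1, h2,
    fun z hz => h3 z (right_ne_zero_of_mul hz)⟩

/-- The weighted Sobolev space is complete: the weak derivatives pass to the limit. -/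
lemma exists_limit (ha : a < 1) {u : ℕ → WeightedH1 a} {f g h : WeightedL2 a}
    (h1 : Tendsto (fun n => (u n).valL2) atTop (𝓝 f))
    (h2 : Tendsto (fun n => (u n).thetaL2) atTop (𝓝 g))
    (h3 : Tendsto (fun n => (u n).phiL2) atTop (𝓝 h)) :
    ∃ v : WeightedH1 a, v.valL2 = f ∧ v.thetaL2 = g ∧ v.phiL2 = h := by
  have hh : (fun z => h z * cos z.1 / cos z.1) =ᵐ[weightedArea a] h := by
    filter_upwards [ae_weightedArea_iff.mpr ae_coordMeasure_mem] with z hz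
    have := (cos_pos_of_mem hz).ne'
    field_simp
  refine ⟨⟨f, g, fun z => h z * cos z.1, Lp.memLp f, Lp.memLp g, (Lp.memLp h).ae_eq hh.symm,
    fun η hη => ?_, fun η hη => ?_⟩, Lp.toLp_coeFn _ _, Lp.toLp_coeFn _ _, ?_⟩
  · rw [integral_mul_test ha hη.partialTheta_isTest (Lp.memLp f),
      integral_mul_test ha hη (Lp.memLp g), Lp.toLp_coeFn, Lp.toLp_coeFn]
    refine tendsto_nhds_unique (h1.inner (tendsto_const_nhds (x :=
      (memLp_test_div ha hη.partialTheta_isTest).toLp)))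
      (((h2.inner (tendsto_const_nhds (x := (memLp_test_div ha hη).toLp))).neg).congr fun n => ?_)
    rw [valL2, thetaL2, ← integral_mul_test ha hη.partialTheta_isTest,
      ← integral_mul_test ha hη, (u n).weak_dTheta η hη]
  · have e : ∀ k : ℝ × S1 → ℝ, ∫ z, k z * cos z.1 * η z ∂coordMeasure =
        ∫ z, k z * (cos z.1 * η z) ∂coordMeasure := fun k => by simp_rw [mul_assoc]
    rw [e, integral_mul_test ha hη.partialPhi_isTest (Lp.memLp f),
      integral_mul_test ha (isTest_mul_cos hη) (Lp.memLp h), Lp.toLp_coeFn, Lp.toLp_coeFn]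
    refine tendsto_nhds_unique (h1.inner (tendsto_const_nhds (x :=
      (memLp_test_div ha hη.partialPhi_isTest).toLp)))
      (((h3.inner (tendsto_const_nhds (x :=
        (memLp_test_div ha (isTest_mul_cos hη)).toLp))).neg).congr fun n => ?_)
    rw [valL2, phiL2, ← integral_mul_test ha hη.partialPhi_isTest,
      ← integral_mul_test ha (isTest_mul_cos hη), (u n).weak_dPhi η hη]
    congr 1
    refine integral_congr_ae ?_
    filter_upwards [ae_coordMeasure_mem] with z hz
    have := (cos_pos_of_mem hz).ne'
    field_simp
  · refine (MemLp.toLp_congr _ (Lp.memLp h) hh).trans (Lp.toLp_coeFn _ _)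

lemma normSq_val_sub (u v : WeightedH1 a) :
    normSq a (fun z => u.fn z - v.fn z) = ENNReal.ofReal (‖u.valL2 - v.valL2‖ ^ 2) := by
  rw [valL2, valL2, ← MemLp.toLp_sub, ← normSq_eq_norm_toLp]; rfl

lemma normSq_theta_sub (u v : WeightedH1 a) :
    normSq a (fun z => u.dTheta z - v.dTheta z) = ENNReal.ofReal (‖u.thetaL2 - v.thetaL2‖ ^ 2) := by
  rw [thetaL2, thetaL2, ← MemLp.toLp_sub, ← normSq_eq_norm_toLp]; rfl

lemma tendsto_ofReal_norm_sub_sq {E : Type*} [NormedAddCommGroup E] {x : ℕ → E} {y : E}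
    (h : Tendsto x atTop (𝓝 y)) :
    Tendsto (fun n => ENNReal.ofReal (‖x n - y‖ ^ 2)) atTop (𝓝 0) := by
  have h1 := (tendsto_iff_norm_sub_tendsto_zero.mp h).pow 2
  simpa using ENNReal.tendsto_ofReal h1

lemma VanishesOff.of_tendsto (ha : -1 < a) (ha' : a < 1) {ω : Set S1} (hω : MeasurableSet ω)
    {u : ℕ → WeightedH1 a} {v : WeightedH1 a} (hu : ∀ n, (u n).VanishesOff ω)
    (h1 : Tendsto (fun n => (u n).valL2) atTop (𝓝 v.valL2))
    (h2 : Tendsto (fun n => (u n).thetaL2) atTop (𝓝 v.thetaL2)) : v.VanishesOff ω := by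
  refine vanishesOff_of_tendsto ha ha' hω hu ?_ ?_
  · simp_rw [normSq_val_sub]; exact tendsto_ofReal_norm_sub_sq h1
  · simp_rw [normSq_theta_sub]; exact tendsto_ofReal_norm_sub_sq h2

/-- The embedding of the weighted Sobolev space into `L²(y^a dS)` is compact. -/
lemma exists_subseq_tendsto (ha : -1 < a) (ha' : a < 1) (u : ℕ → WeightedH1 a) {R : ℝ}
    (h1 : ∀ n, ‖(u n).valL2‖ ≤ R) (h2 : ∀ n, ‖(u n).thetaL2‖ ≤ R) (h3 : ∀ n, ‖(u n).phiL2‖ ≤ R) :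
    ∃ φ : ℕ → ℕ, StrictMono φ ∧ ∃ f, Tendsto (fun n => (u (φ n)).valL2) atTop (𝓝 f) := by
  have hb : ∀ {x : WeightedL2 a}, ‖x‖ ≤ R → ENNReal.ofReal (‖x‖ ^ 2) ≤ ENNReal.ofReal (R ^ 2) :=
    fun h => ENNReal.ofReal_le_ofReal (by gcongr)
  obtain ⟨φ, hφ, H⟩ := exists_subseq_cauchy ha ha' u (B := ENNReal.ofReal (R ^ 2))
    ENNReal.ofReal_ne_top
    (fun n => (normSq_eq_norm_toLp (u n).memLp_fn).trans_le (hb (h1 n)))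
    (fun n => (normSq_eq_norm_toLp (u n).memLp_dTheta).trans_le (hb (h2 n)))
    (fun n => (normSq_eq_norm_toLp (u n).memLp_dPhi).trans_le (hb (h3 n)))
  refine ⟨φ, hφ, cauchySeq_tendsto_of_complete ?_⟩
  simp_rw [normSq_val_sub] at H
  rw [cauchySeq_iff_tendsto_dist_atTop_0]
  have h4 := (ENNReal.continuousAt_toReal ENNReal.zero_ne_top).tendsto.comp H
  rw [ENNReal.toReal_zero] at h4
  have h5 := (continuous_sqrt.tendsto 0).comp h4
  rw [Real.sqrt_zero] at h5
  refine h5.congr fun p => ?_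
  simp only [Function.comp_apply]
  rw [ENNReal.toReal_ofReal (by positivity), Real.sqrt_sq (norm_nonneg _), dist_eq_norm]

end WeightedH1

/-! ### Existence and properties of minimizers -/

lemma norm_toLp_le_of_ae_le {a : ℝ} {f g : ℝ × S1 → ℝ} (hf : MemLp f 2 (weightedArea a))
    (hg : MemLp g 2 (weightedArea a)) (h : ∀ᵐ z ∂coordMeasure, |f z| ≤ |g z|) :
    ‖hf.toLp f‖ ≤ ‖hg.toLp g‖ := by
  rw [Lp.norm_toLp, Lp.norm_toLp]
  exact ENNReal.toReal_mono hg.2.ne (eLpNorm_mono_ae (ae_weightedArea_iff.mpr h))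

lemma abs_sign_mul_le {c x y : ℝ} (h : |c| ≤ 1) : |c * (Real.sign x * y)| ≤ |y| := by
  rw [abs_mul, abs_mul, ← mul_assoc]
  exact mul_le_of_le_one_left (abs_nonneg _)
    (mul_le_one₀ h (abs_nonneg _) (abs_realSign_le x))

namespace WeightedH1

variable {a : ℝ}

/-- Multiplying `|u|` by a sign that is constant on the two half circles does not increase the
energy, provided that the result is again weakly differentiable. -/
lemma exists_halfSign_abs_energy_le (ha : a < 1) {u : WeightedH1 a} (hu : u.IsMeasurable)
    {c₁ c₂ : ℝ} (h₁ : |c₁| = 1) (h₂ : |c₂| = 1)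
    (H : c₁ = c₂ ∨ ∀ᵐ z ∂coordMeasure, u.fn (z.1, -z.2) = -u.fn z) :
    ∃ v : WeightedH1 a, v.IsMeasurable ∧ v.fn = (fun z => halfSign c₁ c₂ z.2 * |u.fn z|) ∧
      v.dTheta = (fun z => halfSign c₁ c₂ z.2 * (Real.sign (u.fn z) * u.dTheta z)) ∧
      v.dPhi = (fun z => halfSign c₁ c₂ z.2 * (Real.sign (u.fn z) * u.dPhi z)) ∧
      ‖v.valL2‖ = ‖u.valL2‖ ∧ ‖v.thetaL2‖ ≤ ‖u.thetaL2‖ ∧ ‖v.phiL2‖ ≤ ‖u.phiL2‖ := by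
  obtain ⟨v, e1, e2, e3⟩ := exists_halfSign_abs ha hu h₁.le h₂.le H
  have hh : ∀ x, |halfSign c₁ c₂ x| = 1 := fun x => by
    unfold halfSign; split_ifs <;> assumption
  have hm := measurable_halfSign c₁ c₂
  have hs := measurable_realSign
  have m1 := hu.fn; have m2 := hu.dTheta; have m3 := hu.dPhi
  have hv : ∀ z, |v.fn z| = |u.fn z| := fun z => by rw [e1]; simp [abs_mul, hh]
  refine ⟨v, ⟨?_, ?_, ?_⟩, e1, e2, e3, le_antisymm ?_ ?_, ?_, ?_⟩
  · rw [e1]; exact (hm.comp measurable_snd).mul m1.norm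
  · rw [e2]; exact (hm.comp measurable_snd).mul ((hs.comp m1).mul m2)
  · rw [e3]; exact (hm.comp measurable_snd).mul ((hs.comp m1).mul m3)
  · exact norm_toLp_le_of_ae_le _ _ (Eventually.of_forall fun z => (hv z).le)
  · exact norm_toLp_le_of_ae_le _ _ (Eventually.of_forall fun z => (hv z).ge)
  · refine norm_toLp_le_of_ae_le _ _ (Eventually.of_forall fun z => ?_)
    rw [e2]; exact abs_sign_mul_le (hh z.2).le
  · refine norm_toLp_le_of_ae_le _ _ (Eventually.of_forall fun z => ?_)
    rw [e3, abs_div, abs_div]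
    exact div_le_div_of_nonneg_right (abs_sign_mul_le (hh z.2).le) (abs_nonneg _)

lemma exists_abs (ha : a < 1) (u : WeightedH1 a) :
    ∃ v : WeightedH1 a, v.IsMeasurable ∧ (v.fn =ᵐ[coordMeasure] fun z => |u.fn z|) ∧
      ‖v.valL2‖ = ‖u.valL2‖ ∧ (∀ κ, energyK κ v v ≤ energyK κ u u) ∧
      ∀ ω, u.VanishesOff ω → v.VanishesOff ω := by
  obtain ⟨u', hu', e⟩ := u.exists_measurable
  obtain ⟨v, hv, e1, -, -, n1, n2, n3⟩ :=
    exists_halfSign_abs_energy_le ha hu' (c₁ := 1) (c₂ := 1) (by simp) (by simp) (Or.inl rfl)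
  refine ⟨v, hv, ?_, by rw [n1, e.valL2], fun κ => ?_, fun ω h => ?_⟩
  · rw [e1]
    filter_upwards [e.fn] with z hz
    simp [halfSign, hz]
  · rw [e.energyK_self, energyK_self, energyK_self]
    gcongr
  · obtain ⟨g, hg, h0⟩ := h
    have := (hg.congr e.fn).halfSign_abs hu'.fn (c₁ := 1) (c₂ := 1) (by simp) (by simp)
    rw [← e1] at this
    exact ⟨_, this, h0.mono fun x hx hn => by simp [hx hn]⟩

/-- The parallelogram identity for the energy: if `l` bounds the quotient of the sum `u + v` from
below, then two functions whose quotients are close to `l` and which are close in `L²` have close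
gradients. -/
lemma energyK_sub_le (ha : a < 1) {κ l : ℝ} {u v : WeightedH1 a}
    (h : l * (lin ha 1 1 u v).massForm (lin ha 1 1 u v) ≤
      energyK κ (lin ha 1 1 u v) (lin ha 1 1 u v)) :
    energyK κ (lin ha 1 (-1) u v) (lin ha 1 (-1) u v) ≤
      2 * (energyK κ u u - l * u.massForm u) + 2 * (energyK κ v v - l * v.massForm v) +
        l * ‖u.valL2 - v.valL2‖ ^ 2 := by
  have e : ‖u.valL2 - v.valL2‖ ^ 2 =
      (lin ha 1 (-1) u v).massForm (lin ha 1 (-1) u v) := by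
    rw [massForm_self, lin_valL2]; simp [sub_eq_add_neg]
  rw [e]
  simp only [energyK_lin_self, massForm_lin_self] at h ⊢
  linarith

/-- The quotient whose infimum is the first eigenvalue of the form `energyK κ`. -/
def quotientK (κ : ℝ) (u : WeightedH1 a) : ℝ := energyK κ u u / u.massForm u

lemma quotientK_nonneg (κ : ℝ) (u : WeightedH1 a) : 0 ≤ quotientK κ u :=
  div_nonneg (energyK_self_nonneg κ u) (by rw [massForm_self]; positivity)

lemma rayleigh_eq (u : WeightedH1 a) : u.rayleigh = quotientK 1 u := by
  rw [rayleigh, quotientK, energyForm_eq]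

end WeightedH1

open WeightedH1

variable {a : ℝ}

/-- The first eigenvalue of the form `energyK κ` on the functions that vanish off `ω`. -/
def eigK (a κ : ℝ) (ω : Set S1) : ℝ :=
  sInf (quotientK κ '' {u : WeightedH1 a | u.IsNonzero ∧ u.VanishesOff ω})

lemma eigK_le {κ : ℝ} {ω : Set S1} {u : WeightedH1 a} (h0 : u.IsNonzero) (hu : u.VanishesOff ω) :
    eigK a κ ω ≤ quotientK κ u :=
  csInf_le ⟨0, by rintro _ ⟨v, -, rfl⟩; exact quotientK_nonneg κ v⟩ ⟨u, ⟨h0, hu⟩, rfl⟩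

lemma eigK_nonneg (a κ : ℝ) (ω : Set S1) : 0 ≤ eigK a κ ω :=
  Real.sInf_nonneg (by rintro _ ⟨v, -, rfl⟩; exact quotientK_nonneg κ v)

lemma eigK_mul_le {κ : ℝ} {ω : Set S1} {u : WeightedH1 a} (hu : u.VanishesOff ω) :
    eigK a κ ω * u.massForm u ≤ energyK κ u u := by
  by_cases h : u.IsNonzero
  · have := eigK_le (κ := κ) h hu
    rwa [quotientK, le_div_iff₀ h.massForm_pos] at this
  · rw [massForm_self, valL2_eq_zero h]
    simpa using energyK_self_nonneg κ u

lemma exists_normalized (ha' : a < 1) {κ : ℝ} {ω : Set S1} {u : WeightedH1 a} (h0 : u.IsNonzero)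
    (hu : u.VanishesOff ω) :
    ∃ v : WeightedH1 a, v.VanishesOff ω ∧ ‖v.valL2‖ = 1 ∧ energyK κ v v = quotientK κ u := by
  have hm := h0.massForm_pos
  refine ⟨lin ha' (√(u.massForm u))⁻¹ 0 u u, hu.lin ha' hu _ _, ?_, ?_⟩
  · have : ‖(lin ha' (√(u.massForm u))⁻¹ 0 u u).valL2‖ ^ 2 = 1 := by
      rw [← massForm_self, massForm_lin_self, inv_pow, Real.sq_sqrt hm.le]
      field_simp; ring
    exact (pow_eq_one_iff_of_nonneg (norm_nonneg _) two_ne_zero).mp this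
  · rw [energyK_lin_self, inv_pow, Real.sq_sqrt hm.le, quotientK]
    field_simp; ring

lemma isNonzero_of_norm_eq_one {u : WeightedH1 a} (h : ‖u.valL2‖ = 1) : u.IsNonzero := by
  rw [isNonzero_iff]; intro h0; simp [h0] at h

/-- If the energy of the differences is bounded by a multiple of their mass up to a null sequence, then
a bounded sequence has a subsequence that converges with its gradient. -/
lemma exists_limit_of_energyK_le (ha : -1 < a) (ha' : a < 1) {κ R : ℝ} (hκ : 1 ≤ κ)
    {u : ℕ → WeightedH1 a} (h1 : ∀ n, ‖(u n).valL2‖ ≤ R)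
    (h2 : ∀ n, energyK κ (u n) (u n) ≤ R ^ 2) (hR : 0 ≤ R) {l : ℝ} {e : ℕ × ℕ → ℝ}
    (he : Tendsto e atTop (𝓝 0)) (hle : ∀ n m, n ≤ m →
      energyK κ (lin ha' 1 (-1) (u n) (u m)) (lin ha' 1 (-1) (u n) (u m)) ≤
        e (n, m) + l * ‖(u n).valL2 - (u m).valL2‖ ^ 2) :
    ∃ φ : ℕ → ℕ, StrictMono φ ∧ ∃ v : WeightedH1 a,
      Tendsto (fun n => (u (φ n)).valL2) atTop (𝓝 v.valL2) ∧
      Tendsto (fun n => (u (φ n)).thetaL2) atTop (𝓝 v.thetaL2) ∧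
      Tendsto (fun n => (u (φ n)).phiL2) atTop (𝓝 v.phiL2) := by
  have key : ∀ w : WeightedH1 a, ‖w.thetaL2‖ ^ 2 ≤ energyK κ w w ∧
      ‖w.phiL2‖ ^ 2 ≤ energyK κ w w := fun w => by
    rw [energyK_self]
    have : ‖w.phiL2‖ ^ 2 ≤ κ ^ 2 * ‖w.phiL2‖ ^ 2 :=
      le_mul_of_one_le_left (by positivity) (one_le_pow₀ hκ)
    constructor
    · have : 0 ≤ κ ^ 2 * ‖w.phiL2‖ ^ 2 := by positivity
      linarith
    · have : 0 ≤ ‖w.thetaL2‖ ^ 2 := by positivity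
      linarith
  obtain ⟨φ, hφ, f, hf⟩ := WeightedH1.exists_subseq_tendsto ha ha' u h1
    (fun n => le_of_sq_le_sq ((key _).1.trans (h2 n)) hR)
    (fun n => le_of_sq_le_sq ((key _).2.trans (h2 n)) hR)
  have cauchy : ∀ x : ℕ → WeightedL2 a, (∀ n m, n ≤ m → ‖x n - x m‖ ^ 2 ≤
      e (φ n, φ m) + l * ‖(u (φ n)).valL2 - (u (φ m)).valL2‖ ^ 2) → ∃ y, Tendsto x atTop (𝓝 y) := by
    intro x hx
    refine cauchySeq_tendsto_of_complete ?_
    have t1 : Tendsto (fun p : ℕ × ℕ => e (φ p.1, φ p.2) +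
        l * ‖(u (φ p.1)).valL2 - (u (φ p.2)).valL2‖ ^ 2) atTop (𝓝 0) := by
      have s1 : Tendsto (fun p : ℕ × ℕ => (φ p.1, φ p.2)) atTop atTop := by
        rw [← prod_atTop_atTop_eq]
        exact hφ.tendsto_atTop.prodMap hφ.tendsto_atTop
      have s2 := cauchySeq_iff_tendsto_dist_atTop_0.mp hf.cauchySeq
      simp_rw [dist_eq_norm] at s2
      simpa using (he.comp s1).add ((s2.pow 2).const_mul l)
    rw [Metric.cauchySeq_iff']
    intro ε hε
    obtain ⟨⟨N, M⟩, hN⟩ := eventually_atTop.mp (t1.eventually_lt_const (pow_pos hε 2))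
    refine ⟨max N M, fun n hn => ?_⟩
    have h5 := hN (max N M, n) ⟨le_max_left _ _, (le_max_right _ _).trans hn⟩
    rw [dist_comm, dist_eq_norm]
    exact lt_of_pow_lt_pow_left₀ 2 hε.le ((hx _ _ hn).trans_lt h5)
  obtain ⟨g, hg⟩ := cauchy (fun n => (u (φ n)).thetaL2) fun n m hnm => by
    have := (key _).1.trans (hle (φ n) (φ m) (hφ.monotone hnm))
    rwa [lin_thetaL2, one_smul, neg_one_smul, ← sub_eq_add_neg] at this
  obtain ⟨h, hh⟩ := cauchy (fun n => (u (φ n)).phiL2) fun n m hnm => by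
    have := (key _).2.trans (hle (φ n) (φ m) (hφ.monotone hnm))
    rwa [lin_phiL2, one_smul, neg_one_smul, ← sub_eq_add_neg] at this
  obtain ⟨v, rfl, rfl, rfl⟩ := WeightedH1.exists_limit ha' hf hg hh
  exact ⟨φ, hφ, v, hf, hg, hh⟩

lemma tendsto_energyK {κ : ℝ} {u : ℕ → WeightedH1 a} {v : WeightedH1 a}
    (h1 : Tendsto (fun n => (u n).thetaL2) atTop (𝓝 v.thetaL2))
    (h2 : Tendsto (fun n => (u n).phiL2) atTop (𝓝 v.phiL2)) :
    Tendsto (fun n => energyK κ (u n) (u n)) atTop (𝓝 (energyK κ v v)) := by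
  simp_rw [energyK_self]
  exact (h1.norm.pow 2).add ((h2.norm.pow 2).const_mul _)

/-- The first eigenvalue is attained, by a nonnegative function. -/
theorem exists_minimizer (ha : -1 < a) (ha' : a < 1) {κ : ℝ} (hκ : 1 ≤ κ) {ω : Set S1}
    (hω : MeasurableSet ω) (hne : ∃ u : WeightedH1 a, u.IsNonzero ∧ u.VanishesOff ω) :
    ∃ u : WeightedH1 a, u.IsMeasurable ∧ u.VanishesOff ω ∧ u.Nonneg ∧ ‖u.valL2‖ = 1 ∧
      energyK κ u u = eigK a κ ω := by
  have h1 : ∀ n : ℕ, ∃ v : WeightedH1 a, v.VanishesOff ω ∧ ‖v.valL2‖ = 1 ∧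
      energyK κ v v < eigK a κ ω + 1 / ((n : ℝ) + 1) := fun n => by
    obtain ⟨_, ⟨u, ⟨h0, hu⟩, rfl⟩, hlt⟩ := Real.lt_sInf_add_pos
      (s := quotientK κ '' {u : WeightedH1 a | u.IsNonzero ∧ u.VanishesOff ω})
      (by obtain ⟨u, hu⟩ := hne; exact ⟨_, u, hu, rfl⟩) (Nat.one_div_pos_of_nat (α := ℝ) (n := n))
    obtain ⟨v, hv, hv1, hv2⟩ := exists_normalized ha' (κ := κ) h0 hu
    exact ⟨v, hv, hv1, hv2 ▸ hlt⟩
  choose u hu hu1 hu2 using h1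
  set l := eigK a κ ω with hl
  have hl0 : 0 ≤ l := eigK_nonneg a κ ω
  have hone : ∀ n : ℕ, 1 / ((n : ℝ) + 1) ≤ 1 := fun n => by
    rw [div_le_one (by positivity)]; linarith [Nat.cast_nonneg (α := ℝ) n]
  have ht := tendsto_one_div_add_atTop_nhds_zero_nat (𝕜 := ℝ)
  obtain ⟨φ, hφ, v, l1, l2, l3⟩ := exists_limit_of_energyK_le ha ha' hκ (u := u) (R := l + 1)
    (fun n => by rw [hu1]; linarith) (fun n => by have := hu2 n; have := hone n; nlinarith)
    (by positivity) (l := l)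
    (e := fun p => 2 * (1 / ((p.1 : ℝ) + 1)) + 2 * (1 / ((p.2 : ℝ) + 1)))
    (by
      rw [← prod_atTop_atTop_eq]
      simpa using ((ht.comp tendsto_fst).const_mul 2).add ((ht.comp tendsto_snd).const_mul 2))
    (fun n m _ => by
      refine (energyK_sub_le ha' (eigK_mul_le ((hu n).lin ha' (hu m) 1 1))).trans ?_
      rw [massForm_self, massForm_self, hu1, hu1]
      have := hu2 n; have := hu2 m
      simp only [← hl]
      linarith)
  have hv : v.VanishesOff ω := VanishesOff.of_tendsto ha ha' hω (fun n => hu (φ n)) l1 l2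
  have hv1 : ‖v.valL2‖ = 1 :=
    tendsto_nhds_unique l1.norm (tendsto_const_nhds.congr fun n => (hu1 (φ n)).symm)
  have hv2 : energyK κ v v ≤ l := by
    have h3 := ((ht.const_add l).comp hφ.tendsto_atTop)
    rw [add_zero] at h3
    exact le_of_tendsto_of_tendsto' (tendsto_energyK l2 l3) h3 fun n => (hu2 (φ n)).le
  obtain ⟨w, hw, e1, n1, n2, n3⟩ := exists_abs ha' v
  refine ⟨w, hw, n3 ω hv, ?_, n1.trans hv1, le_antisymm ((n2 κ).trans hv2) ?_⟩
  · filter_upwards [ae_weightedArea_iff.mpr e1] with z hz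
    rw [hz]; exact abs_nonneg _
  · have := eigK_mul_le (κ := κ) (n3 ω hv)
    rwa [massForm_self, n1, hv1, one_pow, mul_one] at this

/-- The Euler–Lagrange equation of a minimizer. -/
lemma energyK_eq_of_minimizer (ha' : a < 1) {κ : ℝ} {ω : Set S1} {u v : WeightedH1 a}
    (hu : u.VanishesOff ω) (hmin : energyK κ u u = eigK a κ ω * u.massForm u)
    (hv : v.VanishesOff ω) : energyK κ u v = eigK a κ ω * u.massForm v := by
  have h : ∀ t : ℝ, 0 ≤ (energyK κ v v - eigK a κ ω * v.massForm v) * (t * t) +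
      2 * (energyK κ u v - eigK a κ ω * u.massForm v) * t + 0 := fun t => by
    have h1 := eigK_mul_le (κ := κ) (hu.lin ha' hv 1 t)
    rw [energyK_lin_self, massForm_lin_self] at h1
    nlinarith
  have h2 := discrim_le_zero h
  rw [discrim] at h2
  have h3 : energyK κ u v - eigK a κ ω * u.massForm v = 0 := by
    have : (energyK κ u v - eigK a κ ω * u.massForm v) ^ 2 ≤ 0 := by linarith
    exact pow_eq_zero_iff two_ne_zero |>.mp (le_antisymm this (sq_nonneg _))
  linarith

/-! ### The `k`-fold covering of the circle -/

lemma measurePreserving_ang :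
    MeasurePreserving ang volume ((volume : Measure ℝ).restrict (Ioc 0 (2 * π))) := by
  have h := AddCircle.measurePreserving_mk (2 * π) 0
  rw [zero_add] at h
  refine ⟨measurable_ang, ?_⟩
  rw [← h.map_eq, Measure.map_map measurable_ang h.measurable]
  conv_rhs => rw [← Measure.map_id (μ := (volume : Measure ℝ).restrict (Ioc 0 (2 * π)))]
  refine Measure.map_congr ?_
  filter_upwards [ae_restrict_mem measurableSet_Ioc] with p hp
  exact ang_coe hp

/-- The branches of the inverse of the `k`-fold covering `x ↦ k • x` of the circle. -/
def branch (k j : ℕ) (y : S1) : S1 := (((ang y + 2 * π * j) / k : ℝ) : S1)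

lemma measurable_branch (k j : ℕ) : Measurable (branch k j) := by
  have h : Measurable fun p : ℝ => (p : S1) := (AddCircle.continuous_mk' _).measurable
  exact h.comp ((measurable_ang.add_const _).div_const _)

lemma nsmul_branch {k : ℕ} (hk : 0 < k) (j : ℕ) (y : S1) : k • branch k j y = y := by
  have hk' : (k : ℝ) ≠ 0 := by exact_mod_cast hk.ne'
  rw [branch, ← AddCircle.coe_nsmul, nsmul_eq_mul, mul_div_cancel₀ _ hk', mul_comm (2 * π) (j : ℝ),
    AddCircle.coe_add, coe_ang, ← nsmul_eq_mul, AddCircle.coe_nsmul, AddCircle.coe_period,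
    smul_zero, add_zero]

/-- The `j`-th branch maps the circle onto the `j`-th of `k` equal arcs, contracting lengths by the
factor `k`. -/
lemma map_branch {k j : ℕ} (hj : j < k) :
    (volume : Measure S1).map (branch k j) =
      (k : ℝ≥0∞) • (volume : Measure S1).restrict (arcPiece k j) := by
  have hk : (0 : ℝ) < k := by exact_mod_cast (Nat.zero_le _).trans_lt hj
  have hc : Measurable fun p : ℝ => (p : S1) := (AddCircle.continuous_mk' _).measurable
  have he : Measurable fun p : ℝ => (p + 2 * π * j) / k := by fun_prop
  have h1 : (volume : Measure ℝ).map (fun p : ℝ => (p + 2 * π * j) / k) =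
      (k : ℝ≥0∞) • (volume : Measure ℝ) := by
    have := Real.map_volume_mul_right (a := (k : ℝ)⁻¹) (by positivity)
    rw [inv_inv, abs_of_pos hk, ENNReal.ofReal_natCast] at this
    rw [← this]
    conv_rhs => rw [← map_add_right_eq_self (volume : Measure ℝ) (2 * π * j)]
    rw [Measure.map_map (by fun_prop) (by fun_prop)]
    rfl
  have h2 : (fun p : ℝ => (p + 2 * π * j) / k) ⁻¹' Ioc (2 * π / k * j) (2 * π / k * (j + 1)) =
      Ioc 0 (2 * π) := by
    refine Set.ext fun p => ?_
    simp only [mem_preimage, mem_Ioc]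
    rw [lt_div_iff₀ hk, div_le_iff₀ hk,
      show 2 * π / k * j * k = 2 * π * j by field_simp,
      show 2 * π / k * (j + 1) * k = 2 * π + 2 * π * j by field_simp; ring]
    constructor <;> rintro ⟨h, h'⟩ <;> constructor <;> linarith
  have h3 := Measure.restrict_map (μ := (volume : Measure ℝ)) he
    (measurableSet_Ioc (a := 2 * π / k * j) (b := 2 * π / k * (j + 1)))
  rw [h1, h2, Measure.restrict_smul] at h3
  have h4 : branch k j = (fun p : ℝ => (p : S1)) ∘ (fun p : ℝ => (p + 2 * π * j) / k) ∘ ang := rfl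
  rw [h4, ← Measure.map_map hc (he.comp measurable_ang), ← Measure.map_map he measurable_ang,
    measurePreserving_ang.map_eq, ← h3, Measure.map_smul, (measurePreserving_arcPiece hj).map_eq]

section Product

variable {ν : Measure ℝ} [SFinite ν]

lemma map_prod_branch {k j : ℕ} (hj : j < k) :
    (ν.prod (volume : Measure S1)).map (fun z => (z.1, branch k j z.2)) =
      (k : ℝ≥0∞) • (ν.prod (volume : Measure S1)).restrict (univ ×ˢ arcPiece k j) := by
  have h := Measure.map_prod_map ν (volume : Measure S1) measurable_id (measurable_branch k j)
  rw [Measure.map_id, map_branch hj, Measure.prod_smul_right] at h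
  rw [← Measure.prod_restrict, Measure.restrict_univ, h]
  rfl

lemma measurable_prod_branch (k j : ℕ) :
    Measurable fun z : ℝ × S1 => (z.1, branch k j z.2) :=
  measurable_fst.prodMk ((measurable_branch k j).comp measurable_snd)

lemma quasiMeasurePreserving_prod_branch {k j : ℕ} (hj : j < k) :
    Measure.QuasiMeasurePreserving (fun z : ℝ × S1 => (z.1, branch k j z.2))
      (ν.prod (volume : Measure S1)) (ν.prod (volume : Measure S1)) := by
  refine ⟨measurable_prod_branch k j, ?_⟩
  rw [map_prod_branch hj]
  exact (Measure.smul_absolutelyContinuous).trans Measure.restrict_le_self.absolutelyContinuous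

lemma map_prod_branch_le {k j : ℕ} (hj : j < k) :
    (ν.prod (volume : Measure S1)).map (fun z => (z.1, branch k j z.2)) ≤
      (k : ℝ≥0∞) • (ν.prod (volume : Measure S1)) := by
  rw [map_prod_branch hj]
  gcongr
  exact Measure.restrict_le_self

lemma integrable_comp_branch {k j : ℕ} (hj : j < k) {f : ℝ × S1 → ℝ}
    (hf : Integrable f (ν.prod (volume : Measure S1))) :
    Integrable (fun z => f (z.1, branch k j z.2)) (ν.prod (volume : Measure S1)) := by
  refine Integrable.comp_measurable (g := f) ?_ (measurable_prod_branch k j)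
  exact (hf.smul_measure (by simp)).mono_measure (map_prod_branch_le hj)

lemma memLp_comp_branch {k j : ℕ} (hj : j < k) {f : ℝ × S1 → ℝ}
    (hf : MemLp f 2 (ν.prod (volume : Measure S1))) :
    MemLp (fun z => f (z.1, branch k j z.2)) 2 (ν.prod (volume : Measure S1)) := by
  refine MemLp.comp_of_map (g := f) ?_ (measurable_prod_branch k j).aemeasurable
  exact hf.of_measure_le_smul (c := k) (by simp) (map_prod_branch_le hj)

end Product

/-- The average of a function over the fibres of the `k`-fold covering. -/
def fibreAvg (k : ℕ) (f : ℝ × S1 → ℝ) (z : ℝ × S1) : ℝ :=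
  (k : ℝ)⁻¹ * ∑ j ∈ Finset.range k, f (z.1, branch k j z.2)

/-- The pull-back of a function under the `k`-fold covering. -/
def cover (k : ℕ) (f : ℝ × S1 → ℝ) (z : ℝ × S1) : ℝ := f (z.1, k • z.2)

/-- The identity behind the duality of `fibreAvg` and `cover`. -/
lemma fibreAvg_mul_cover {k : ℕ} (hk : 0 < k) (f g : ℝ × S1 → ℝ) (z : ℝ × S1) :
    fibreAvg k (fun z => f z * cover k g z) z = fibreAvg k f z * g z := by
  simp only [fibreAvg, cover, nsmul_branch hk, ← Finset.sum_mul]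
  ring

lemma fibreAvg_cover {k : ℕ} (hk : 0 < k) (g : ℝ × S1 → ℝ) : fibreAvg k (cover k g) = g := by
  have hk' : (k : ℝ) ≠ 0 := by exact_mod_cast hk.ne'
  funext z
  simp [fibreAvg, cover, nsmul_branch hk, hk']

lemma fibreAvg_sq_le (k : ℕ) (f : ℝ × S1 → ℝ) (z : ℝ × S1) :
    fibreAvg k f z ^ 2 ≤ fibreAvg k (fun z => f z ^ 2) z := by
  rcases k.eq_zero_or_pos with rfl | hk
  · simp [fibreAvg]
  have hk' : (0 : ℝ) < k := by exact_mod_cast hk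
  have h := sq_sum_le_card_mul_sum_sq (s := Finset.range k)
    (f := fun j => f (z.1, branch k j z.2))
  rw [Finset.card_range] at h
  rw [fibreAvg, fibreAvg, mul_pow]
  calc _ ≤ ((k : ℝ)⁻¹) ^ 2 * (k * ∑ j ∈ Finset.range k, f (z.1, branch k j z.2) ^ 2) := by gcongr
    _ = _ := by field_simp

lemma integrable_fibreAvg {ν : Measure ℝ} [SFinite ν] (k : ℕ) {f : ℝ × S1 → ℝ}
    (hf : Integrable f (ν.prod (volume : Measure S1))) :
    Integrable (fibreAvg k f) (ν.prod (volume : Measure S1)) :=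
  (integrable_finsetSum _ fun _ hj =>
    integrable_comp_branch (Finset.mem_range.mp hj) hf).const_mul _

lemma memLp_fibreAvg {ν : Measure ℝ} [SFinite ν] (k : ℕ) {f : ℝ × S1 → ℝ}
    (hf : MemLp f 2 (ν.prod (volume : Measure S1))) :
    MemLp (fibreAvg k f) 2 (ν.prod (volume : Measure S1)) :=
  (memLp_finsetSum _ fun _ hj => memLp_comp_branch (Finset.mem_range.mp hj) hf).const_mul _

lemma integral_fibreAvg {ν : Measure ℝ} [SFinite ν] {k : ℕ} (hk : 0 < k) {f : ℝ × S1 → ℝ}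
    (hf : Integrable f (ν.prod (volume : Measure S1))) :
    ∫ z, fibreAvg k f z ∂ν.prod (volume : Measure S1) = ∫ z, f z ∂ν.prod (volume : Measure S1) := by
  have hk' : (k : ℝ) ≠ 0 := by exact_mod_cast hk.ne'
  set M := ν.prod (volume : Measure S1)
  have h1 : ∀ j ∈ Finset.range k, ∫ z, f (z.1, branch k j z.2) ∂M =
      k * ∫ z in univ ×ˢ arcPiece k j, f z ∂M := fun j hj => by
    have hj := Finset.mem_range.mp hj
    have hm : AEStronglyMeasurable f (M.map fun z => (z.1, branch k j z.2)) :=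
      hf.1.mono_ac (quasiMeasurePreserving_prod_branch hj).absolutelyContinuous
    rw [← integral_map (f := f) (measurable_prod_branch k j).aemeasurable hm, map_prod_branch hj,
      integral_smul_measure, ENNReal.toReal_natCast, smul_eq_mul]
  simp only [fibreAvg]
  rw [integral_const_mul, integral_finsetSum _ fun j hj =>
    integrable_comp_branch (Finset.mem_range.mp hj) hf, Finset.sum_congr rfl h1, ← Finset.mul_sum,
    inv_mul_cancel_left₀ hk', ← integral_biUnion_finset _
      (fun j _ => MeasurableSet.univ.prod (measurableSet_arcPiece k j))
      (fun i _ j _ hij => Set.Disjoint.set_prod_right (disjoint_arcPiece hk hij) _ _)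
      (fun _ _ => hf.integrableOn)]
  have : ⋃ j ∈ Finset.range k, (univ : Set ℝ) ×ˢ arcPiece k j = univ := by
    refine eq_univ_of_forall fun z => ?_
    have := (iUnion_arcPiece hk).symm ▸ mem_univ z.2
    simpa using this
  rw [this, setIntegral_univ]

lemma lintegral_fibreAvg_sq_le {ν : Measure ℝ} [SFinite ν] {k : ℕ} (hk : 0 < k) {f : ℝ × S1 → ℝ}
    (hf : AEStronglyMeasurable f (ν.prod (volume : Measure S1))) :
    ∫⁻ z, ‖fibreAvg k f z‖ₑ ^ 2 ∂ν.prod (volume : Measure S1) ≤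
      ∫⁻ z, ‖f z‖ₑ ^ 2 ∂ν.prod (volume : Measure S1) := by
  by_cases h : ∫⁻ z, ‖f z‖ₑ ^ 2 ∂ν.prod (volume : Measure S1) = ∞
  · rw [h]; exact le_top
  have hm := memLp_two_of_lintegral_lt_top hf (lt_top_iff_ne_top.mpr h)
  have hi := (memLp_two_iff_integrable_sq hm.1).mp hm
  have hi' := (memLp_two_iff_integrable_sq (memLp_fibreAvg k hm).1).mp (memLp_fibreAvg k hm)
  simp_rw [enorm_sq_eq_ofReal]
  rw [← ofReal_integral_eq_lintegral_ofReal hi' (Eventually.of_forall fun _ => sq_nonneg _),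
    ← ofReal_integral_eq_lintegral_ofReal hi (Eventually.of_forall fun _ => sq_nonneg _)]
  refine ENNReal.ofReal_le_ofReal ?_
  rw [← integral_fibreAvg hk hi]
  exact integral_mono hi' (integrable_fibreAvg k hi) fun z => fibreAvg_sq_le k f z

lemma measurePreserving_nsmul {k : ℕ} (hk : 0 < k) :
    MeasurePreserving (fun y : S1 => k • y) volume volume := by
  have := Measure.measurePreserving_zsmul (volume : Measure S1) (n := (k : ℤ))
    (by exact_mod_cast hk.ne')
  simpa using this

lemma measurePreserving_cover {ν : Measure ℝ} [SFinite ν] {k : ℕ} (hk : 0 < k) :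
    MeasurePreserving (fun z : ℝ × S1 => (z.1, k • z.2)) (ν.prod (volume : Measure S1))
      (ν.prod (volume : Measure S1)) :=
  (MeasurePreserving.id ν).prod (measurePreserving_nsmul hk)

lemma exists_eq_ang_add (p : ℝ) : ∃ n : ℤ, p = ang (p : S1) + n * (2 * π) := by
  have h : ((p - ang (p : S1) : ℝ) : S1) = 0 := by
    rw [AddCircle.coe_sub, coe_ang, sub_self]
  obtain ⟨n, hn⟩ := (AddCircle.coe_eq_zero_iff (2 * π)).mp h
  exact ⟨n, by rw [zsmul_eq_mul] at hn; linarith⟩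

/-- On the real line the average over the fibres has a formula without the representative `ang`; in
particular the average of a smooth function is smooth. -/
lemma fibreAvg_coe {k : ℕ} (hk : 0 < k) (f : ℝ × S1 → ℝ) (θ p : ℝ) :
    fibreAvg k f (θ, (p : S1)) =
      (k : ℝ)⁻¹ * ∑ j ∈ Finset.range k, f (θ, (((p + 2 * π * j) / k : ℝ) : S1)) := by
  have hk' : (k : ℝ) ≠ 0 := by exact_mod_cast hk.ne'
  set G : ℝ → ℝ := fun p => ∑ j ∈ Finset.range k, f (θ, (((p + 2 * π * j) / k : ℝ) : S1)) with hG
  have hper : Function.Periodic G (2 * π) := fun p => by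
    have e1 : G (p + 2 * π) =
        ∑ j ∈ Finset.range k, f (θ, (((p + 2 * π * ((j + 1 : ℕ) : ℝ)) / k : ℝ) : S1)) := by
      refine Finset.sum_congr rfl fun j _ => ?_
      congr 3
      push_cast
      ring
    have e2 : ((p + 2 * π * (k : ℝ)) / k : ℝ) = (p + 2 * π * ((0 : ℕ) : ℝ)) / k + 2 * π := by
      field_simp; push_cast; ring
    have h1 := Finset.sum_range_succ
      (fun j : ℕ => f (θ, (((p + 2 * π * (j : ℝ)) / k : ℝ) : S1))) k
    rw [Finset.sum_range_succ', e2, AddCircle.coe_add, AddCircle.coe_period, add_zero] at h1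
    rw [e1]
    exact add_right_cancel h1
  obtain ⟨n, hn⟩ := exists_eq_ang_add p
  have h2 : G p = G (ang (p : S1)) := by
    conv_lhs => rw [hn]
    exact hper.int_mul n _
  change (k : ℝ)⁻¹ * G (ang (p : S1)) = (k : ℝ)⁻¹ * G p
  rw [h2]

lemma cover_coe (k : ℕ) (f : ℝ × S1 → ℝ) (θ p : ℝ) :
    cover k f (θ, (p : S1)) = f (θ, ((k * p : ℝ) : S1)) := by
  rw [cover, ← AddCircle.coe_nsmul, nsmul_eq_mul]

namespace IsTestFunction

variable {η : ℝ × S1 → ℝ} {k : ℕ}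

lemma cover (h : IsTestFunction η) (k : ℕ) : IsTestFunction (cover k η) := by
  obtain ⟨α, β, h1, h2, h3⟩ := h.compactSupport
  refine ⟨?_, α, β, h1, h2, fun z hz => h3 (z.1, k • z.2) hz⟩
  have e : (fun p : ℝ × ℝ => HemisphereEigenvalue.cover k η (p.1, (p.2 : S1))) =
      (fun p : ℝ × ℝ => η (p.1, (p.2 : S1))) ∘ fun p => (p.1, k * p.2) := by
    funext p
    exact cover_coe k η p.1 p.2
  rw [e]
  exact h.smooth.comp (by fun_prop)

lemma fibreAvg (h : IsTestFunction η) (hk : 0 < k) : IsTestFunction (fibreAvg k η) := by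
  obtain ⟨α, β, h1, h2, h3⟩ := h.compactSupport
  refine ⟨?_, α, β, h1, h2, fun z hz => ?_⟩
  · simp_rw [fibreAvg_coe hk]
    refine contDiff_const.mul (ContDiff.sum fun j _ => ?_)
    exact h.smooth.comp (g := fun p : ℝ × ℝ => η (p.1, (p.2 : S1)))
      (f := fun p : ℝ × ℝ => (p.1, (p.2 + 2 * π * j) / k)) (by fun_prop)
  · obtain ⟨j, -, hj⟩ := Finset.exists_ne_zero_of_sum_ne_zero (right_ne_zero_of_mul hz)
    exact h3 (z.1, branch k j z.2) hj

lemma partialPhi_cover (h : IsTestFunction η) (k : ℕ) (z : ℝ × S1) :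
    partialPhi (HemisphereEigenvalue.cover k η) z =
      k * HemisphereEigenvalue.cover k (partialPhi η) z := by
  obtain ⟨θ, x⟩ := z
  obtain ⟨p, rfl⟩ := QuotientAddGroup.mk_surjective x
  have h1 := (h.cover k).hasDerivAt_phi θ p
  have h2 := (h.hasDerivAt_phi θ (k * p)).comp p ((hasDerivAt_id p).const_mul (k : ℝ))
  have h3 := h1.unique (h2.congr_of_eventuallyEq (Eventually.of_forall fun t => cover_coe k η θ t))
  refine h3.trans ?_
  rw [mul_one, mul_comm]
  exact congrArg ((k : ℝ) * ·) (cover_coe k (partialPhi η) θ p).symm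

lemma partialTheta_fibreAvg (h : IsTestFunction η) (k : ℕ) :
    partialTheta (HemisphereEigenvalue.fibreAvg k η) =
      HemisphereEigenvalue.fibreAvg k (partialTheta η) := by
  funext z
  exact ((HasDerivAt.fun_sum fun j _ =>
    h.hasDerivAt_theta z.1 (branch k j z.2)).const_mul (k : ℝ)⁻¹).deriv

lemma partialPhi_fibreAvg (h : IsTestFunction η) (hk : 0 < k) (z : ℝ × S1) :
    partialPhi (HemisphereEigenvalue.fibreAvg k η) z =
      (k : ℝ)⁻¹ * HemisphereEigenvalue.fibreAvg k (partialPhi η) z := by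
  obtain ⟨θ, x⟩ := z
  obtain ⟨p, rfl⟩ := QuotientAddGroup.mk_surjective x
  have h1 := (h.fibreAvg hk).hasDerivAt_phi θ p
  have h2 := (HasDerivAt.fun_sum (u := Finset.range k) fun j _ =>
    (h.hasDerivAt_phi θ ((p + 2 * π * j) / k)).comp p
      (((hasDerivAt_id p).add_const (2 * π * j)).div_const (k : ℝ))).const_mul (k : ℝ)⁻¹
  have h3 := h1.unique (h2.congr_of_eventuallyEq (Eventually.of_forall fun t => by
      simp [fibreAvg_coe hk]))
  refine h3.trans ?_
  rw [fibreAvg_coe hk, ← Finset.sum_mul]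
  ring

end IsTestFunction

lemma memLp_cover {a : ℝ} {k : ℕ} (hk : 0 < k) {f : ℝ × S1 → ℝ}
    (hf : MemLp f 2 (weightedArea a)) : MemLp (cover k f) 2 (weightedArea a) := by
  rw [weightedArea_eq_prod] at hf ⊢
  have : SFinite (heightMeasure a) := by unfold heightMeasure; infer_instance
  exact hf.comp_measurePreserving (measurePreserving_cover hk)

lemma memLp_fibreAvg_area {a : ℝ} (k : ℕ) {f : ℝ × S1 → ℝ}
    (hf : MemLp f 2 (weightedArea a)) : MemLp (fibreAvg k f) 2 (weightedArea a) := by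
  rw [weightedArea_eq_prod] at hf ⊢
  have : SFinite (heightMeasure a) := by unfold heightMeasure; infer_instance
  exact memLp_fibreAvg k hf

lemma cover_mul_integral_eq {ν : Measure ℝ} [SFinite ν] {k : ℕ} (hk : 0 < k) {f g : ℝ × S1 → ℝ}
    (h : Integrable (fun z => cover k f z * g z) (ν.prod (volume : Measure S1))) :
    ∫ z, cover k f z * g z ∂ν.prod (volume : Measure S1) =
      ∫ z, f z * fibreAvg k g z ∂ν.prod (volume : Measure S1) := by
  rw [← integral_fibreAvg hk h]
  refine integral_congr_ae (Eventually.of_forall fun z => ?_)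
  simp only
  rw [mul_comm (f z), ← fibreAvg_mul_cover hk]
  simp_rw [mul_comm]

lemma integral_cover_mul_test {a : ℝ} (ha : a < 1) {k : ℕ} (hk : 0 < k) {f η : ℝ × S1 → ℝ}
    (hf : MemLp f 2 (weightedArea a)) (hη : IsTestFunction η) :
    ∫ z, cover k f z * η z ∂coordMeasure = ∫ z, f z * fibreAvg k η z ∂coordMeasure :=
  cover_mul_integral_eq hk (hη.integrable_mul (collarIntegrable_of_memLp ha (memLp_cover hk hf)))

lemma integral_fibreAvg_mul_test {a : ℝ} (ha : a < 1) {k : ℕ} (hk : 0 < k) {f η : ℝ × S1 → ℝ}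
    (hf : MemLp f 2 (weightedArea a)) (hη : IsTestFunction η) :
    ∫ z, fibreAvg k f z * η z ∂coordMeasure = ∫ z, f z * cover k η z ∂coordMeasure := by
  have h := (hη.cover k).integrable_mul (collarIntegrable_of_memLp ha hf)
  simp_rw [mul_comm (f _)] at h ⊢
  refine Eq.trans ?_ (cover_mul_integral_eq hk h).symm
  simp_rw [mul_comm]
  rfl

lemma inner_cover {a : ℝ} {k : ℕ} (hk : 0 < k) {f g : ℝ × S1 → ℝ}
    (hf : MemLp f 2 (weightedArea a)) (hg : MemLp g 2 (weightedArea a)) :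
    inner ℝ (memLp_cover hk hf).toLp hg.toLp =
      inner ℝ hf.toLp (memLp_fibreAvg_area k hg).toLp := by
  have h := integrable_mul_of_memLp (memLp_cover hk hf) hg
  rw [inner_toLp, inner_toLp]
  have : SFinite (heightMeasure a) := by unfold heightMeasure; infer_instance
  rw [weightedArea_eq_prod] at h ⊢
  exact cover_mul_integral_eq hk h

lemma norm_fibreAvg_le {a : ℝ} {k : ℕ} (hk : 0 < k) {f : ℝ × S1 → ℝ}
    (hf : MemLp f 2 (weightedArea a)) :
    ‖(memLp_fibreAvg_area k hf).toLp‖ ≤ ‖hf.toLp‖ := by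
  have : SFinite (heightMeasure a) := by unfold heightMeasure; infer_instance
  have h1 : normSq a (fibreAvg k f) ≤ normSq a f := by
    have h := hf.1
    unfold normSq
    rw [weightedArea_eq_prod] at h ⊢
    exact lintegral_fibreAvg_sq_le hk h
  rw [normSq_eq_norm_toLp hf, normSq_eq_norm_toLp (memLp_fibreAvg_area k hf),
    ENNReal.ofReal_le_ofReal_iff (by positivity)] at h1
  exact le_of_sq_le_sq h1 (norm_nonneg _)

namespace WeightedH1

variable {a : ℝ} {k : ℕ}

/-- The function `(θ, φ) ↦ U(θ, k φ)`. -/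
def pull (ha : a < 1) (hk : 0 < k) (U : WeightedH1 a) : WeightedH1 a where
  fn := cover k U.fn
  dTheta := cover k U.dTheta
  dPhi z := k * cover k U.dPhi z
  memLp_fn := memLp_cover hk U.memLp_fn
  memLp_dTheta := memLp_cover hk U.memLp_dTheta
  memLp_dPhi := by
    refine ((memLp_cover hk U.memLp_dPhi).const_mul k).ae_eq (Eventually.of_forall fun z => ?_)
    simp only [cover]; ring
  weak_dTheta η hη := by
    rw [integral_cover_mul_test ha hk U.memLp_fn hη.partialTheta_isTest,
      integral_cover_mul_test ha hk U.memLp_dTheta hη, ← hη.partialTheta_fibreAvg,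
      U.weak_dTheta _ (hη.fibreAvg hk)]
  weak_dPhi η hη := by
    have hk' : (k : ℝ) ≠ 0 := by exact_mod_cast hk.ne'
    have h := U.weak_dPhi _ (hη.fibreAvg hk)
    simp_rw [hη.partialPhi_fibreAvg hk, mul_left_comm, integral_const_mul] at h
    simp_rw [mul_assoc, integral_const_mul]
    rw [integral_cover_mul_test ha hk U.memLp_fn hη.partialPhi_isTest,
      integral_cover_mul_test ha hk U.memLp_dPhi' hη]
    rw [inv_mul_eq_iff_eq_mul₀ hk'] at h
    rw [h]; ring

/-- The function `(θ, φ) ↦ k⁻¹ ∑ u(θ, φ')`, the sum over the `k` angles with `k φ' = φ`. -/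
def push (ha : a < 1) (hk : 0 < k) (u : WeightedH1 a) : WeightedH1 a where
  fn := fibreAvg k u.fn
  dTheta := fibreAvg k u.dTheta
  dPhi z := (k : ℝ)⁻¹ * fibreAvg k u.dPhi z
  memLp_fn := memLp_fibreAvg_area k u.memLp_fn
  memLp_dTheta := memLp_fibreAvg_area k u.memLp_dTheta
  memLp_dPhi := by
    refine ((memLp_fibreAvg_area k u.memLp_dPhi).const_mul (k : ℝ)⁻¹).ae_eq
      (Eventually.of_forall fun z => ?_)
    simp only [fibreAvg, ← Finset.sum_div]; ring
  weak_dTheta η hη := by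
    rw [integral_fibreAvg_mul_test ha hk u.memLp_fn hη.partialTheta_isTest,
      integral_fibreAvg_mul_test ha hk u.memLp_dTheta hη]
    exact u.weak_dTheta _ (hη.cover k)
  weak_dPhi η hη := by
    have hk' : (k : ℝ) ≠ 0 := by exact_mod_cast hk.ne'
    have h := u.weak_dPhi _ (hη.cover k)
    simp_rw [hη.partialPhi_cover, mul_left_comm, integral_const_mul] at h
    simp_rw [mul_assoc, integral_const_mul]
    rw [integral_fibreAvg_mul_test ha hk u.memLp_fn hη.partialPhi_isTest,
      integral_fibreAvg_mul_test ha hk u.memLp_dPhi' hη, ← mul_neg, ← h,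
      inv_mul_cancel_left₀ hk']

lemma massForm_pull (ha : a < 1) (hk : 0 < k) (U v : WeightedH1 a) :
    (pull ha hk U).massForm v = U.massForm (push ha hk v) := by
  rw [massForm_eq, massForm_eq]
  exact inner_cover hk U.memLp_fn v.memLp_fn

lemma phiL2_pull (ha : a < 1) (hk : 0 < k) (U : WeightedH1 a) :
    (pull ha hk U).phiL2 = (k : ℝ) • (memLp_cover hk U.memLp_dPhi).toLp := by
  rw [← MemLp.toLp_const_smul]
  refine MemLp.toLp_congr _ _ (Eventually.of_forall fun z => ?_)
  simp only [pull, cover, Pi.smul_apply, smul_eq_mul]; ring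

lemma phiL2_push (ha : a < 1) (hk : 0 < k) (u : WeightedH1 a) :
    (push ha hk u).phiL2 = (k : ℝ)⁻¹ • (memLp_fibreAvg_area k u.memLp_dPhi).toLp := by
  rw [← MemLp.toLp_const_smul]
  refine MemLp.toLp_congr _ _ (Eventually.of_forall fun z => ?_)
  simp only [push, fibreAvg, Pi.smul_apply, smul_eq_mul, ← Finset.sum_div]; ring

lemma energyK_pull (ha : a < 1) (hk : 0 < k) (U v : WeightedH1 a) :
    energyK 1 (pull ha hk U) v = energyK k U (push ha hk v) := by
  have hk' : (k : ℝ) ≠ 0 := by exact_mod_cast hk.ne'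
  have h1 : inner ℝ (pull ha hk U).thetaL2 v.thetaL2 = inner ℝ U.thetaL2 (push ha hk v).thetaL2 :=
    inner_cover hk U.memLp_dTheta v.memLp_dTheta
  have h2 : inner ℝ (memLp_cover hk U.memLp_dPhi).toLp v.phiL2 =
      inner ℝ U.phiL2 (memLp_fibreAvg_area k v.memLp_dPhi).toLp :=
    inner_cover hk U.memLp_dPhi v.memLp_dPhi
  rw [energyK, energyK, h1, phiL2_pull, phiL2_push, inner_smul_left, inner_smul_right, h2,
    conj_trivial]
  field_simp

lemma push_pull_aeeq (ha : a < 1) (hk : 0 < k) (U : WeightedH1 a) :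
    (push ha hk (pull ha hk U)).AEEq U := by
  have hk' : (k : ℝ) ≠ 0 := by exact_mod_cast hk.ne'
  refine ⟨?_, ?_, ?_⟩
  · exact Eventually.of_forall fun z => congrFun (fibreAvg_cover hk U.fn) z
  · exact Eventually.of_forall fun z => congrFun (fibreAvg_cover hk U.dTheta) z
  · refine Eventually.of_forall fun z => ?_
    have := congrFun (fibreAvg_cover hk U.dPhi) z
    simp only [fibreAvg] at this
    simp only [push, pull, fibreAvg, ← Finset.mul_sum]
    field_simp at this ⊢
    linarith

lemma massForm_pull_self (ha : a < 1) (hk : 0 < k) (U : WeightedH1 a) :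
    (pull ha hk U).massForm (pull ha hk U) = U.massForm U := by
  rw [massForm_pull, massForm_eq, massForm_eq, (push_pull_aeeq ha hk U).valL2]

lemma energyK_pull_self (ha : a < 1) (hk : 0 < k) (U : WeightedH1 a) :
    energyK 1 (pull ha hk U) (pull ha hk U) = energyK k U U := by
  have h := push_pull_aeeq ha hk U
  rw [energyK_pull, energyK, energyK, h.thetaL2, h.phiL2]

lemma energyK_push_self_le (ha : a < 1) (hk : 0 < k) (u : WeightedH1 a) :
    energyK k (push ha hk u) (push ha hk u) ≤ energyK 1 u u := by
  have hk' : (k : ℝ) ≠ 0 := by exact_mod_cast hk.ne'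
  have h1 : ‖(push ha hk u).thetaL2‖ ≤ ‖u.thetaL2‖ := norm_fibreAvg_le hk u.memLp_dTheta
  have h2 : ‖(memLp_fibreAvg_area k u.memLp_dPhi).toLp‖ ≤ ‖u.phiL2‖ :=
    norm_fibreAvg_le hk u.memLp_dPhi
  rw [energyK_self, energyK_self, phiL2_push, norm_smul, mul_pow, norm_inv, Real.norm_natCast,
    inv_pow, ← mul_assoc, mul_inv_cancel₀ (pow_ne_zero 2 hk'), one_pow]
  gcongr

end WeightedH1

/-! ### The arcs, traces and symmetries under the covering -/

lemma mem_arcs_one {x : S1} : x ∈ arcs 1 ↔ ang x ∈ Ioo 0 π := by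
  have e : arcs 1 = (fun t : ℝ => (t : S1)) '' Ioo 0 π := by
    have h : (1 - 2⁻¹ : ℝ) * (2 * π) = π := by ring
    simp [arcs, period, h]
  rw [e]
  constructor
  · rintro ⟨t, ht, rfl⟩
    have : t ∈ Ioc 0 (2 * π) := ⟨ht.1, by linarith [ht.2, pi_pos]⟩
    simp only
    rwa [ang_coe this]
  · intro h
    exact ⟨ang x, h, coe_ang x⟩

lemma mem_arcs_iff {k : ℕ} (hk : 0 < k) {x : S1} : x ∈ arcs k ↔ k • x ∈ arcs 1 := by
  have hk' : (0 : ℝ) < k := by exact_mod_cast hk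
  rw [mem_arcs_one]
  constructor
  · rintro ⟨t, ht, rfl⟩
    simp only [mem_iUnion, Finset.mem_Icc, period] at ht
    obtain ⟨i, ⟨hi1, hi2⟩, h1, h2⟩ := ht
    have e1 : ((i : ℝ) - 1) * (2 * π / k) * k = ((i : ℝ) - 1) * (2 * π) := by field_simp
    have e2 : ((i : ℝ) - 1 / 2) * (2 * π / k) * k = ((i : ℝ) - 1 / 2) * (2 * π) := by field_simp
    have h3 := mul_lt_mul_of_pos_right h1 hk'
    have h4 := mul_lt_mul_of_pos_right h2 hk'
    rw [e1] at h3
    rw [e2] at h4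
    have e3 : k • ((t : ℝ) : S1) = ((t * k - ((i : ℤ) - 1 : ℤ) * (2 * π) : ℝ) : S1) := by
      rw [← AddCircle.coe_nsmul, nsmul_eq_mul, AddCircle.coe_sub, ← zsmul_eq_mul,
        AddCircle.coe_zsmul, AddCircle.coe_period, smul_zero, sub_zero, mul_comm (k : ℝ) t]
    have h5 : t * k - ((i : ℤ) - 1 : ℤ) * (2 * π) ∈ Ioo 0 π := by
      push_cast; constructor <;> linarith
    simp only
    rw [e3, ang_coe ⟨h5.1, by linarith [h5.2, pi_pos]⟩]
    exact h5
  · intro h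
    have hx := ang_mem x
    have e : k • x = ((k * ang x : ℝ) : S1) := by
      conv_lhs => rw [← coe_ang x]
      rw [← AddCircle.coe_nsmul, nsmul_eq_mul]
    obtain ⟨n, hn⟩ := exists_eq_ang_add (k * ang x)
    rw [← e] at hn
    have hpos : 0 < k * ang x := mul_pos hk' hx.1
    have hle : k * ang x ≤ k * (2 * π) := mul_le_mul_of_nonneg_left hx.2 hk'.le
    have n0 : (-1 : ℝ) < n := by
      by_contra hc
      have : (n : ℝ) * (2 * π) ≤ -1 * (2 * π) :=
        mul_le_mul_of_nonneg_right (not_lt.mp hc) two_pi_pos.le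
      linarith [h.2, pi_pos]
    have n1 : (n : ℝ) < k := lt_of_mul_lt_mul_right (by linarith [h.1]) two_pi_pos.le
    have n0' : -1 < n := by exact_mod_cast n0
    have n1' : n < k := by exact_mod_cast n1
    obtain ⟨m, rfl⟩ := Int.eq_ofNat_of_zero_le (show 0 ≤ n by omega)
    have hm : m < k := by exact_mod_cast n1'
    refine ⟨ang x, ?_, coe_ang x⟩
    simp only [mem_iUnion, Finset.mem_Icc, period]
    refine ⟨m + 1, ⟨by omega, by omega⟩, ?_, ?_⟩
    · rw [mul_div_assoc', div_lt_iff₀ hk']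
      push_cast at hn ⊢; linarith [h.1]
    · rw [mul_div_assoc', lt_div_iff₀ hk']
      push_cast at hn ⊢; linarith [h.2]

lemma measurableSet_arcs_one : MeasurableSet (arcs 1) := by
  have : arcs 1 = ang ⁻¹' Ioo 0 π := Set.ext fun x => mem_arcs_one
  rw [this]
  exact measurable_ang measurableSet_Ioo

lemma measurable_nsmul_circle (k : ℕ) : Measurable fun x : S1 => k • x :=
  (continuous_nsmul k).measurable

lemma measurableSet_arcs {k : ℕ} (hk : 0 < k) : MeasurableSet (arcs k) := by
  have : arcs k = (fun x : S1 => k • x) ⁻¹' arcs 1 := Set.ext fun x => mem_arcs_iff hk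
  rw [this]
  exact measurable_nsmul_circle k measurableSet_arcs_one

lemma quasiMeasurePreserving_branch {k j : ℕ} (hj : j < k) :
    Measure.QuasiMeasurePreserving (branch k j) volume volume := by
  refine ⟨measurable_branch k j, ?_⟩
  rw [map_branch hj]
  exact (Measure.smul_absolutelyContinuous).trans Measure.restrict_le_self.absolutelyContinuous

lemma memLp_branch {k j : ℕ} (hj : j < k) {g : S1 → ℝ} (hg : MemLp g 2 volume) :
    MemLp (fun y => g (branch k j y)) 2 volume := by
  refine MemLp.comp_of_map (g := g) ?_ (measurable_branch k j).aemeasurable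
  refine hg.of_measure_le_smul (c := k) (by simp) ?_
  rw [map_branch hj]
  gcongr
  exact Measure.restrict_le_self

/-- The average over the fibres of the covering, for functions on the circle. -/
def fibreAvgCircle (k : ℕ) (g : S1 → ℝ) (y : S1) : ℝ :=
  (k : ℝ)⁻¹ * ∑ j ∈ Finset.range k, g (branch k j y)

lemma IsTrace.fibreAvg {u : ℝ × S1 → ℝ} {g : S1 → ℝ} {k : ℕ} (hk : 0 < k)
    (hu : AEStronglyMeasurable u coordMeasure) (h : IsTrace u g) :
    IsTrace (fibreAvg k u) (fibreAvgCircle k g) := by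
  refine ⟨(memLp_finsetSum _ fun j hj =>
    memLp_branch (Finset.mem_range.mp hj) h.1).const_mul _, ?_⟩
  refine tendsto_of_tendsto_of_tendsto_of_le_of_le' tendsto_const_nhds h.2
    (Eventually.of_forall fun _ => zero_le) ?_
  filter_upwards [eventually_lt_half_pi] with ε hε
  refine mul_le_mul' le_rfl ?_
  rw [setLIntegral_strip, setLIntegral_strip]
  have hm : AEStronglyMeasurable (fun z => u z - g z.2) (collar ε) := by
    refine AEStronglyMeasurable.sub ?_ (h.1.1.comp_snd)
    rw [collar_eq hε.2.le]
    exact hu.restrict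
  refine le_trans (le_of_eq ?_) (lintegral_fibreAvg_sq_le hk hm)
  refine lintegral_congr fun z => ?_
  simp only [HemisphereEigenvalue.fibreAvg, fibreAvgCircle, Finset.sum_sub_distrib, mul_sub]

lemma IsTrace.comp_snd {u : ℝ × S1 → ℝ} {g : S1 → ℝ} {τ : S1 → S1}
    (hτ : MeasurePreserving τ volume volume) (hu : AEStronglyMeasurable u coordMeasure)
    (h : IsTrace u g) : IsTrace (fun z => u (z.1, τ z.2)) (fun x => g (τ x)) := by
  refine ⟨h.1.comp_measurePreserving hτ, h.2.congr' ?_⟩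
  filter_upwards [eventually_lt_half_pi] with ε hε
  rw [setLIntegral_strip, setLIntegral_strip]
  have hm : AEStronglyMeasurable (fun z => u z - g z.2) (collar ε) := by
    refine AEStronglyMeasurable.sub ?_ (h.1.1.comp_snd)
    rw [collar_eq hε.2.le]
    exact hu.restrict
  have mp : MeasurePreserving (fun z : ℝ × S1 => (z.1, τ z.2)) (collar ε) (collar ε) :=
    (MeasurePreserving.id _).prod hτ
  congr 1
  conv_lhs => rw [← mp.map_eq]
  rw [lintegral_map' _ mp.measurable.aemeasurable]
  rw [mp.map_eq]
  exact hm.enorm.pow_const 2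

lemma circleRefl_circleRefl (k i j : ℕ) (x : S1) :
    circleRefl k i (circleRefl k j x) = x + ((((i : ℝ) - j) * period k : ℝ) : S1) := by
  rw [circleRefl, circleRefl, ← sub_add, add_comm, ← AddCircle.coe_sub]
  congr 2
  ring

lemma nsmul_period {k : ℕ} (hk : 0 < k) (n : ℤ) : k • (((n : ℝ) * period k : ℝ) : S1) = 0 := by
  have hk' : (k : ℝ) ≠ 0 := by exact_mod_cast hk.ne'
  rw [← AddCircle.coe_nsmul, nsmul_eq_mul, period,
    show (k : ℝ) * (n * (2 * π / k)) = n * (2 * π) by field_simp, ← zsmul_eq_mul,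
    AddCircle.coe_zsmul, AddCircle.coe_period, smul_zero]

namespace WeightedH1

variable {a : ℝ} {k : ℕ}

lemma aestronglyMeasurable_fn (u : WeightedH1 a) : AEStronglyMeasurable u.fn coordMeasure :=
  u.memLp_fn.1.mono_ac (coordMeasure_absolutelyContinuous a)

lemma VanishesOff.pull (ha : a < 1) (hk : 0 < k) {U : WeightedH1 a} (h : U.VanishesOff (arcs 1)) :
    (WeightedH1.pull ha hk U).VanishesOff (arcs k) := by
  obtain ⟨g, hg, h0⟩ := h
  refine ⟨fun x => g (k • x), hg.comp_snd (measurePreserving_nsmul hk) U.aestronglyMeasurable_fn, ?_⟩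
  have h1 : ∀ᵐ x : S1, k • x ∉ arcs 1 → g (k • x) = 0 :=
    (measurePreserving_nsmul hk).quasiMeasurePreserving.ae (p := fun y => y ∉ arcs 1 → g y = 0) h0
  filter_upwards [h1] with x hx hn
  exact hx fun hm => hn ((mem_arcs_iff hk).mpr hm)

lemma VanishesOff.push (ha : a < 1) (hk : 0 < k) {u : WeightedH1 a} (h : u.VanishesOff (arcs k)) :
    (WeightedH1.push ha hk u).VanishesOff (arcs 1) := by
  obtain ⟨g, hg, h0⟩ := h
  refine ⟨_, hg.fibreAvg hk u.aestronglyMeasurable_fn, ?_⟩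
  have h1 : ∀ᵐ y : S1, ∀ j ∈ Finset.range k, branch k j y ∉ arcs k → g (branch k j y) = 0 :=
    (eventually_all_finset _).mpr fun j hj =>
      (quasiMeasurePreserving_branch (Finset.mem_range.mp hj)).ae
        (p := fun y => y ∉ arcs k → g y = 0) h0
  filter_upwards [h1] with y hy hn
  rw [fibreAvgCircle, Finset.sum_eq_zero fun j hj => hy j hj ?_, mul_zero]
  rwa [mem_arcs_iff hk, nsmul_branch hk]

lemma isSymmetric_pull (ha : a < 1) (hk : 0 < k) (U : WeightedH1 a) :
    (pull ha hk U).IsSymmetric k := by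
  refine fun i _ j _ => Eventually.of_forall fun z => ?_
  have := nsmul_period hk ((i : ℤ) - j)
  push_cast at this
  simp only [pull, cover, circleRefl_circleRefl, smul_add, this, add_zero]

lemma IsSymmetric.cover_fibreAvg (hk : 0 < k) {u : WeightedH1 a} (h : u.IsSymmetric k) :
    cover k (fibreAvg k u.fn) =ᵐ[coordMeasure] u.fn := by
  have hk' : (k : ℝ) ≠ 0 := by exact_mod_cast hk.ne'
  have h1 : ∀ᵐ z ∂coordMeasure, ∀ j ∈ Finset.range k,
      u.fn z = u.fn (z.1, z.2 + (((j : ℝ) * period k : ℝ) : S1)) := by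
    refine (eventually_all_finset _).mpr fun j hj => ?_
    have hj := Finset.mem_range.mp hj
    filter_upwards [ae_weightedArea_iff.mp (h (j + 1) (Finset.mem_Icc.mpr ⟨by omega, by omega⟩) 1
      (Finset.mem_Icc.mpr ⟨le_rfl, hk⟩))] with z hz
    rw [circleRefl_circleRefl] at hz
    push_cast at hz
    rwa [add_sub_cancel_right] at hz
  filter_upwards [h1] with z hz
  obtain ⟨θ, x⟩ := z
  obtain ⟨p, rfl⟩ := QuotientAddGroup.mk_surjective x
  have e := cover_coe k (fibreAvg k u.fn) θ p
  refine e.trans ?_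
  rw [fibreAvg_coe hk, Finset.sum_congr rfl fun j hj => ?_, Finset.sum_const, Finset.card_range,
    nsmul_eq_mul, inv_mul_cancel_left₀ hk']
  rw [hz j hj]
  congr 2
  rw [show (k * p + 2 * π * j) / k = p + j * period k by rw [period]; field_simp,
    AddCircle.coe_add]

lemma massForm_push_of_isSymmetric (ha : a < 1) (hk : 0 < k) {u : WeightedH1 a}
    (h : u.IsSymmetric k) : (push ha hk u).massForm (push ha hk u) = u.massForm u := by
  rw [← massForm_pull, massForm_eq, massForm_eq]
  have : (pull ha hk (push ha hk u)).valL2 = u.valL2 :=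
    MemLp.toLp_congr _ _ (ae_weightedArea_iff.mpr (h.cover_fibreAvg hk))
  rw [this]

end WeightedH1

/-! ### Polarization -/

lemma measurePreserving_neg_circle :
    MeasurePreserving (fun x : S1 => -x) volume volume :=
  Measure.measurePreserving_neg volume

lemma measurePreserving_refl (ν : Measure ℝ) [SFinite ν] :
    MeasurePreserving (fun z : ℝ × S1 => (z.1, -z.2)) (ν.prod (volume : Measure S1))
      (ν.prod (volume : Measure S1)) :=
  (MeasurePreserving.id ν).prod measurePreserving_neg_circle

lemma measurePreserving_refl_area (a : ℝ) :
    MeasurePreserving (fun z : ℝ × S1 => (z.1, -z.2)) (weightedArea a) (weightedArea a) := by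
  have : SFinite (heightMeasure a) := by unfold heightMeasure; infer_instance
  rw [weightedArea_eq_prod]
  exact measurePreserving_refl _

lemma integral_refl {μ : Measure (ℝ × S1)}
    (hμ : MeasurePreserving (fun z : ℝ × S1 => (z.1, -z.2)) μ μ) {F : ℝ × S1 → ℝ}
    (hF : AEStronglyMeasurable F μ) : ∫ z, F (z.1, -z.2) ∂μ = ∫ z, F z ∂μ := by
  conv_rhs => rw [← hμ.map_eq]
  rw [integral_map hμ.measurable.aemeasurable (by rwa [hμ.map_eq])]

lemma inner_toLp_eq_zero_of_odd {a : ℝ} {f g : ℝ × S1 → ℝ} (hf : MemLp f 2 (weightedArea a))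
    (hg : MemLp g 2 (weightedArea a))
    (h : ∀ᵐ z ∂coordMeasure, f (z.1, -z.2) * g (z.1, -z.2) = -(f z * g z)) :
    inner ℝ hf.toLp hg.toLp = 0 := by
  rw [inner_toLp]
  have h1 := integral_refl (measurePreserving_refl_area a) (F := fun z => f z * g z)
    (hf.1.mul hg.1)
  rw [integral_congr_ae (ae_weightedArea_iff.mpr h), integral_neg] at h1
  linarith

lemma isTest_refl {η : ℝ × S1 → ℝ} (hη : IsTestFunction η) :
    IsTestFunction fun z => η (z.1, -z.2) := by
  obtain ⟨α, β, h1, h2, h3⟩ := hη.compactSupport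
  exact ⟨hη.smooth.comp (g := fun p : ℝ × ℝ => η (p.1, (p.2 : S1)))
    (f := fun p : ℝ × ℝ => (p.1, -p.2)) (by fun_prop), α, β, h1, h2, fun z hz => h3 (z.1, -z.2) hz⟩

lemma partialPhi_refl {η : ℝ × S1 → ℝ} (hη : IsTestFunction η) (z : ℝ × S1) :
    partialPhi (fun z => η (z.1, -z.2)) z = -partialPhi η (z.1, -z.2) := by
  obtain ⟨θ, x⟩ := z
  obtain ⟨p, rfl⟩ := QuotientAddGroup.mk_surjective x
  have h1 := (isTest_refl hη).hasDerivAt_phi θ p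
  have h2 := (hη.hasDerivAt_phi θ (-p)).comp p (hasDerivAt_neg p)
  rw [mul_neg_one] at h2
  exact h1.unique h2

namespace WeightedH1

variable {a : ℝ}

lemma memLp_refl {f : ℝ × S1 → ℝ} (hf : MemLp f 2 (weightedArea a)) :
    MemLp (fun z => f (z.1, -z.2)) 2 (weightedArea a) :=
  hf.comp_measurePreserving (measurePreserving_refl_area a)

lemma integral_refl_mul {f η : ℝ × S1 → ℝ} (ha : a < 1) (hf : MemLp f 2 (weightedArea a))
    (hη : IsTestFunction η) :
    ∫ z, f (z.1, -z.2) * η z ∂coordMeasure = ∫ z, f z * η (z.1, -z.2) ∂coordMeasure := by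
  have h := ((isTest_refl hη).integrable_mul (collarIntegrable_of_memLp ha hf)).1
  have h2 := integral_refl (μ := coordMeasure) (measurePreserving_refl _) h
  simpa only [neg_neg] using h2

/-- The function `(θ, φ) ↦ u(θ, -φ)`. -/
def refl (ha : a < 1) (u : WeightedH1 a) : WeightedH1 a where
  fn z := u.fn (z.1, -z.2)
  dTheta z := u.dTheta (z.1, -z.2)
  dPhi z := -u.dPhi (z.1, -z.2)
  memLp_fn := memLp_refl u.memLp_fn
  memLp_dTheta := memLp_refl u.memLp_dTheta
  memLp_dPhi := by
    simp_rw [neg_div]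
    exact (memLp_refl u.memLp_dPhi).neg
  weak_dTheta η hη := by
    rw [integral_refl_mul ha u.memLp_fn hη.partialTheta_isTest,
      integral_refl_mul ha u.memLp_dTheta hη]
    exact u.weak_dTheta _ (isTest_refl hη)
  weak_dPhi η hη := by
    have h := u.weak_dPhi _ (isTest_refl hη)
    simp_rw [partialPhi_refl hη, mul_neg, integral_neg, neg_inj] at h
    simp_rw [neg_mul, integral_neg, neg_neg]
    rw [integral_refl_mul ha u.memLp_fn hη.partialPhi_isTest,
      integral_refl_mul ha u.memLp_dPhi' hη, h]

end WeightedH1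

lemma ae_ang_ne (t : ℝ) : ∀ᵐ x : S1, ang x ≠ t :=
  measurePreserving_ang.quasiMeasurePreserving.ae (p := fun q => q ≠ t)
    (ae_restrict_of_ae (by simp [ae_iff]))

lemma ang_neg {x : S1} (h : ang x ≠ 2 * π) : ang (-x) = 2 * π - ang x := by
  have hx := ang_mem x
  have e : -x = ((2 * π - ang x : ℝ) : S1) := by
    rw [AddCircle.coe_sub, AddCircle.coe_period, coe_ang, zero_sub]
  rw [e, ang_coe ⟨?_, by linarith [hx.1]⟩]
  linarith [lt_of_le_of_ne hx.2 h]

lemma ae_halfSign_neg : ∀ᵐ x : S1, halfSign 1 (-1) (-x) = -halfSign 1 (-1) x := by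
  filter_upwards [ae_ang_ne π, ae_ang_ne (2 * π)] with x h1 h2
  rw [halfSign, halfSign, ang_neg h2]
  rcases lt_or_gt_of_ne h1 with h | h
  · rw [if_neg (by linarith), if_pos h.le]
  · rw [if_pos (by linarith), if_neg (by linarith), neg_neg]

namespace WeightedH1

variable {a : ℝ}

/-- Polarization with respect to the plane of the half circle `arcs 1`: at every pair of reflected
points the larger value of `|u|` is put on the side of the half circle. If at almost every pair of
reflected points of the circle one of the two traces is zero, then the result vanishes off the half
circle. The polarization is `w + χ |d|`, with the even part `w` and the odd part `d` of `|u|` and the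
sign `χ` of the half circle; the even and the odd parts being orthogonal, its energy is at most the
one of `w + d`. -/
lemma exists_polarization (ha : a < 1) {u : WeightedH1 a} {g : S1 → ℝ} (hg : IsTrace u.fn g)
    (h0 : ∀ᵐ y : S1, g y * g (-y) = 0) :
    ∃ v : WeightedH1 a, v.VanishesOff (arcs 1) ∧ v.massForm v = u.massForm u ∧
      ∀ κ, energyK κ v v ≤ energyK κ u u := by
  obtain ⟨u₀, hm, e0, n0, en0, -⟩ := exists_abs ha u
  have hg0 : IsTrace u₀.fn fun x => |g x| := by
    obtain ⟨u', hu', e⟩ := u.exists_measurable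
    have := (hg.congr e.fn).halfSign_abs hu'.fn (c₁ := 1) (c₂ := 1) (by simp) (by simp)
    simp only [halfSign, ite_self, one_mul] at this
    refine this.congr ?_
    filter_upwards [e.fn, e0] with z h1 h2
    rw [h2, h1]
  set r := refl ha u₀ with hr
  set w := lin ha (1 / 2) (1 / 2) u₀ r with hw
  set d := lin ha (1 / 2) (-1 / 2) u₀ r with hd
  have mneg : Measurable fun z : ℝ × S1 => (z.1, -z.2) := by fun_prop
  have hrm : r.IsMeasurable := ⟨hm.fn.comp mneg, hm.dTheta.comp mneg, (hm.dPhi.comp mneg).neg⟩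
  have hdm : d.IsMeasurable := ⟨(hm.fn.const_mul _).add (hrm.fn.const_mul _),
    (hm.dTheta.const_mul _).add (hrm.dTheta.const_mul _),
    (hm.dPhi.const_mul _).add (hrm.dPhi.const_mul _)⟩
  have hwm : w.IsMeasurable := ⟨(hm.fn.const_mul _).add (hrm.fn.const_mul _),
    (hm.dTheta.const_mul _).add (hrm.dTheta.const_mul _),
    (hm.dPhi.const_mul _).add (hrm.dPhi.const_mul _)⟩
  have w1 : ∀ z : ℝ × S1, w.fn (z.1, -z.2) = w.fn z := fun z => by
    simp only [hw, hr, lin, refl, neg_neg]; ring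
  have w2 : ∀ z : ℝ × S1, w.dTheta (z.1, -z.2) = w.dTheta z := fun z => by
    simp only [hw, hr, lin, refl, neg_neg]; ring
  have w3 : ∀ z : ℝ × S1, w.dPhi (z.1, -z.2) = -w.dPhi z := fun z => by
    simp only [hw, hr, lin, refl, neg_neg]; ring
  have d1 : ∀ z : ℝ × S1, d.fn (z.1, -z.2) = -d.fn z := fun z => by
    simp only [hd, hr, lin, refl, neg_neg]; ring
  have d2 : ∀ z : ℝ × S1, d.dTheta (z.1, -z.2) = -d.dTheta z := fun z => by
    simp only [hd, hr, lin, refl, neg_neg]; ring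
  have d3 : ∀ z : ℝ × S1, d.dPhi (z.1, -z.2) = d.dPhi z := fun z => by
    simp only [hd, hr, lin, refl, neg_neg]; ring
  obtain ⟨D, -, D1, D2, D3, n1, n2, n3⟩ := exists_halfSign_abs_energy_le ha hdm (c₁ := 1)
    (c₂ := -1) (by simp) (by simp) (Or.inr (Eventually.of_forall d1))
  have hχ : ∀ᵐ z ∂coordMeasure, halfSign 1 (-1) (-z.2) = -halfSign 1 (-1) z.2 :=
    Measure.quasiMeasurePreserving_snd.ae (p := fun x => halfSign 1 (-1) (-x) = -halfSign 1 (-1) x)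
      ae_halfSign_neg
  have o1 : inner ℝ w.valL2 d.valL2 = 0 :=
    inner_toLp_eq_zero_of_odd _ _ (Eventually.of_forall fun z => by rw [w1, d1]; ring)
  have o2 : inner ℝ w.thetaL2 d.thetaL2 = 0 :=
    inner_toLp_eq_zero_of_odd _ _ (Eventually.of_forall fun z => by rw [w2, d2]; ring)
  have o3 : inner ℝ w.phiL2 d.phiL2 = 0 :=
    inner_toLp_eq_zero_of_odd _ _ (Eventually.of_forall fun z => by simp only [w3, d3]; ring)
  have p1 : inner ℝ w.valL2 D.valL2 = 0 := inner_toLp_eq_zero_of_odd _ _ (by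
    filter_upwards [hχ] with z hz
    rw [w1, D1]; simp only [d1, hz, abs_neg]; ring)
  have p2 : inner ℝ w.thetaL2 D.thetaL2 = 0 := inner_toLp_eq_zero_of_odd _ _ (by
    filter_upwards [hχ] with z hz
    rw [w2, D2]; simp only [d1, d2, hz, Real.sign_neg]; ring)
  have p3 : inner ℝ w.phiL2 D.phiL2 = 0 := inner_toLp_eq_zero_of_odd _ _ (by
    filter_upwards [hχ] with z hz
    simp only [D3, w3, d1, d3, hz, Real.sign_neg]; ring)
  have s1 : u₀.valL2 = w.valL2 + d.valL2 := by rw [hw, hd, lin_valL2, lin_valL2]; module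
  have s2 : u₀.thetaL2 = w.thetaL2 + d.thetaL2 := by rw [hw, hd, lin_thetaL2, lin_thetaL2]; module
  have s3 : u₀.phiL2 = w.phiL2 + d.phiL2 := by rw [hw, hd, lin_phiL2, lin_phiL2]; module
  refine ⟨lin ha 1 1 w D, ?_, ?_, fun κ => ?_⟩
  · have t1 := hg0.comp_snd measurePreserving_neg_circle u₀.aestronglyMeasurable_fn
    have tw := hg0.lin hm.fn t1 (1 / 2) (1 / 2)
    have td := (hg0.lin hm.fn t1 (1 / 2) (-1 / 2)).halfSign_abs hdm.fn (c₁ := 1) (c₂ := -1)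
      (by simp) (by simp)
    have tD : IsTrace D.fn fun x =>
        halfSign 1 (-1) x * |1 / 2 * |g x| + (-1 / 2 * |g (-x)|)| := by rw [D1]; exact td
    refine ⟨_, tw.lin hwm.fn tD 1 1, ?_⟩
    filter_upwards [h0, ae_ang_ne π] with y hy hπ hn
    rw [mem_arcs_one] at hn
    have hlt : π < ang y := by
      by_contra hc
      exact hn ⟨(ang_mem y).1, lt_of_le_of_ne (not_lt.mp hc) hπ⟩
    simp only [halfSign, if_neg (not_le.mpr hlt)]
    rcases mul_eq_zero.mp hy with h | h
    · rw [h]; simp [abs_mul]; ring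
    · rw [h]; simp [abs_mul]
  · rw [massForm_self, massForm_self, ← n0, s1, norm_add_sq_real, o1, lin_valL2, one_smul, one_smul,
      norm_add_sq_real, p1, n1]
  · refine le_trans ?_ (en0 κ)
    rw [energyK_self, energyK_self, s2, s3, lin_thetaL2, lin_phiL2]
    simp only [one_smul, norm_add_sq_real, o2, o3, p2, p3, mul_zero, add_zero]
    gcongr

end WeightedH1

/-! ### Optimality of the equally spaced arcs -/

lemma exists_of_nsmul_eq_zero {k : ℕ} (hk : 0 < k) {x : S1} (h : k • x = 0) :
    ∃ m < k, x = (((m : ℝ) * period k : ℝ) : S1) := by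
  have hk' : (0 : ℝ) < k := by exact_mod_cast hk
  have hx := ang_mem x
  rw [← coe_ang x, ← AddCircle.coe_nsmul, nsmul_eq_mul] at h
  obtain ⟨n, hn⟩ := (AddCircle.coe_eq_zero_iff (2 * π)).mp h
  rw [zsmul_eq_mul] at hn
  have n0 : (0 : ℝ) < n := by
    have : 0 < (n : ℝ) * (2 * π) := by rw [hn]; exact mul_pos hk' hx.1
    exact pos_of_mul_pos_left this two_pi_pos.le
  have n1 : (n : ℝ) ≤ k := by
    have : (n : ℝ) * (2 * π) ≤ k * (2 * π) := by
      rw [hn]; exact mul_le_mul_of_nonneg_left hx.2 hk'.le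
    exact le_of_mul_le_mul_right this two_pi_pos
  have n0' : 0 < n := by exact_mod_cast n0
  have n1' : n ≤ k := by exact_mod_cast n1
  obtain ⟨m, rfl⟩ := Int.eq_ofNat_of_zero_le n0'.le
  have hxm : ang x = (m : ℝ) * period k := by
    rw [period, ← mul_div_assoc, eq_div_iff hk'.ne', mul_comm, ← hn]; rfl
  rcases (show m ≤ k by exact_mod_cast n1').lt_or_eq with hlt | rfl
  · exact ⟨m, hlt, by rw [← hxm, coe_ang]⟩
  · refine ⟨0, hk, ?_⟩
    rw [← coe_ang x, hxm, period, mul_div_cancel₀ _ hk'.ne', AddCircle.coe_period]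
    simp

/-- For `ω` in the class of boundary sets, the average over the fibres of the covering of a function
that vanishes off `ω` is zero at one of almost every two reflected points. -/
lemma fibreAvgCircle_mul_neg_eq_zero {k : ℕ} (hk : 0 < k) {ω : Set S1} (hω : ω ∈ boundarySets k)
    {g : S1 → ℝ} (h0 : ∀ᵐ x : S1, x ∉ ω → g x = 0) :
    ∀ᵐ y : S1, fibreAvgCircle k g y * fibreAvgCircle k g (-y) = 0 := by
  have h1 : ∀ᵐ y : S1, ∀ j ∈ Finset.range k, branch k j y ∉ ω → g (branch k j y) = 0 :=
    (eventually_all_finset _).mpr fun j hj =>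
      (quasiMeasurePreserving_branch (Finset.mem_range.mp hj)).ae
        (p := fun y => y ∉ ω → g y = 0) h0
  have h2 : ∀ᵐ y : S1, ∀ j ∈ Finset.range k, branch k j (-y) ∉ ω → g (branch k j (-y)) = 0 :=
    measurePreserving_neg_circle.quasiMeasurePreserving.ae
      (p := fun y => ∀ j ∈ Finset.range k, branch k j y ∉ ω → g (branch k j y) = 0) h1
  have h3 : ∀ᵐ y : S1, ∀ j ∈ Finset.range k, ∀ i ∈ Finset.Icc 1 k,
      (branch k j y ∈ ω ↔ circleRefl k i (branch k j y) ∈ ωᶜ) :=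
    (eventually_all_finset _).mpr fun j hj => (eventually_all_finset _).mpr fun i hi =>
      (quasiMeasurePreserving_branch (Finset.mem_range.mp hj)).ae
        (p := fun y => y ∈ ω ↔ circleRefl k i y ∈ ωᶜ) (hω.2.2 i hi)
  filter_upwards [h1, h2, h3] with y e1 e2 e3
  by_contra hne
  rw [mul_eq_zero, not_or] at hne
  obtain ⟨j, hj, hgj⟩ := Finset.exists_ne_zero_of_sum_ne_zero (right_ne_zero_of_mul hne.1)
  obtain ⟨l, hl, hgl⟩ := Finset.exists_ne_zero_of_sum_ne_zero (right_ne_zero_of_mul hne.2)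
  have hjω : branch k j y ∈ ω := by
    by_contra hc; exact hgj (e1 j hj hc)
  have hlω : branch k l (-y) ∈ ω := by
    by_contra hc; exact hgl (e2 l hl hc)
  obtain ⟨m, hm, hmx⟩ := exists_of_nsmul_eq_zero hk (x := branch k l (-y) + branch k j y) (by
    rw [smul_add, nsmul_branch hk, nsmul_branch hk, neg_add_cancel])
  refine (e3 j hj (m + 1) (Finset.mem_Icc.mpr ⟨by omega, by omega⟩)).mp hjω ?_
  rw [circleRefl]
  push_cast
  rwa [add_sub_cancel_right, ← hmx, add_sub_cancel_right]

lemma ae_mem_arcs_one_iff : ∀ᵐ y : S1, y ∈ arcs 1 ↔ -y ∉ arcs 1 := by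
  filter_upwards [ae_ang_ne π, ae_ang_ne (2 * π)] with y h1 h2
  have hy := ang_mem y
  rw [mem_arcs_one, mem_arcs_one, ang_neg h2]
  constructor
  · rintro ⟨-, h⟩ ⟨-, h'⟩; linarith
  · intro h
    refine ⟨hy.1, ?_⟩
    by_contra hc
    have hlt : ang y < 2 * π := lt_of_le_of_ne hy.2 h2
    have hgt : π < ang y := lt_of_le_of_ne (not_lt.mp hc) (Ne.symm h1)
    exact h ⟨by linarith, by linarith⟩

lemma nsmul_circleRefl {k : ℕ} (hk : 0 < k) (i : ℕ) (x : S1) :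
    k • circleRefl k i x = -(k • x) := by
  have := nsmul_period hk ((i : ℤ) - 1)
  push_cast at this
  rw [circleRefl, smul_sub, this, zero_sub]

lemma arcs_mem_boundarySets {k : ℕ} (hk : 0 < k) : arcs k ∈ boundarySets k := by
  have h1 : ∀ᵐ x : S1, k • x ∈ arcs 1 ↔ -(k • x) ∉ arcs 1 :=
    (measurePreserving_nsmul hk).quasiMeasurePreserving.ae
      (p := fun y => y ∈ arcs 1 ↔ -y ∉ arcs 1) ae_mem_arcs_one_iff
  refine ⟨measurableSet_arcs hk, ?_, fun i _ => ?_⟩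
  · have h2 : arcs k =ᵐ[volume] (fun x : S1 => -x) ⁻¹' (arcs k)ᶜ := by
      refine eventuallyEq_set.mpr ?_
      filter_upwards [h1] with x hx
      rw [mem_preimage, mem_compl_iff, mem_arcs_iff hk, mem_arcs_iff hk, smul_neg]
      exact hx
    rw [measure_congr h2, measurePreserving_neg_circle.measure_preimage
      (measurableSet_arcs hk).compl.nullMeasurableSet]
  · filter_upwards [h1] with x hx
    rw [mem_compl_iff, mem_arcs_iff hk, mem_arcs_iff hk, nsmul_circleRefl hk]
    exact hx

namespace WeightedH1

variable {a : ℝ}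

/-- A function with `k`-fold symmetry that vanishes off a set of the class of boundary sets can be
replaced by one that vanishes off the half circle, in the angle `k φ`. -/
lemma exists_vanishesOff_arcs_one (ha : a < 1) {k : ℕ} (hk : 0 < k) {ω : Set S1}
    (hω : ω ∈ boundarySets k) {u : WeightedH1 a} (hu : u.VanishesOff ω) (hs : u.IsSymmetric k) :
    ∃ v : WeightedH1 a, v.VanishesOff (arcs 1) ∧ v.massForm v = u.massForm u ∧
      energyK k v v ≤ energyK 1 u u := by
  obtain ⟨g, hg, h0⟩ := hu
  obtain ⟨v, h1, h2, h3⟩ := exists_polarization ha (u := push ha hk u)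
    (hg.fibreAvg hk u.aestronglyMeasurable_fn) (fibreAvgCircle_mul_neg_eq_zero hk hω h0)
  exact ⟨v, h1, h2.trans (massForm_push_of_isSymmetric ha hk hs),
    (h3 k).trans (energyK_push_self_le ha hk u)⟩

lemma isNonzero_of_massForm_eq {u v : WeightedH1 a} (h : v.massForm v = u.massForm u)
    (hu : u.IsNonzero) : v.IsNonzero := by
  rw [isNonzero_iff]
  intro h0
  have := hu.massForm_pos
  rw [← h, massForm_self, h0] at this
  simp at this

lemma isSymmetric_one (u : WeightedH1 a) : u.IsSymmetric 1 := by
  intro i hi j hj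
  have hi : i = 1 := by simpa using hi
  have hj : j = 1 := by simpa using hj
  subst hi hj
  refine Eventually.of_forall fun z => ?_
  rw [circleRefl_circleRefl]
  simp

lemma Nonneg.pull (ha : a < 1) {k : ℕ} (hk : 0 < k) {U : WeightedH1 a} (h : U.Nonneg) :
    (WeightedH1.pull ha hk U).Nonneg := by
  refine ae_weightedArea_iff.mpr ?_
  exact (measurePreserving_cover (ν := thetaMeasure) hk).quasiMeasurePreserving.ae
    (p := fun z => 0 ≤ U.fn z) (ae_weightedArea_iff.mp h)

/-- The function `(sin θ)^{2s}`: it vanishes on the boundary circle, and its Rayleigh quotient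
is `4s`. -/
lemma exists_groundState_vanishesOff {s : ℝ} (hs0 : 0 < s) (hs1 : s < 1) :
    ∃ u : WeightedH1 (1 - 2 * s), u.IsNonzero ∧ u.VanishesOff ∅ ∧ (∀ k, u.IsSymmetric k) ∧
      ∀ κ, energyK κ u u = 4 * s * u.massForm u := by
  obtain ⟨u, e1, e2, e3⟩ := exists_groundState hs0 hs1
  refine ⟨u, ?_, ⟨0, ⟨MemLp.zero, ?_⟩, by simp⟩, ?_, fun κ => ?_⟩
  · intro h
    have h1 : ∀ᵐ z ∂coordMeasure, False := by
      filter_upwards [ae_weightedArea_iff.mp h, ae_coordMeasure_mem] with z hz hm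
      rw [e1] at hz
      exact (rpow_pos_of_pos (sin_pos_of_mem hm) _).ne' hz
    have h2 : coordMeasure univ = 0 := by
      simpa [ae_iff] using h1
    rw [coordMeasure, ← univ_prod_univ, Measure.prod_prod] at h2
    simp [AddCircle.measure_univ, pi_pos.not_ge] at h2
    linarith [pi_pos]
  · have hlim : Tendsto (fun ε : ℝ => ENNReal.ofReal (ε ^ (4 * s)) * ENNReal.ofReal (2 * π))
        (𝓝[>] 0) (𝓝 0) := by
      have h1 : Tendsto (fun ε : ℝ => ε ^ (4 * s)) (𝓝[>] 0) (𝓝 0) := by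
        have := (continuousAt_rpow_const 0 (4 * s) (Or.inr (by positivity))).tendsto
        rw [zero_rpow (by positivity)] at this
        exact this.mono_left nhdsWithin_le_nhds
      have := ENNReal.Tendsto.mul_const (b := ENNReal.ofReal (2 * π)) (ENNReal.tendsto_ofReal h1)
        (Or.inr ENNReal.ofReal_ne_top)
      simpa using this
    refine tendsto_of_tendsto_of_tendsto_of_le_of_le' tendsto_const_nhds hlim
      (Eventually.of_forall fun _ => zero_le) ?_
    filter_upwards [eventually_lt_half_pi] with ε hε
    have hvol : (volume : Measure (ℝ × S1)) (Ioo (0 : ℝ) ε ×ˢ (univ : Set S1)) =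
        ENNReal.ofReal ε * ENNReal.ofReal (2 * π) := by
      rw [Measure.volume_eq_prod, Measure.prod_prod, Real.volume_Ioo, AddCircle.measure_univ,
        sub_zero]
    calc _ ≤ (ENNReal.ofReal ε)⁻¹ *
        ∫⁻ z in Ioo (0 : ℝ) ε ×ˢ (univ : Set S1), ENNReal.ofReal (ε ^ (4 * s)) := by
          refine mul_le_mul' le_rfl (setLIntegral_mono' (measurableSet_Ioo.prod .univ) ?_)
          rintro z ⟨⟨h0, h1⟩, -⟩
          have hz : z.1 ∈ Ioo 0 (π / 2) := ⟨h0, h1.trans hε.2⟩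
          rw [Pi.zero_apply, sub_zero, e1, enorm_sq_eq_ofReal]
          refine ENNReal.ofReal_le_ofReal ?_
          rw [← rpow_natCast, ← rpow_mul (sin_pos_of_mem hz).le]
          calc _ = sin z.1 ^ (4 * s) := by congr 1; push_cast; ring
            _ ≤ ε ^ (4 * s) := rpow_le_rpow (sin_pos_of_mem hz).le
              ((sin_le h0.le).trans h1.le) (by positivity)
      _ = ((ENNReal.ofReal ε)⁻¹ * ENNReal.ofReal ε) *
          (ENNReal.ofReal (ε ^ (4 * s)) * ENNReal.ofReal (2 * π)) := by
          rw [setLIntegral_const, hvol]; ring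
      _ = _ := by
          rw [ENNReal.inv_mul_cancel (by simpa using hε.1) ENNReal.ofReal_ne_top, one_mul]
  · intro k i _ j _
    rw [e1]
    exact Eventually.of_forall fun z => rfl
  · have hphi : u.phiL2 = 0 := by
      rw [phiL2, ← MemLp.toLp_zero (MemLp.zero' (ε := ℝ) (p := 2)), MemLp.toLp_eq_toLp_iff, e3]
      exact Eventually.of_forall fun z => by simp
    rw [energyK, hphi, inner_zero_left, mul_zero, add_zero, thetaL2, inner_toLp, massForm, e1, e2]
    exact integral_groundState hs0

lemma four_mul_norm_sq_le {s : ℝ} (hs0 : 0 < s) (hs1 : s < 1) {u : WeightedH1 (1 - 2 * s)}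
    (h : u.VanishesOff ∅) : 4 * s * ‖u.valL2‖ ^ 2 ≤ ‖u.thetaL2‖ ^ 2 := by
  have := four_mul_normSq_le hs0 hs1 h
  rw [normSq_eq_norm_toLp u.memLp_fn, normSq_eq_norm_toLp u.memLp_dTheta,
    ← ENNReal.ofReal_mul (by positivity), ENNReal.ofReal_le_ofReal_iff (by positivity)] at this
  exact this

end WeightedH1

open WeightedH1

variable {s : ℝ}

lemma lambda1_eq (s : ℝ) (ω : Set S1) : lambda1 s ω = eigK (1 - 2 * s) 1 ω := by
  have : (WeightedH1.rayleigh : WeightedH1 (1 - 2 * s) → ℝ) = quotientK 1 := funext rayleigh_eq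
  rw [lambda1, eigK, this]; rfl

lemma eigK_empty (hs0 : 0 < s) (hs1 : s < 1) (κ : ℝ) : eigK (1 - 2 * s) κ ∅ = 4 * s := by
  obtain ⟨u, h0, hu, -, he⟩ := exists_groundState_vanishesOff hs0 hs1
  refine le_antisymm ((eigK_le h0 hu).trans_eq ?_) ?_
  · rw [quotientK, he, mul_div_cancel_right₀ _ h0.massForm_pos.ne']
  · refine le_csInf ⟨_, u, ⟨h0, hu⟩, rfl⟩ ?_
    rintro _ ⟨v, ⟨hv0, hv⟩, rfl⟩
    rw [quotientK, le_div_iff₀ hv0.massForm_pos, massForm_self, energyK_self]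
    have h1 := four_mul_norm_sq_le hs0 hs1 hv
    have : 0 ≤ κ ^ 2 * ‖v.phiL2‖ ^ 2 := by positivity
    linarith

lemma eigK_le_four_mul (hs0 : 0 < s) (hs1 : s < 1) (κ : ℝ) (ω : Set S1) :
    eigK (1 - 2 * s) κ ω ≤ 4 * s := by
  obtain ⟨u, h0, hu, -, he⟩ := exists_groundState_vanishesOff hs0 hs1
  refine (eigK_le h0 (hu.mono (empty_subset ω))).trans_eq ?_
  rw [quotientK, he, mul_div_cancel_right₀ _ h0.massForm_pos.ne']

lemma eigK_mono (hs0 : 0 < s) (hs1 : s < 1) {κ κ' : ℝ} (h0 : 0 ≤ κ) (h : κ ≤ κ') (ω : Set S1) :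
    eigK (1 - 2 * s) κ ω ≤ eigK (1 - 2 * s) κ' ω := by
  obtain ⟨u, hu0, hu, -⟩ := exists_groundState_vanishesOff hs0 hs1
  refine le_csInf ⟨_, u, ⟨hu0, hu.mono (empty_subset ω)⟩, rfl⟩ ?_
  rintro _ ⟨v, hv, rfl⟩
  refine (eigK_le hv.1 hv.2).trans ?_
  exact div_le_div_of_nonneg_right (energyK_mono h0 h v) hv.1.massForm_pos.le

lemma eigK_le_lambda1Sym (hs0 : 0 < s) (hs1 : s < 1) {k : ℕ} (hk : 0 < k) {ω : Set S1}
    (hω : ω ∈ boundarySets k) : eigK (1 - 2 * s) k (arcs 1) ≤ lambda1Sym s k ω := by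
  have ha : 1 - 2 * s < 1 := by linarith
  obtain ⟨u, hu0, hu, hus, -⟩ := exists_groundState_vanishesOff hs0 hs1
  refine le_csInf ⟨_, u, ⟨⟨hu0, hu.mono (empty_subset ω)⟩, hus k⟩, rfl⟩ ?_
  rintro _ ⟨v, ⟨⟨hv0, hv⟩, hvs⟩, rfl⟩
  obtain ⟨w, h1, h2, h3⟩ := exists_vanishesOff_arcs_one ha hk hω hv hvs
  rw [rayleigh_eq, quotientK, le_div_iff₀ hv0.massForm_pos, ← h2]
  exact (eigK_mul_le h1).trans h3

/-- The optimal eigenvalue is attained at the equally spaced arcs, by the pull-back of a nonnegative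
minimizer for the half circle. -/
lemma exists_pull_minimizer (hs0 : 0 < s) (hs1 : s < 1) {k : ℕ} (hk : 0 < k) :
    ∃ u ∈ admissibleSym s k (arcs k), u.Nonneg ∧ u.rayleigh = eigK (1 - 2 * s) k (arcs 1) ∧
      ∀ v : WeightedH1 (1 - 2 * s), v.VanishesOff (arcs k) →
        u.energyForm v = eigK (1 - 2 * s) k (arcs 1) * u.massForm v := by
  have ha : -1 < 1 - 2 * s := by linarith
  have ha' : 1 - 2 * s < 1 := by linarith
  obtain ⟨u₀, h00, hu₀, -⟩ := exists_groundState_vanishesOff hs0 hs1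
  obtain ⟨U, -, hU, hUn, hU1, hUe⟩ := exists_minimizer ha ha' (κ := k) (by exact_mod_cast hk)
    measurableSet_arcs_one ⟨u₀, h00, hu₀.mono (empty_subset _)⟩
  have hm : U.massForm U = 1 := by rw [massForm_self, hU1, one_pow]
  have hUz : U.IsNonzero := isNonzero_of_norm_eq_one hU1
  refine ⟨pull ha' hk U, ⟨⟨isNonzero_of_massForm_eq (massForm_pull_self ha' hk U) hUz,
    hU.pull ha' hk⟩, isSymmetric_pull ha' hk U⟩, hUn.pull ha' hk, ?_, fun v hv => ?_⟩
  · rw [rayleigh_eq, quotientK, energyK_pull_self, massForm_pull_self, hm, hUe, div_one]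
  · rw [energyForm_eq, energyK_pull, massForm_pull]
    exact energyK_eq_of_minimizer ha' hU (by rw [hUe, hm, mul_one]) (hv.push ha' hk)

lemma lambdaOpt_eq (hs0 : 0 < s) (hs1 : s < 1) {k : ℕ} (hk : 0 < k) :
    lambdaOpt s k = eigK (1 - 2 * s) k (arcs 1) := by
  refine le_antisymm ?_ (eigK_le_lambda1Sym hs0 hs1 hk (arcs_mem_boundarySets hk))
  obtain ⟨u, hu, -, hr, -⟩ := exists_pull_minimizer hs0 hs1 hk
  rw [← hr]
  refine csInf_le ⟨0, ?_⟩ ⟨u, hu, rfl⟩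
  rintro _ ⟨v, -, rfl⟩
  rw [rayleigh_eq]
  exact quotientK_nonneg 1 v

/-! ### The limit of many arcs -/

/-- A function without dependence on `φ` that vanishes off the half circle vanishes on the whole
circle. -/
lemma WeightedH1.VanishesOff.empty_of_phiL2_eq_zero {a : ℝ} (ha : a < 1) {u : WeightedH1 a}
    (h : u.VanishesOff (arcs 1)) (h0 : u.phiL2 = 0) : u.VanishesOff ∅ := by
  obtain ⟨v, hv, e⟩ := u.exists_measurable
  have hphi : v.dPhi =ᵐ[coordMeasure] 0 := by
    have h1 : v.phiL2 = 0 := e.phiL2.symm.trans h0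
    rw [phiL2, ← MemLp.toLp_zero (MemLp.zero' (ε := ℝ) (p := 2)), MemLp.toLp_eq_toLp_iff] at h1
    filter_upwards [ae_weightedArea_iff.mp h1, ae_coordMeasure_mem] with z hz hm
    simpa [(cos_pos_of_mem hm).ne'] using hz
  obtain ⟨c, -, hc⟩ := exists_eq_fst_of_weak_phi hv.fn (collarIntegrable_of_memLp ha v.memLp_fn)
    fun η hη => by
      rw [v.weak_dPhi η hη, integral_mul_congr hphi]; simp
  obtain ⟨g, hg, hg0⟩ := h
  have hgv := hg.congr e.fn
  have mp : MeasurePreserving (fun z : ℝ × S1 => (z.1, -z.2)) coordMeasure coordMeasure :=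
    measurePreserving_refl _
  have hrefl : (fun z : ℝ × S1 => v.fn (z.1, -z.2)) =ᵐ[coordMeasure] v.fn := by
    filter_upwards [hc, mp.quasiMeasurePreserving.ae (p := fun z => v.fn z = c z.1) hc] with z h1 h2
    rw [h1]; exact h2
  have hgn := (hgv.comp_snd measurePreserving_neg_circle v.aestronglyMeasurable_fn).congr hrefl
  have hg0' : ∀ᵐ y : S1, -y ∉ arcs 1 → g (-y) = 0 :=
    measurePreserving_neg_circle.quasiMeasurePreserving.ae
      (p := fun y => y ∉ arcs 1 → g y = 0) hg0
  refine ⟨g, hg, ?_⟩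
  filter_upwards [hgv.unique hv.fn hgn, hg0, hg0', ae_mem_arcs_one_iff] with y h1 h2 h3 h4 _
  by_cases hy : y ∈ arcs 1
  · rw [h1]; exact h3 (h4.mp hy)
  · exact h2 hy

lemma tendsto_eigK (hs0 : 0 < s) (hs1 : s < 1) :
    Tendsto (fun n : ℕ => eigK (1 - 2 * s) ((n + 1 : ℕ) : ℝ) (arcs 1)) atTop (𝓝 (4 * s)) := by
  have ha : -1 < 1 - 2 * s := by linarith
  have ha' : 1 - 2 * s < 1 := by linarith
  set Λ : ℕ → ℝ := fun n => eigK (1 - 2 * s) ((n + 1 : ℕ) : ℝ) (arcs 1) with hΛ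
  have hle : ∀ n, Λ n ≤ 4 * s := fun n => eigK_le_four_mul hs0 hs1 _ _
  have hmono : Monotone Λ := fun n m h => eigK_mono hs0 hs1 (Nat.cast_nonneg _)
    (by exact_mod_cast Nat.succ_le_succ h) _
  obtain ⟨L, hL⟩ : ∃ L, Tendsto Λ atTop (𝓝 L) :=
    ⟨_, tendsto_atTop_ciSup hmono ⟨4 * s, by rintro _ ⟨n, rfl⟩; exact hle n⟩⟩
  have hLle : L ≤ 4 * s := le_of_tendsto' hL hle
  suffices h : 4 * s ≤ L by rwa [← le_antisymm hLle h]
  obtain ⟨u₀, h00, hu₀, -⟩ := exists_groundState_vanishesOff hs0 hs1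
  have hcast : ∀ n : ℕ, (1 : ℝ) ≤ ((n + 1 : ℕ) : ℝ) := fun n => by
    exact_mod_cast Nat.succ_le_succ (Nat.zero_le n)
  choose U _ hU _ hU1 hUe using fun n : ℕ => exists_minimizer ha ha' (hcast n)
    measurableSet_arcs_one ⟨u₀, h00, hu₀.mono (empty_subset (arcs 1))⟩
  have hUe' : ∀ n, energyK ((n + 1 : ℕ) : ℝ) (U n) (U n) = Λ n := hUe
  have hE : ∀ n m, n ≤ m → energyK ((n + 1 : ℕ) : ℝ) (U m) (U m) ≤ Λ m := fun n m h =>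
    (energyK_mono (Nat.cast_nonneg _) (by exact_mod_cast Nat.succ_le_succ h) _).trans_eq (hUe' m)
  have hE1 : ∀ n, energyK 1 (U n) (U n) ≤ Λ n := fun n =>
    (energyK_mono zero_le_one (hcast n) _).trans_eq (hUe' n)
  obtain ⟨φ, hφ, v, l1, l2, l3⟩ := exists_limit_of_energyK_le ha ha' le_rfl (u := U)
    (R := 1 + 4 * s) (fun n => by rw [hU1]; linarith)
    (fun n => by have := hE1 n; have := hle n; nlinarith) (by positivity) (l := 4 * s)
    (e := fun p => 2 * (Λ p.2 - Λ p.1))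
    (by
      rw [← prod_atTop_atTop_eq]
      simpa using ((hL.comp tendsto_snd).sub (hL.comp tendsto_fst)).const_mul 2)
    (fun n m hnm => by
      refine (energyK_mono zero_le_one (hcast n) _).trans ?_
      refine (energyK_sub_le ha' (eigK_mul_le ((hU n).lin ha' (hU m) 1 1))).trans ?_
      change 2 * (_ - Λ n * _) + 2 * (_ - Λ n * _) + Λ n * _ ≤ _
      rw [massForm_self, massForm_self, hU1, hU1, hUe']
      have h1 := hE n m hnm
      have h2 : Λ n * ‖(U n).valL2 - (U m).valL2‖ ^ 2 ≤
          4 * s * ‖(U n).valL2 - (U m).valL2‖ ^ 2 := by gcongr; exact hle n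
      simp only
      linarith)
  have hv : v.VanishesOff (arcs 1) :=
    VanishesOff.of_tendsto ha ha' measurableSet_arcs_one (fun n => hU (φ n)) l1 l2
  have hv1 : ‖v.valL2‖ = 1 :=
    tendsto_nhds_unique l1.norm (tendsto_const_nhds.congr fun n => (hU1 (φ n)).symm)
  -- the `φ`-derivatives are bounded by `√(4s) / k`
  have hphi : v.phiL2 = 0 := by
    have h1 : Tendsto (fun n => ‖(U n).phiL2‖ ^ 2) atTop (𝓝 0) := by
      have t1 := (tendsto_one_div_add_atTop_nhds_zero_nat (𝕜 := ℝ)).const_mul (4 * s)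
      rw [mul_zero] at t1
      refine squeeze_zero (fun n => by positivity) (fun n => ?_) t1
      have h2 := (hUe' n).le.trans (hle n)
      rw [energyK_self] at h2
      have h3 := hcast n
      have h4 : ((n + 1 : ℕ) : ℝ) * ‖(U n).phiL2‖ ^ 2 ≤ ((n + 1 : ℕ) : ℝ) ^ 2 * ‖(U n).phiL2‖ ^ 2 := by
        gcongr; exact le_self_pow₀ h3 two_ne_zero
      have h5 : 0 ≤ ‖(U n).thetaL2‖ ^ 2 := by positivity
      rw [mul_one_div, le_div_iff₀ (by positivity)]
      push_cast at h2 h4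
      linarith
    have h2 := tendsto_nhds_unique (l3.norm.pow 2) (h1.comp hφ.tendsto_atTop)
    simpa using h2
  have hθ : ‖v.thetaL2‖ ^ 2 ≤ L := by
    refine le_of_tendsto_of_tendsto' (l2.norm.pow 2) (hL.comp hφ.tendsto_atTop) fun n => ?_
    refine le_trans ?_ (hE1 (φ n))
    rw [energyK_self]
    have : 0 ≤ (1 : ℝ) ^ 2 * ‖(U (φ n)).phiL2‖ ^ 2 := by positivity
    linarith
  have := four_mul_norm_sq_le hs0 hs1 (hv.empty_of_phiL2_eq_zero ha' hphi)
  rw [hv1, one_pow, mul_one] at this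
  exact this.trans hθ

end HemisphereEigenvalue

end

open HemisphereEigenvalue in
theorem mainTheorem6 (s : ℝ) (hs0 : 0 < s) (hs1 : s < 1) :
    -- one symmetry: the Rayleigh quotient of a minimizer can be lowered by passing to a half circle
    (∀ ω ∈ boundarySets 1,
      (∃ u ∈ admissible s ω, u.Nonneg ∧ u.rayleigh = lambda1 s ω) ∧
      ∀ u ∈ admissible s ω, u.rayleigh = lambda1 s ω →
        ∃ v ∈ admissible s (arcs 1), v.rayleigh ≤ u.rayleigh) ∧
    -- `k` symmetries: the arcs `ω_k` are optimal, with a nonnegative first eigenfunction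
    (∀ k : ℕ, 1 ≤ k →
      arcs k ∈ boundarySets k ∧
      IsLeast (lambda1Sym s k '' boundarySets k) (lambdaOpt s k) ∧
      ∃ u ∈ admissibleSym s k (arcs k), u.Nonneg ∧ u.rayleigh = lambdaOpt s k ∧
        ∀ v : WeightedH1 (1 - 2 * s), v.VanishesOff (arcs k) →
          u.energyForm v = lambdaOpt s k * u.massForm v) ∧
    -- the optimal eigenvalues are nondecreasing and converge to `λ₁^s(∅)`, of degree `2s`
    (∀ k : ℕ, 1 ≤ k → lambdaOpt s k ≤ lambdaOpt s (k + 1)) ∧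
    Tendsto (fun k : ℕ => lambdaOpt s k) atTop (𝓝 (lambda1 s ∅)) ∧
    charExponent 2 s (lambda1 s ∅) = 2 * s := by
  have ha : -1 < 1 - 2 * s := by linarith
  have ha' : 1 - 2 * s < 1 := by linarith
  refine ⟨fun ω hω => ⟨?_, fun u hu _ => ?_⟩, fun k hk => ⟨arcs_mem_boundarySets hk, ⟨?_, ?_⟩, ?_⟩,
    fun k hk => ?_, ?_, ?_⟩
  · obtain ⟨u₀, h0, hu₀, -⟩ := WeightedH1.exists_groundState_vanishesOff hs0 hs1
    obtain ⟨u, -, hu, hn, h1, he⟩ := exists_minimizer ha ha' le_rfl hω.1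
      ⟨u₀, h0, hu₀.mono (empty_subset ω)⟩
    refine ⟨u, ⟨isNonzero_of_norm_eq_one h1, hu⟩, hn, ?_⟩
    rw [WeightedH1.rayleigh_eq, WeightedH1.quotientK, he, WeightedH1.massForm_self, h1, one_pow,
      div_one, lambda1_eq]
  · obtain ⟨v, hv, hm, he⟩ :=
      WeightedH1.exists_vanishesOff_arcs_one ha' one_pos hω hu.2 u.isSymmetric_one
    refine ⟨v, ⟨WeightedH1.isNonzero_of_massForm_eq hm hu.1, hv⟩, ?_⟩
    rw [Nat.cast_one] at he
    rw [WeightedH1.rayleigh_eq, WeightedH1.rayleigh_eq, WeightedH1.quotientK, WeightedH1.quotientK,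
      hm]
    exact div_le_div_of_nonneg_right he hu.1.massForm_pos.le
  · exact ⟨arcs k, arcs_mem_boundarySets hk, rfl⟩
  · rintro _ ⟨ω, hω, rfl⟩
    rw [lambdaOpt_eq hs0 hs1 hk]
    exact eigK_le_lambda1Sym hs0 hs1 hk hω
  · rw [lambdaOpt_eq hs0 hs1 hk]
    exact exists_pull_minimizer hs0 hs1 hk
  · rw [lambdaOpt_eq hs0 hs1 hk, lambdaOpt_eq hs0 hs1 k.succ_pos]
    exact eigK_mono hs0 hs1 (Nat.cast_nonneg k) (by push_cast; linarith) _
  · rw [lambda1_eq, eigK_empty hs0 hs1, ← tendsto_add_atTop_iff_nat 1]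
    exact (tendsto_eigK hs0 hs1).congr fun n => (lambdaOpt_eq hs0 hs1 n.succ_pos).symm
  · rw [lambda1_eq, eigK_empty hs0 hs1, charExponent, Nat.cast_ofNat,
      show ((2 - 2 * s) / 2) ^ 2 + 4 * s = (1 + s) ^ 2 by ring, Real.sqrt_sq (by linarith)]
    ring
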